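/- Let $n\ge 2$, let $U\subset\mathbb{R}^n$ be open, let $f,g_1,g_2:U\to\mathbb{R}^n$ be smooth ($C^\infty$), and let $p\in U$. Consider the control system $$\dot x=f(x)+g_1(x)u_1+g_2(x)u_2,\qquad u=(u_1,u_2)\in\mathbb{R}^2 .$$ A distribution (codistribution) on $U$ is a $C^\infty(U)$-submodule $\Delta$ of the smooth vector fields (one-forms) on $U$, and $\Delta_q=\{X_q : X\in\Delta\}$ denotes its value at $q\in U$. For distributions $\Delta_1,\Delta_2$, let $[\Delta_1,\Delta_2]$ be the $C^\infty(U)$-span of all Lie brackets $[X,Y]$ with $X\in\Delta_1$, $Y\in\Delta_2$. Let $\Delta=\mathrm{span}_{C^\infty(U)}\{g_1,g_2\}$, and define its Lie flag $(F_k)$ and derived flag $(G_k)$ by $$F_0=G_0=\Delta,\qquad F_{k+1}=F_k+[F_k,F_0],\qquad G_{k+1}=G_k+[G_k,G_k].$$ For $1\le k\le n-3$ let $\Lambda^k=(G_k)^\perp$ be the codistribution of smooth one-forms on $U$ that annihilate $G_k$. For a codistribution $\Lambda$ and $q\in U$ let $$A(\Lambda)_q=\{X_q\in T_qU : \langle\lambda_q,X_q\rangle=0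 \text{ and } X_q\lrcorner\, d\lambda_q\in\Lambda_q \text{ for all }\lambda\in\Lambda\},\qquad C(\Lambda)_q=(A(\Lambda)_q)^\perp\subset T_q^*U$$ be the Cauchy characteristic space and the retracting space of $\Lambda$ at $q$. **Theorem.** There exist an open neighbourhood $V\subset U$ of $p$, a change of coordinates $z=\varphi(x)$ on $V$ (a smooth diffeomorphism of $V$ onto an open subset of $\mathbb{R}^n$) and a regular static state feedback $u=\alpha(x)+\beta(x)v$ on $V$ (with $\alpha:V\to\mathbb{R}^2$ and $\beta:V\to\mathbb{R}^{2\times2}$ smooth and $\beta(x)$ invertible for all $x\in V$) such that the closed-loop system in the coordinates $z=(z_1,\dots,z_n)$ has the triangular form $$\begin{aligned}\dot z_i&=\phi_i(z_1,\dots,z_{i+1},z_n)+z_{i+1}v_1\qquad(1\le i\le n-2),\\ \dot z_{n-1}&=v_2,\\ \dot z_n&=v_1,\end{aligned}$$ for some smooth functions $\phi_1,\dots,\phi_{n-2}$, **if and only if** there exists an open neighbourhood $W\subset U$ of $p$ such that 1. $\dim (F_k)_q=\dim (G_k)_q=2+k$ for all $0\le k\le n-2$ and $q\in W$; 2. $(L_f\omega)_q\in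 C(\Lambda^k)_q$ for all $1\le k\le n-3$, $q\in W$ and $\omega\in\Lambda^k$, where $L_f$ denotes the Lie derivative. -/

import Mathlib

open scoped ContDiff

namespace FlatTriangular

section General

variable {E : Type*} [NormedAddCommGroup E] [NormedSpace ℝ E]
  {F : Type*} [NormedAddCommGroup F] [NormedSpace ℝ F]

/-- The ring `C^∞(U)`. A function on `U` is represented by a function on the whole space whose
values outside `U` are irrelevant (and arbitrary); the same convention is used for vector fields
`E → E` and one-forms `E → (E →L[ℝ] ℝ)`. -/
def smoothFunctions (U : Set E) : Subalgebra ℝ (E → ℝ) where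
  carrier := {a | ContDiffOn ℝ ∞ a U}
  mul_mem' ha hb := ContDiffOn.mul ha hb
  add_mem' ha hb := ContDiffOn.add ha hb
  algebraMap_mem' _ := contDiffOn_const

/-- The `C^∞(U)`-module of smooth maps `U → F`: the vector fields on `U` for `F = E`, the one-forms
on `U` for `F = (E →L[ℝ] ℝ)`. -/
def smoothMaps (U : Set E) (F : Type*) [NormedAddCommGroup F] [NormedSpace ℝ F] :
    Submodule (smoothFunctions U) (E → F) where
  carrier := {X | ContDiffOn ℝ ∞ X U}
  add_mem' ha hb := ContDiffOn.add ha hb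
  zero_mem' := contDiffOn_const
  smul_mem' c _ hX := ContDiffOn.smul c.2 hX

/-- The distribution on `U`, i.e. the `C^∞(U)`-submodule, generated by two vector fields. -/
def distributionSpan (U : Set E) (g₁ g₂ : E → E) : Submodule (smoothFunctions U) (E → E) :=
  Submodule.span (smoothFunctions U) {g₁, g₂}

/-- The distribution `[Δ₁, Δ₂]`: the `C^∞(U)`-span of all Lie brackets `[X, Y]` with
`X ∈ Δ₁` and `Y ∈ Δ₂`. -/
def bracket {U : Set E} (Δ₁ Δ₂ : Submodule (smoothFunctions U) (E → E)) :
    Submodule (smoothFunctions U) (E → E) :=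
  Submodule.span (smoothFunctions U)
    {Z | ∃ X ∈ Δ₁, ∃ Y ∈ Δ₂, Z = VectorField.lieBracket ℝ X Y}

/-- The Lie flag of `Δ`: `F₀ = Δ`, `F_{k+1} = F_k + [F_k, F₀]`. -/
def lieFlag {U : Set E} (Δ : Submodule (smoothFunctions U) (E → E)) :
    ℕ → Submodule (smoothFunctions U) (E → E)
  | 0 => Δ
  | k + 1 => lieFlag Δ k ⊔ bracket (lieFlag Δ k) Δ

/-- The derived flag of `Δ`: `G₀ = Δ`, `G_{k+1} = G_k + [G_k, G_k]`. -/
def derivedFlag {U : Set E} (Δ : Submodule (smoothFunctions U) (E → E)) :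
    ℕ → Submodule (smoothFunctions U) (E → E)
  | 0 => Δ
  | k + 1 => derivedFlag Δ k ⊔ bracket (derivedFlag Δ k) (derivedFlag Δ k)

/-- The value `Δ_q = {X q | X ∈ Δ}` of a distribution (or codistribution) at a point. -/
def fiber {U : Set E} (Δ : Submodule (smoothFunctions U) (E → F)) (q : E) : Submodule ℝ F where
  carrier := {v | ∃ X ∈ Δ, X q = v}
  add_mem' := by
    rintro _ _ ⟨X, hX, rfl⟩ ⟨Y, hY, rfl⟩
    exact ⟨X + Y, Δ.add_mem hX hY, rfl⟩
  zero_mem' := ⟨0, Δ.zero_mem, rfl⟩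
  smul_mem' := by
    rintro c _ ⟨X, hX, rfl⟩
    exact ⟨algebraMap ℝ (smoothFunctions U) c • X, Δ.smul_mem _ hX, rfl⟩

/-- The codistribution `Δ^⊥`: the smooth one-forms on `U` annihilating every field in `Δ`. -/
def annihilator {U : Set E} (Δ : Submodule (smoothFunctions U) (E → E)) :
    Submodule (smoothFunctions U) (E → (E →L[ℝ] ℝ)) where
  carrier := {θ | θ ∈ smoothMaps U (E →L[ℝ] ℝ) ∧ ∀ X ∈ Δ, ∀ q ∈ U, θ q (X q) = 0}
  add_mem' := by
    rintro θ η ⟨hθ, hθ'⟩ ⟨hη, hη'⟩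
    exact ⟨add_mem hθ hη, fun X hX q hq => by simp [hθ' X hX q hq, hη' X hX q hq]⟩
  zero_mem' := ⟨zero_mem _, fun X hX q hq => by simp⟩
  smul_mem' := by
    rintro c θ ⟨hθ, hθ'⟩
    refine ⟨Submodule.smul_mem _ c hθ, fun X hX q hq => ?_⟩
    change (c : E → ℝ) q • θ q (X q) = 0
    rw [hθ' X hX q hq, smul_zero]

/-- The exterior derivative of a one-form, as an alternating bilinear form at each point. -/
noncomputable def extDerivOneForm (θ : E → (E →L[ℝ] ℝ)) (q : E) : E [⋀^Fin 2]→L[ℝ] ℝ :=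
  extDeriv (fun x => ContinuousAlternatingMap.ofSubsingleton ℝ E ℝ (0 : Fin 1) (θ x)) q

theorem extDerivOneForm_apply {θ : E → (E →L[ℝ] ℝ)} {q : E} (h : DifferentiableAt ℝ θ q)
    (X Y : E) :
    extDerivOneForm θ q ![X, Y] = fderiv ℝ θ q X Y - fderiv ℝ θ q Y X := by
  have h' : DifferentiableAt ℝ
      (fun x => ContinuousAlternatingMap.ofSubsingleton ℝ E ℝ (0 : Fin 1) (θ x)) q :=
    (ContinuousAlternatingMap.ofSubsingletonLIE (𝕜 := ℝ) (E := E) (F := ℝ)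
      (0 : Fin 1)).differentiableAt.comp q h
  have key : ∀ Z W : E, fderiv ℝ (fun x => θ x Z) q W = fderiv ℝ θ q W Z := fun Z W => by
    rw [fderiv_clm_apply h (differentiableAt_const Z)]
    simp
  rw [extDerivOneForm, extDeriv_apply h', Fin.sum_univ_two]
  simp [Fin.removeNth, key, sub_eq_add_neg]

/-- The Lie derivative `L_X θ` of a one-form along a vector field. In coordinates
`(L_X θ)_i = ∑ j, (X_j ∂_j θ_i + θ_j ∂_i X_j)`. -/
noncomputable def lieDerivOneForm (X : E → E) (θ : E → (E →L[ℝ] ℝ)) (q : E) : E →L[ℝ] ℝ :=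
  fderiv ℝ θ q (X q) + (θ q).comp (fderiv ℝ X q)

/-- Cartan's formula `L_X θ = X ⌟ dθ + d⟨θ, X⟩`. -/
theorem lieDerivOneForm_apply {X : E → E} {θ : E → (E →L[ℝ] ℝ)} {q : E}
    (hθ : DifferentiableAt ℝ θ q) (hX : DifferentiableAt ℝ X q) (Y : E) :
    lieDerivOneForm X θ q Y =
      extDerivOneForm θ q ![X q, Y] + fderiv ℝ (fun x => θ x (X x)) q Y := by
  rw [extDerivOneForm_apply hθ, fderiv_clm_apply hθ hX, lieDerivOneForm]
  simp

/-- The Cauchy characteristic space (associated space) `A(Λ)_q` of a codistribution: the vectors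
`v` that annihilate `Λ_q` and for which the interior product `v ⌟ dθ_q` lies in `Λ_q` for all
`θ ∈ Λ`. -/
def cauchyCharSpace {U : Set E} (Λ : Submodule (smoothFunctions U) (E → (E →L[ℝ] ℝ))) (q : E) :
    Submodule ℝ E where
  carrier := {v | ∀ θ ∈ Λ, θ q v = 0 ∧ ∃ ξ ∈ fiber Λ q, ∀ w, extDerivOneForm θ q ![v, w] = ξ w}
  add_mem' := by
    intro v v' hv hv' θ hθ
    obtain ⟨h1, ξ, hξ, h2⟩ := hv θ hθ
    obtain ⟨h1', ξ', hξ', h2'⟩ := hv' θ hθ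
    refine ⟨by simp [h1, h1'], ξ + ξ', add_mem hξ hξ', fun w => ?_⟩
    rw [(extDerivOneForm θ q).vecCons_add, h2, h2', add_apply]
  zero_mem' := by
    intro θ _
    refine ⟨by simp, 0, zero_mem _, fun w => ?_⟩
    exact (extDerivOneForm θ q).map_coord_zero 0 rfl
  smul_mem' := by
    intro c v hv θ hθ
    obtain ⟨h1, ξ, hξ, h2⟩ := hv θ hθ
    refine ⟨by simp [h1], c • ξ, Submodule.smul_mem _ c hξ, fun w => ?_⟩
    rw [(extDerivOneForm θ q).vecCons_smul, h2, smul_apply]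

/-- For a codistribution spanned by a family `S` of one-forms, the conditions defining the Cauchy
characteristic space need only be tested on `S`. -/
theorem mem_cauchyCharSpace_span {U : Set E} (hU : IsOpen U) {S : Set (E → (E →L[ℝ] ℝ))}
    (hS : S ⊆ smoothMaps U (E →L[ℝ] ℝ)) {q : E} (hq : q ∈ U) (v : E) :
    v ∈ cauchyCharSpace (Submodule.span (smoothFunctions U) S) q ↔
      ∀ θ ∈ S, θ q v = 0 ∧ ∃ ξ ∈ fiber (Submodule.span (smoothFunctions U) S) q,
        ∀ w, extDerivOneForm θ q ![v, w] = ξ w := by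
  refine ⟨fun h θ hθ => h θ (Submodule.subset_span hθ), fun h θ hθ => ?_⟩
  have hle : Submodule.span (smoothFunctions U) S ≤ smoothMaps U _ := Submodule.span_le.2 hS
  have hd : ∀ θ ∈ Submodule.span (smoothFunctions U) S, DifferentiableAt ℝ θ q := fun θ hθ =>
    (ContDiffOn.contDiffAt (hle hθ) (hU.mem_nhds hq)).differentiableAt (by simp)
  induction hθ using Submodule.span_induction with
  | mem θ hθ => exact h θ hθ
  | zero =>
    refine ⟨rfl, 0, zero_mem _, fun w => ?_⟩
    rw [extDerivOneForm_apply (hd 0 (zero_mem _))]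
    have e : fderiv ℝ (0 : E → E →L[ℝ] ℝ) q = 0 := fderiv_const_apply _
    simp [e]
  | add a b ha hb iha ihb =>
    obtain ⟨h1, ξ, hξ, h2⟩ := iha
    obtain ⟨h1', ξ', hξ', h2'⟩ := ihb
    refine ⟨by simp [h1, h1'], ξ + ξ', add_mem hξ hξ', fun w => ?_⟩
    rw [extDerivOneForm_apply (hd _ (add_mem ha hb)), fderiv_add (hd a ha) (hd b hb),
      add_apply ξ, ← h2, ← h2', extDerivOneForm_apply (hd a ha), extDerivOneForm_apply (hd b hb)]
    simp
    ring
  | smul c a ha ih =>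
    obtain ⟨h1, ξ, hξ, h2⟩ := ih
    have hc : DifferentiableAt ℝ (c : E → ℝ) q :=
      (ContDiffOn.contDiffAt c.2 (hU.mem_nhds hq)).differentiableAt (by simp)
    have h0 : (c • a) q v = (c : E → ℝ) q • a q v := rfl
    refine ⟨by simp [h0, h1], (fderiv ℝ (c : E → ℝ) q v) • a q + (c : E → ℝ) q • ξ,
      add_mem (Submodule.smul_mem _ _ ⟨a, ha, rfl⟩) (Submodule.smul_mem _ _ hξ), fun w => ?_⟩
    have e : fderiv ℝ (c • a) q =
        (c : E → ℝ) q • fderiv ℝ a q + (fderiv ℝ (c : E → ℝ) q).smulRight (a q) :=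
      fderiv_smul hc (hd a ha)
    have h3 := h2 w
    rw [extDerivOneForm_apply (hd a ha)] at h3
    rw [extDerivOneForm_apply (hd _ (Submodule.smul_mem _ c ha)), e]
    simp [h1, ← h3]
    ring

/-- The retracting space `C(Λ)_q = (A(Λ)_q)^⊥`, a space of covectors at `q`. -/
def retractingSpace {U : Set E} (Λ : Submodule (smoothFunctions U) (E → (E →L[ℝ] ℝ))) (q : E) :
    Submodule ℝ (E →L[ℝ] ℝ) where
  carrier := {ξ | ∀ v ∈ cauchyCharSpace Λ q, ξ v = 0}
  add_mem' := by
    intro ξ η hξ hη v hv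
    simp [hξ v hv, hη v hv]
  zero_mem' := by
    intro v _
    simp
  smul_mem' := by
    intro c ξ hξ v hv
    simp [hξ v hv]

end General

section TriangularForm

/-- The right-hand side, at the state `z = (z₁, …, z_n)` and the control `v = (v₁, v₂)`, of the
triangular form
`ż_i = φ_i(z) + z_{i+1} v₁` for `1 ≤ i ≤ n - 2`, `ż_{n-1} = v₂`, `ż_n = v₁`.
Coordinates are numbered from `0` here, so that `z_i` is `z ⟨i - 1, _⟩`. -/
def triangularField {n : ℕ} (φ : Fin n → (Fin n → ℝ) → ℝ) (z : Fin n → ℝ) (v : Fin 2 → ℝ) :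
    Fin n → ℝ := fun i =>
  if h : i.val + 2 < n then φ i z + z ⟨i.val + 1, by omega⟩ * v 0
  else if i.val + 2 = n then v 1
  else v 0

/-- The functions `φ₁, …, φ_{n-2}` are smooth on `O` and `φ_i` depends only on the coordinates
`z₁, …, z_{i+1}, z_n` there (numbered from `0`: the coordinates `0, …, i + 1` and `n - 1`). -/
def IsTriangularDrift {n : ℕ} (O : Set (Fin n → ℝ)) (φ : Fin n → (Fin n → ℝ) → ℝ) : Prop :=
  ∀ i : Fin n, i.val + 2 < n →
    ContDiffOn ℝ ∞ (φ i) O ∧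
    ∀ z ∈ O, ∀ w ∈ O,
      (∀ j : Fin n, (j.val ≤ i.val + 1 ∨ j.val + 1 = n) → z j = w j) → φ i z = φ i w

/-- On some open neighbourhood `V ⊆ U` of `p` there are a change of coordinates `z = ψ x` (a
smooth diffeomorphism of `V` onto an open set) and a regular static state feedback
`u = α x + β x v` such that the closed-loop system obtained from `ẋ = f + g₁ u₁ + g₂ u₂` reads, in
the coordinates `z`, as the triangular form. -/
def IsLocallyTriangularizable {n : ℕ} (U : Set (Fin n → ℝ))
    (f g₁ g₂ : (Fin n → ℝ) → (Fin n → ℝ)) (p : Fin n → ℝ) : Prop :=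
  ∃ (ψ : OpenPartialHomeomorph (Fin n → ℝ) (Fin n → ℝ))
    (α : (Fin n → ℝ) → (Fin 2 → ℝ)) (β : (Fin n → ℝ) → Matrix (Fin 2) (Fin 2) ℝ)
    (φ : Fin n → (Fin n → ℝ) → ℝ),
    p ∈ ψ.source ∧ ψ.source ⊆ U ∧
    ContDiffOn ℝ ∞ ψ ψ.source ∧ ContDiffOn ℝ ∞ ψ.symm ψ.target ∧
    ContDiffOn ℝ ∞ α ψ.source ∧ (∀ i j, ContDiffOn ℝ ∞ (fun x => β x i j) ψ.source) ∧
    (∀ x ∈ ψ.source, IsUnit (β x)) ∧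
    IsTriangularDrift ψ.target φ ∧
    ∀ x ∈ ψ.source, ∀ v u : Fin 2 → ℝ, u = α x + (β x).mulVec v →
      fderiv ℝ ψ x (f x + u 0 • g₁ x + u 1 • g₂ x) = triangularField φ (ψ x) v

end TriangularForm

end FlatTriangular

/-!
Coordinates are numbered from `0`, `r = n - 2`, and the last coordinate is called `h`. Everything
rests on the contact forms `θ_i = dz_i - z_{i+1} dh`, for which `dθ_i = -dz_{i+1} ∧ dh`.

**From the conditions to the triangular form.** Let `G_k` be the derived flag and `C_k` the Cauchy
characteristic space of its annihilator. Because the Lie flag and the derived flag both grow by one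
dimension at each step, the bracket `G_{k+1} × G_{k+1} → G_{k+2} / G_{k+1}` has rank two, so that
`C_{k+1} ⊆ G_k` has codimension one in `G_k` (`IsRegularFlag.sub_smul_mem_charSpace`,
`IsRegularFlag.finrank_charSpace`). The Jacobi identity shows that the spaces `C_k` increase with
`k` and are involutive. The Frobenius theorem, applied to the largest of them, gives a function `h`
that is constant along all `C_{k+1}` but not along `Δ`
(`IsRegularFlag.exists_characteristic_integral`).

Choose a frame `b₁`, `b₂` of `Δ` with `dh(b₁) = 1` and `dh(b₂) = 0`, and let `c_0 = b₂`,
`c_{k+1} = [b₁, c_k]`. Then `G_k ∩ ker dh` is spanned by `c_0, …, c_k` and is involutive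
(`IsAdaptedFrame.fiber_derivedFlag_le`, `IsAdaptedFrame.lieBracket_iterBracket_mem`), so the
Frobenius theorem gives a function `y` that is constant along `c_0, …, c_{r-1}` but not along `c_r`.
The successive derivatives `z_i` of `y` along `b₁`, together with `h`, are coordinates in which
`θ_0, …, θ_{r-k-1}` annihilate `G_k`. By Cartan's formula `L_f θ_i = f ⌟ dθ_i + d⟨θ_i, f⟩`, the
condition on `L_f` says that the drift terms `φ_i = ⟨θ_i, f⟩` do not vary in the directions of
`z_{i+2}, …, z_r` (`IsFlatOutput.fderiv_contactForm_apply_eq_zero`). A feedback that turns the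
equations of `z_r` and `h` into `v₂` and `v₁` completes the triangular form.

**From the triangular form to the conditions.** The closed-loop equation is affine in `v`, and its
linear part exhibits a frame of `Δ` of the form `b₁ = ∑ z_{i+1} ∂_i + ∂_h`, `b₂ = ∂_r`. The formula
for `dθ_i` shows by induction that `G_k` lies in the common kernel of `θ_0, …, θ_{r-k-1}`, which
has dimension at most `2 + k`, and brackets with `b₁` show that already the Lie flag fills it
(`IsChainedFrame.fiber_lieFlag`). Cauchy characteristic vectors of this kernel have no components
along `∂_0, …, ∂_{r-k}` and `∂_h`; the bracket of `f` with such a constant field is seen by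
`θ_i` only through the derivative of `φ_i`, which vanishes by triangularity
(`IsChainedFrame.lieDerivOneForm_mem_retractingSpace`).

**The Frobenius theorem** is proved in the form needed (`exists_first_integral`). Normalize the
involutive frame to `S` with `P ∘ S = id` for a fixed linear map `P`; its fields then commute.
The solution of `u' = S(u) (P p - P q)`, `u(0) = q`, runs inside the leaf of `q` and reaches the
slice `P = P p` at time `1`, so `q ↦ η (u 1)` is a first integral for any linear `η`. Smoothness
in `q` comes from the inverse function theorem in the Banach space `C([0, 1], E)`, where the
superposition operator `γ ↦ S ∘ γ` is smooth.
-/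

namespace FlatTriangular

open Set Filter Topology unitInterval VectorField Module

/-! ### Smooth local inverses -/

section SmoothInverse

/-- The inverse function theorem with a domain on which the inverse is smooth throughout, not only
at the image of `a`. -/
theorem exists_smooth_openPartialHomeomorph {E F : Type*} [NormedAddCommGroup E] [NormedSpace ℝ E]
    [CompleteSpace E] [NormedAddCommGroup F] [NormedSpace ℝ F] {f : E → F} {N : Set E} {a : E}
    (hN : IsOpen N) (ha : a ∈ N) (hf : ContDiffOn ℝ ∞ f N) (f' : E ≃L[ℝ] F)
    (hf' : HasFDerivAt f (f' : E →L[ℝ] F) a) :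
    ∃ e : OpenPartialHomeomorph E F, a ∈ e.source ∧ e.source ⊆ N ∧ (∀ x, e x = f x) ∧
      ContDiffOn ℝ ∞ e.symm e.target := by
  have hfa : ContDiffAt ℝ ∞ f a := hf.contDiffAt (hN.mem_nhds ha)
  set e₀ := hfa.toOpenPartialHomeomorph f hf' (by simp) with he₀
  have hcont : ContinuousOn (fderiv ℝ f) N := hf.continuousOn_fderiv_of_isOpen hN (by simp)
  have hO : IsOpen (N ∩ fderiv ℝ f ⁻¹' range ((↑) : (E ≃L[ℝ] F) → E →L[ℝ] F)) :=
    hcont.isOpen_inter_preimage hN (ContinuousLinearEquiv.isOpen)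
  refine ⟨e₀.restrOpen _ hO, ⟨hfa.mem_toOpenPartialHomeomorph_source hf' (by simp), ha, ?_⟩,
    fun x hx => hx.2.1, fun x => rfl, ?_⟩
  · exact ⟨f', hf'.fderiv.symm⟩
  · intro y hy
    have hx := (e₀.restrOpen _ hO).map_target hy
    obtain ⟨A, hA⟩ := hx.2.2
    have h1 : ContDiffAt ℝ ∞ f ((e₀.restrOpen _ hO).symm y) := hf.contDiffAt (hN.mem_nhds hx.2.1)
    refine (OpenPartialHomeomorph.contDiffAt_symm (e₀.restrOpen _ hO) hy (f₀' := A) ?_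
      h1).contDiffWithinAt
    rw [hA]
    exact (h1.differentiableAt (by simp)).hasFDerivAt

end SmoothInverse

/-! ### Superposition operators on spaces of continuous curves -/

section Superposition

/-- Pointwise evaluation of a continuous family of continuous linear maps on a continuous family
of vectors, as a bounded bilinear operation on spaces of continuous maps. -/
noncomputable def pointwiseApply (K : Type*) [TopologicalSpace K] [CompactSpace K] (E F : Type*)
    [NormedAddCommGroup E] [NormedSpace ℝ E] [NormedAddCommGroup F] [NormedSpace ℝ F] :
    C(K, E →L[ℝ] F) →L[ℝ] C(K, E) →L[ℝ] C(K, F) :=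
  LinearMap.mkContinuous₂
    (LinearMap.mk₂ ℝ
      (fun (A : C(K, E →L[ℝ] F)) (η : C(K, E)) => (⟨fun t => A t (η t), by fun_prop⟩ : C(K, F)))
      (fun _ _ _ => by ext; simp) (fun _ _ _ => by ext; simp)
      (fun _ _ _ => by ext; simp) (fun _ _ _ => by ext; simp)) 1 (fun A η => by
        rw [ContinuousMap.norm_le _ (by positivity)]
        intro t
        have h1 := (A t).le_opNorm (η t)
        have h2 := A.norm_coe_le_norm t
        have h3 := η.norm_coe_le_norm t
        simp only [LinearMap.mk₂_apply, ContinuousMap.coe_mk, one_mul]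
        exact h1.trans (mul_le_mul h2 h3 (norm_nonneg _) ((norm_nonneg _).trans h2)))

variable {K : Type*} [TopologicalSpace K] {E F : Type*} [NormedAddCommGroup E]
  [NormedAddCommGroup F]

/-- The superposition operator `γ ↦ g ∘ γ` on continuous maps out of a compact space. -/
def superposition (K : Type*) [TopologicalSpace K] (g : C(E, F)) (γ : C(K, E)) : C(K, F) :=
  g.comp γ

@[simp]
theorem superposition_apply (g : C(E, F)) (γ : C(K, E)) (t : K) :
    superposition K g γ t = g (γ t) := rfl

variable [CompactSpace K] [NormedSpace ℝ E] [NormedSpace ℝ F]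

@[simp]
theorem pointwiseApply_apply (A : C(K, E →L[ℝ] F)) (η : C(K, E)) (t : K) :
    pointwiseApply K E F A η t = A t (η t) := rfl

/-- The derivative of the superposition operator is multiplication by the derivative of `g` along
the curve. -/
theorem hasFDerivAt_superposition (g : C(E, F)) (g' : C(E, E →L[ℝ] F))
    (hg : ∀ x, HasFDerivAt g (g' x) x) (γ : C(K, E)) :
    HasFDerivAt (superposition K g) (pointwiseApply K E F (superposition K g' γ)) γ := by
  rw [hasFDerivAt_iff_isLittleO_nhds_zero, Asymptotics.isLittleO_iff]
  intro ε hε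
  have hc : Continuous (superposition K g') := ContinuousMap.continuous_postcomp g'
  obtain ⟨δ, hδ, h⟩ := Metric.continuous_iff.1 hc γ ε hε
  filter_upwards [Metric.ball_mem_nhds (0 : C(K, E)) hδ] with η hη
  rw [ContinuousMap.norm_le _ (by positivity)]
  intro t
  have hseg : ∀ x ∈ segment ℝ (γ t) (γ t + η t), ‖g' x - g' (γ t)‖ ≤ ε := by
    intro x hx
    rw [segment_eq_image'] at hx
    obtain ⟨s, hs, rfl⟩ := hx
    have hs1 : dist (γ + s • η) γ < δ := by
      rw [dist_eq_norm, add_sub_cancel_left, norm_smul]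
      have : ‖η‖ < δ := by simpa using hη
      have h0 : ‖s‖ ≤ 1 := by rw [Real.norm_of_nonneg hs.1]; exact hs.2
      nlinarith [norm_nonneg η, norm_nonneg s]
    have h2 := (h _ hs1).le
    rw [dist_eq_norm] at h2
    have h3 := ((superposition K g' (γ + s • η)) - superposition K g' γ).norm_coe_le_norm t
    simp only [ContinuousMap.sub_apply, superposition_apply, ContinuousMap.add_apply,
      ContinuousMap.smul_apply] at h3
    simp only [add_sub_cancel_left]
    exact h3.trans h2
  have := (convex_segment (𝕜 := ℝ) (γ t) (γ t + η t)).norm_image_sub_le_of_norm_hasFDerivWithin_le'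
    (f := g) (f' := fun x => g' x) (φ := g' (γ t)) (C := ε)
    (fun x _ => (hg x).hasFDerivWithinAt) hseg (left_mem_segment ..) (right_mem_segment ..)
  simp only [add_sub_cancel_left] at this
  simp only [ContinuousMap.sub_apply, superposition_apply, ContinuousMap.add_apply,
    pointwiseApply_apply]
  exact this.trans (mul_le_mul_of_nonneg_left (η.norm_coe_le_norm t) hε.le)

end Superposition

section SuperpositionSmooth

universe u
variable {K : Type*} [TopologicalSpace K] [CompactSpace K]
variable {E : Type u} [NormedAddCommGroup E] [NormedSpace ℝ E]

/-- The derivative of `γ ↦ g ∘ γ` is expressed by the superposition operator of `g'`, which is `C^m`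
by induction. Source and target lie in one universe so that the induction covers `E →L[ℝ] F`. -/
theorem contDiff_superposition_nat (m : ℕ) {F : Type u} [NormedAddCommGroup F] [NormedSpace ℝ F]
    (g : C(E, F)) (hg : ContDiff ℝ ∞ g) : ContDiff ℝ m (superposition K g) := by
  induction m generalizing F with
  | zero =>
    exact contDiff_zero.2 (ContinuousMap.continuous_postcomp g)
  | succ m ih =>
    have hg' : ContDiff ℝ ∞ (fderiv ℝ g) := hg.fderiv_right (by simp)
    refine (contDiff_succ_iff_hasFDerivAt (n := m)).2
      ⟨fun γ => pointwiseApply K E F (superposition K ⟨fderiv ℝ g, hg'.continuous⟩ γ), ?_, ?_⟩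
    · exact (pointwiseApply K E F).contDiff.comp (ih ⟨fderiv ℝ g, hg'.continuous⟩ hg')
    · intro γ
      exact hasFDerivAt_superposition g ⟨fderiv ℝ g, hg'.continuous⟩
        (fun x => (hg.differentiable (by simp) x).hasFDerivAt) γ

theorem contDiff_superposition {F : Type u} [NormedAddCommGroup F] [NormedSpace ℝ F]
    (g : C(E, F)) (hg : ContDiff ℝ ∞ g) : ContDiff ℝ ∞ (superposition K g) :=
  contDiff_infty.2 fun m => contDiff_superposition_nat m g hg

end SuperpositionSmooth

/-! ### Primitives of curves -/

section Primitive

variable {E : Type*} [NormedAddCommGroup E] [NormedSpace ℝ E]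

/-- The primitive operator `η ↦ (t ↦ ∫₀ᵗ η)` on `C([0, 1], E)`. -/
noncomputable def primitive (E : Type*) [NormedAddCommGroup E] [NormedSpace ℝ E] :
    C(I, E) →L[ℝ] C(I, E) :=
  LinearMap.mkContinuous
    { toFun := fun η => ⟨fun t => ∫ s in (0 : ℝ)..t, IccExtend zero_le_one η s,
        (intervalIntegral.continuous_primitive
          (fun a b => (η.continuous.Icc_extend' (h := zero_le_one)).intervalIntegrable a b)
            0).comp continuous_subtype_val⟩
      map_add' := fun η ξ => by
        ext t
        exact intervalIntegral.integral_add
          ((η.continuous.Icc_extend' (h := zero_le_one)).intervalIntegrable _ _)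
          ((ξ.continuous.Icc_extend' (h := zero_le_one)).intervalIntegrable _ _)
      map_smul' := fun c η => by
        ext t
        exact intervalIntegral.integral_smul c _ } 1 (fun η => by
      rw [ContinuousMap.norm_le _ (by positivity)]
      intro t
      have := intervalIntegral.norm_integral_le_of_norm_le_const (a := (0 : ℝ)) (b := t)
        (f := IccExtend zero_le_one η) (C := ‖η‖) (fun s _ => η.norm_coe_le_norm _)
      refine this.trans ?_
      rw [sub_zero, abs_of_nonneg t.2.1, mul_comm]
      exact mul_le_mul_of_nonneg_right t.2.2 (norm_nonneg _))

theorem primitive_apply (η : C(I, E)) (t : I) :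
    primitive E η t = ∫ s in (0 : ℝ)..t, IccExtend zero_le_one η s := rfl

theorem norm_primitive_le : ‖primitive E‖ ≤ 1 :=
  LinearMap.mkContinuous_norm_le _ zero_le_one _

theorem hasDerivAt_primitive [CompleteSpace E] (η : C(I, E)) (s : ℝ) :
    HasDerivAt (fun t => ∫ s in (0 : ℝ)..t, IccExtend zero_le_one η s)
      (IccExtend zero_le_one η s) s :=
  intervalIntegral.integral_hasDerivAt_right
    ((η.continuous.Icc_extend' (h := zero_le_one)).intervalIntegrable _ _)
    ((η.continuous.Icc_extend' (h := zero_le_one)).stronglyMeasurableAtFilter _ _)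
    (η.continuous.Icc_extend' (h := zero_le_one)).continuousAt

theorem eq_add_primitive [CompleteSpace E] {w : ℝ → E} {η : C(I, E)}
    (h : ∀ t : I, HasDerivAt w (η t) t) (t : I) : w t = w 0 + primitive E η t := by
  rw [primitive_apply, intervalIntegral.integral_eq_sub_of_hasDerivAt (f := w)]
  · abel
  · intro s hs
    rw [uIcc_of_le t.2.1] at hs
    have hs' : s ∈ I := ⟨hs.1, hs.2.trans t.2.2⟩
    rw [IccExtend_of_mem _ _ hs']
    exact h ⟨s, hs'⟩
  · exact (η.continuous.Icc_extend' (h := zero_le_one)).intervalIntegrable _ _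

/-- The constant curves, as a continuous linear map. -/
noncomputable def constCurve (E : Type*) [NormedAddCommGroup E] [NormedSpace ℝ E] :
    E →L[ℝ] C(I, E) :=
  LinearMap.mkContinuous
    { toFun := fun x => ContinuousMap.const I x
      map_add' := fun _ _ => rfl
      map_smul' := fun _ _ => rfl } 1 (fun x => by
    rw [ContinuousMap.norm_le _ (by positivity)]
    intro t
    exact (one_mul ‖x‖).ge)

@[simp]
theorem constCurve_apply (x : E) (t : I) : constCurve E x t = x := rfl

end Primitive

/-! ### Exterior derivatives of vector-valued one-forms -/

section Curl

variable {E : Type*} [NormedAddCommGroup E] [NormedSpace ℝ E]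
  {F : Type*} [NormedAddCommGroup F] [NormedSpace ℝ F]

/-- The exterior derivative of a vector-valued one-form `θ` as a bilinear map:
`(v, w) ↦ Dθ(v) w - Dθ(w) v`. -/
noncomputable def curl (θ : E → E →L[ℝ] F) (q : E) : E →L[ℝ] E →L[ℝ] F :=
  fderiv ℝ θ q - (fderiv ℝ θ q).flip

theorem curl_apply (θ : E → E →L[ℝ] F) (q v w : E) :
    curl θ q v w = fderiv ℝ θ q v w - fderiv ℝ θ q w v := rfl

theorem curl_swap (θ : E → E →L[ℝ] F) (q v w : E) : curl θ q v w = -curl θ q w v := by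
  simp [curl_apply]

@[simp]
theorem curl_self (θ : E → E →L[ℝ] F) (q v : E) : curl θ q v v = 0 := by
  simp [curl_apply]

theorem fderiv_apply_eq_neg_of_eventually_eq_zero {θ : E → E →L[ℝ] F} {X : E → E} {q : E}
    (hθ : DifferentiableAt ℝ θ q) (hX : DifferentiableAt ℝ X q) (h : ∀ᶠ x in 𝓝 q, θ x (X x) = 0)
    (v : E) : θ q (fderiv ℝ X q v) = -fderiv ℝ θ q v (X q) := by
  have h1 : fderiv ℝ (fun x => θ x (X x)) q = 0 := by
    rw [Filter.EventuallyEq.fderiv_eq (f := fun _ => (0 : F)) h]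
    simp
  rw [fderiv_clm_apply hθ hX] at h1
  have := congrArg (fun L : E →L[ℝ] F => L v) h1
  simp only [add_apply, ContinuousLinearMap.comp_apply, ContinuousLinearMap.flip_apply,
    zero_apply] at this
  exact eq_neg_of_add_eq_zero_left this

/-- Cartan's formula on fields annihilated by the form. -/
theorem apply_lieBracket_eq_neg_curl {θ : E → E →L[ℝ] F} {X Y : E → E} {q : E}
    (hθ : DifferentiableAt ℝ θ q) (hX : DifferentiableAt ℝ X q) (hY : DifferentiableAt ℝ Y q)
    (h : ∀ᶠ x in 𝓝 q, θ x (X x) = 0) (h' : ∀ᶠ x in 𝓝 q, θ x (Y x) = 0) :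
    θ q (lieBracket ℝ X Y q) = -curl θ q (X q) (Y q) := by
  rw [lieBracket, map_sub, fderiv_apply_eq_neg_of_eventually_eq_zero hθ hX h,
    fderiv_apply_eq_neg_of_eventually_eq_zero hθ hY h', curl_apply]
  abel

end Curl

/-! ### Cutoff functions -/

section Cutoff

variable {E : Type*} [NormedAddCommGroup E] [NormedSpace ℝ E] [FiniteDimensional ℝ E]
  {F : Type*} [NormedAddCommGroup F] [NormedSpace ℝ F]

/-- A smooth map on an open set can be multiplied by a cutoff function that is `1` near a given
point, so as to become smooth on the whole space and vanish outside the open set. -/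
theorem exists_cutoff {V : Set E} (hV : IsOpen V) {p : E} (hp : p ∈ V) {Y : E → F}
    (hY : ContDiffOn ℝ ∞ Y V) :
    ∃ χ : E → ℝ, ContDiff ℝ ∞ (fun q => χ q • Y q) ∧ (∀ᶠ q in 𝓝 p, χ q = 1) ∧
      ∀ q ∉ V, χ q = 0 := by
  obtain ⟨r, hr, hrV⟩ := Metric.nhds_basis_closedBall.mem_iff.1 (hV.mem_nhds hp)
  let c : ContDiffBump p := ⟨r / 2, r, half_pos hr, half_lt_self hr⟩
  have hz : ∀ q ∉ V, q ∉ tsupport c := fun q hq hc => hq (hrV (by rwa [c.tsupport_eq] at hc))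
  refine ⟨c, contDiff_iff_contDiffAt.2 fun q => ?_, c.eventuallyEq_one, fun q hq =>
    image_eq_zero_of_notMem_tsupport (hz q hq)⟩
  by_cases hq : q ∈ V
  · exact c.contDiff.contDiffAt.smul (hY.contDiffAt (hV.mem_nhds hq))
  · refine (contDiffAt_const (c := (0 : F))).congr_of_eventuallyEq ?_
    filter_upwards [(notMem_tsupport_iff_eventuallyEq.1 (hz q hq))] with x hx
    simp [hx]

theorem exists_contDiff_eventuallyEq {V : Set E} (hV : IsOpen V) {p : E} (hp : p ∈ V) {Y : E → F}
    (hY : ContDiffOn ℝ ∞ Y V) : ∃ Z : E → F, ContDiff ℝ ∞ Z ∧ Z =ᶠ[𝓝 p] Y := by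
  obtain ⟨χ, h1, h2, -⟩ := exists_cutoff hV hp hY
  exact ⟨_, h1, h2.mono fun q hq => by simp [hq]⟩

end Cutoff

/-! ### Frames and the Frobenius theorem -/

section Frame

variable {E : Type*} [NormedAddCommGroup E] [NormedSpace ℝ E] [FiniteDimensional ℝ E]

/-- Linearly independent smooth fields `X i` admit near a point a smooth family of parametrizations
`S q` of their span, normalized by a fixed linear map: `P ∘ S q = id`. -/
theorem exists_frame_splitting {ι : Type*} [Fintype ι] {X : ι → E → E} {N : Set E}
    (hN : IsOpen N) (hX : ∀ i, ContDiffOn ℝ ∞ (X i) N) {p : E} (hp : p ∈ N)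
    (hli : LinearIndependent ℝ (fun i => X i p)) :
    ∃ (P : E →L[ℝ] (ι → ℝ)) (S : E → (ι → ℝ) →L[ℝ] E) (V : Set E), IsOpen V ∧ p ∈ V ∧ V ⊆ N ∧
      ContDiffOn ℝ ∞ S V ∧ ∀ q ∈ V, (∀ c, P (S q c) = c) ∧
        (∀ c, S q c ∈ Submodule.span ℝ (range fun i => X i q)) ∧
        (∀ i, S q (P (X i q)) = X i q) := by
  classical
  obtain ⟨P₀, hP₀⟩ := LinearMap.exists_leftInverse_of_injective
    (Fintype.linearCombination ℝ (fun i => X i p)) (LinearMap.ker_eq_bot.2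
      (linearIndependent_iff_injective_fintypeLinearCombination.1 hli))
  let P : E →L[ℝ] (ι → ℝ) := LinearMap.toContinuousLinearMap P₀
  let M : E → (ι → ℝ) →L[ℝ] E := fun q =>
    ∑ i, (ContinuousLinearMap.proj (R := ℝ) (φ := fun _ : ι => ℝ) i).smulRight (X i q)
  have hMapp : ∀ q c, M q c = ∑ i, c i • X i q := fun q c => by simp [M]
  have hM : ContDiffOn ℝ ∞ M N := ContDiffOn.sum fun i _ =>
    (ContinuousLinearMap.smulRightL ℝ (ι → ℝ) E
      (ContinuousLinearMap.proj i)).contDiff.comp_contDiffOn (hX i)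
  let T : E → (ι → ℝ) →L[ℝ] (ι → ℝ) := fun q => P.comp (M q)
  have hT : ContDiffOn ℝ ∞ T N :=
    (ContinuousLinearMap.compL ℝ (ι → ℝ) E (ι → ℝ) P).contDiff.comp_contDiffOn hM
  have hTp : T p = 1 := by
    ext1 c
    have := congrArg (fun L : (ι → ℝ) →ₗ[ℝ] (ι → ℝ) => L c) hP₀
    simpa [T, P, hMapp, Fintype.linearCombination_apply] using this
  have hXM : ∀ q i, X i q = M q (Pi.single i 1) := fun q i => by
    simp [hMapp, Pi.single_apply]
  refine ⟨P, fun q => (M q).comp (Ring.inverse (T q)), N ∩ T ⁻¹' {A | IsUnit A},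
    hT.continuousOn.isOpen_inter_preimage hN Units.isOpen, ⟨hp, by simp [hTp]⟩,
    inter_subset_left, ?_, ?_⟩
  · intro q hq
    obtain ⟨A, hA⟩ := hq.2
    have h1 : ContDiffAt ℝ ∞ (fun q => Ring.inverse (T q)) q := by
      have h2 := contDiffAt_ringInverse ℝ (n := ∞) A
      rw [hA] at h2
      exact h2.comp q (hT.contDiffAt (hN.mem_nhds hq.1))
    exact ((hM.contDiffAt (hN.mem_nhds hq.1)).clm_comp h1).contDiffWithinAt
  · intro q hq
    have hu : IsUnit (T q) := hq.2
    refine ⟨fun c => ?_, fun c => ?_, fun i => ?_⟩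
    · have := congrArg (fun L : (ι → ℝ) →L[ℝ] (ι → ℝ) => L c) (Ring.mul_inverse_cancel _ hu)
      simpa [T] using this
    · rw [ContinuousLinearMap.comp_apply, hMapp]
      exact Submodule.sum_mem _ fun i _ => Submodule.smul_mem _ _
        (Submodule.subset_span (mem_range_self i))
    · have := congrArg (fun L : (ι → ℝ) →L[ℝ] (ι → ℝ) => L (Pi.single i 1))
        (Ring.inverse_mul_cancel _ hu)
      simp only [mul_apply_eq_comp, one_apply_eq_self] at this
      rw [hXM, ContinuousLinearMap.comp_apply]
      exact congrArg (M q) this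

end Frame

section Frobenius

variable {E : Type*} [NormedAddCommGroup E] [NormedSpace ℝ E]

/-- For an involutive frame, the fields `q ↦ S q a` of the normalized frame commute. -/
theorem fderiv_frame_comm {ι : Type*} [Fintype ι] {X : ι → E → E} {V : Set E} (hV : IsOpen V)
    (hX : ∀ i, ContDiffOn ℝ ∞ (X i) V)
    (hinv : ∀ q ∈ V, ∀ i j, lieBracket ℝ (X i) (X j) q ∈ Submodule.span ℝ (range fun k => X k q))
    {P : E →L[ℝ] (ι → ℝ)} {S : E → (ι → ℝ) →L[ℝ] E} (hS : ContDiffOn ℝ ∞ S V)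
    (hPS : ∀ q ∈ V, ∀ c, P (S q c) = c)
    (hspan : ∀ q ∈ V, ∀ c, S q c ∈ Submodule.span ℝ (range fun i => X i q))
    (hSP : ∀ q ∈ V, ∀ i, S q (P (X i q)) = X i q) {q : E} (hq : q ∈ V) (a b : ι → ℝ) :
    fderiv ℝ S q (S q a) b = fderiv ℝ S q (S q b) a := by
  have hVq := hV.mem_nhds hq
  have hSd : ∀ x ∈ V, DifferentiableAt ℝ S x := fun x hx =>
    (hS.contDiffAt (hV.mem_nhds hx)).differentiableAt (by simp)
  -- the one-form `v ↦ v - S P v`, whose kernel is the distribution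
  let θ : E → E →L[ℝ] E := fun x => ContinuousLinearMap.id ℝ E - (S x).comp P
  have hθ : DifferentiableAt ℝ θ q :=
    (differentiableAt_const _).sub ((hSd q hq).clm_comp (differentiableAt_const P))
  have hθX : ∀ i, ∀ᶠ x in 𝓝 q, θ x (X i x) = 0 := fun i => by
    filter_upwards [hVq] with x hx
    simp [θ, hSP x hx]
  have hθS : ∀ c, ∀ᶠ x in 𝓝 q, θ x (S x c) = 0 := fun c => by
    filter_upwards [hVq] with x hx
    simp [θ, hPS x hx]
  have hker : ∀ v ∈ Submodule.span ℝ (range fun k => X k q), θ q v = 0 := by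
    intro v hv
    induction hv using Submodule.span_induction with
    | mem v hv => obtain ⟨i, rfl⟩ := hv; exact (hθX i).self_of_nhds
    | zero => simp
    | add v w _ _ h1 h2 => rw [map_add, h1, h2, add_zero]
    | smul c v _ h1 => rw [map_smul, h1, smul_zero]
  have hXd : ∀ i, DifferentiableAt ℝ (X i) q := fun i =>
    ((hX i).contDiffAt hVq).differentiableAt (by simp)
  have hcX : ∀ i j, curl θ q (X i q) (X j q) = 0 := fun i j => by
    have := apply_lieBracket_eq_neg_curl hθ (hXd i) (hXd j) (hθX i) (hθX j)
    rw [hker _ (hinv q hq i j)] at this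
    exact neg_eq_zero.1 this.symm
  have hc1 : ∀ v ∈ Submodule.span ℝ (range fun k => X k q), ∀ i, curl θ q v (X i q) = 0 := by
    intro v hv i
    induction hv using Submodule.span_induction with
    | mem v hv => obtain ⟨j, rfl⟩ := hv; exact hcX j i
    | zero => simp
    | add v w _ _ h1 h2 => simp [h1, h2]
    | smul c v _ h1 => simp [h1]
  have hc2 : ∀ v ∈ Submodule.span ℝ (range fun k => X k q),
      ∀ w ∈ Submodule.span ℝ (range fun k => X k q), curl θ q v w = 0 := by
    intro v hv w hw
    induction hw using Submodule.span_induction with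
    | mem w hw => obtain ⟨j, rfl⟩ := hw; exact hc1 v hv j
    | zero => simp
    | add v w _ _ h1 h2 => simp [h1, h2]
    | smul c v _ h1 => simp [h1]
  have hSc : ∀ c, DifferentiableAt ℝ (fun x => S x c) q := fun c =>
    (hSd q hq).clm_apply (differentiableAt_const c)
  have hSc' : ∀ c v, fderiv ℝ (fun x => S x c) q v = fderiv ℝ S q v c := fun c v => by
    rw [fderiv_clm_apply (hSd q hq) (differentiableAt_const c)]
    simp
  have h1 : θ q (lieBracket ℝ (fun x => S x a) (fun x => S x b) q) = 0 := by
    rw [apply_lieBracket_eq_neg_curl hθ (hSc a) (hSc b) (hθS a) (hθS b),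
      hc2 _ (hspan q hq a) _ (hspan q hq b), neg_zero]
  have hP : ∀ c v, P (fderiv ℝ S q v c) = 0 := fun c v => by
    have h2 : fderiv ℝ (fun x => P (S x c)) q = 0 := by
      have : (fun x => P (S x c)) =ᶠ[𝓝 q] fun _ => c := by
        filter_upwards [hVq] with x hx using hPS x hx c
      rw [this.fderiv_eq]
      simp
    have h3 : fderiv ℝ (fun x => P (S x c)) q = P.comp (fderiv ℝ (fun x => S x c) q) :=
      (P.hasFDerivAt.comp q (hSc c).hasFDerivAt).fderiv
    rw [h3] at h2
    have := congrArg (fun L : E →L[ℝ] (ι → ℝ) => L v) h2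
    simpa [hSc'] using this
  have h4 : lieBracket ℝ (fun x => S x a) (fun x => S x b) q
      = fderiv ℝ S q (S q a) b - fderiv ℝ S q (S q b) a := by
    rw [lieBracket, hSc', hSc']
  rw [h4] at h1
  simp only [θ, sub_apply, ContinuousLinearMap.id_apply, ContinuousLinearMap.comp_apply, map_sub,
    hP, sub_zero, map_zero] at h1
  exact sub_eq_zero.1 h1

end Frobenius

section FirstIntegrals

universe u

variable {E : Type u} [NormedAddCommGroup E] [NormedSpace ℝ E] [CompleteSpace E]
  {G : Type u} [NormedAddCommGroup G] [NormedSpace ℝ G]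

/-- Smooth dependence of the integral curves `u' = S(u) (P p - P q)`, `u(0) = q`, on `q`, together
with uniqueness for the linearized integral equation. At `q = p` the equation degenerates to
`u' = 0`, so that the implicit function theorem applies on `C([0, 1], E)` without further
estimates. -/
theorem exists_smooth_curves (S : C(E, G →L[ℝ] E)) (hS : ContDiff ℝ ∞ S) (P : E →L[ℝ] G) (p : E) :
    ∃ (u : E → C(I, E)) (V : Set E), IsOpen V ∧ p ∈ V ∧ ContDiffOn ℝ ∞ u V ∧
      u p = constCurve E p ∧
      (∀ q ∈ V, u q = constCurve E q + primitive E
        (pointwiseApply I G E (superposition I S (u q)) (constCurve G (P (p - q))))) ∧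
      ∀ q ∈ V, ∀ k l : C(I, E), (∀ t, l t = fderiv ℝ S (u q t) (k t) (P (p - q))) →
        k = primitive E l → k = 0 := by
  have hS' : ContDiff ℝ ∞ (fderiv ℝ S) := hS.fderiv_right (by simp)
  let S' : C(E, E →L[ℝ] G →L[ℝ] E) := ⟨fderiv ℝ S, hS'.continuous⟩
  let B := pointwiseApply I G E
  let x : E × C(I, E) → C(I, G) := fun z => constCurve G (P (p - z.1))
  let Sg : E × C(I, E) → C(I, G →L[ℝ] E) := fun z => superposition I S z.2
  let Φ : E × C(I, E) → C(I, E) := fun z => z.2 - constCurve E z.1 - primitive E (B (Sg z) (x z))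
  let Ψ : E × C(I, E) → E × C(I, E) := fun z => (z.1, Φ z)
  have hx : ContDiff ℝ ∞ x := (constCurve G).contDiff.comp (P.contDiff.comp
    (contDiff_const.sub contDiff_fst))
  have hSg : ContDiff ℝ ∞ Sg := (contDiff_superposition S hS).comp contDiff_snd
  have hBc : ContDiff ℝ ∞ B := by fun_prop
  have hB : ContDiff ℝ ∞ (fun z => B (Sg z) (x z)) :=
    ContDiff.clm_apply (f := fun z => B (Sg z)) (hBc.comp hSg) hx
  have hΨ : ContDiff ℝ ∞ Ψ := contDiff_fst.prodMk ((contDiff_snd.sub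
    ((constCurve E).contDiff.comp contDiff_fst)).sub ((primitive E).contDiff.comp hB))
  set z₀ : E × C(I, E) := (p, constCurve E p) with hz₀
  have hx0 : x z₀ = 0 := by simp [x, hz₀]
  -- at `z₀` the factor `x` vanishes, so only its derivative contributes
  let R : E →L[ℝ] C(I, E) := -(constCurve E) +
    (primitive E).comp ((B (Sg z₀)).comp ((constCurve G).comp P))
  let e₀ : (E × C(I, E)) ≃L[ℝ] (E × C(I, E)) :=
    (ContinuousLinearEquiv.refl ℝ E).skewProd (ContinuousLinearEquiv.refl ℝ C(I, E)) R
  have hΨ' : HasFDerivAt Ψ (e₀ : (E × C(I, E)) →L[ℝ] (E × C(I, E))) z₀ := by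
    have hx' : HasFDerivAt x (-((constCurve G).comp
        (P.comp (ContinuousLinearMap.fst ℝ E C(I, E))))) z₀ := by
      have h1 : HasFDerivAt (fun z : E × C(I, E) => p - z.1)
        (-(ContinuousLinearMap.fst ℝ E C(I, E))) z₀ := hasFDerivAt_fst.const_sub p
      have h2 := ((constCurve G).comp P).hasFDerivAt.comp z₀ h1
      refine h2.congr_fderiv ?_
      ext <;> simp
    have hb := B.hasFDerivAt_of_bilinear ((hSg.differentiable (by simp)) z₀).hasFDerivAt hx'
    have h3 := (hasFDerivAt_fst (𝕜 := ℝ) (p := z₀)).prodMk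
      ((hasFDerivAt_snd (𝕜 := ℝ) (p := z₀)).sub
      ((constCurve E).hasFDerivAt.comp z₀ (hasFDerivAt_fst (𝕜 := ℝ) (p := z₀))) |>.sub
      ((primitive E).hasFDerivAt.comp z₀ hb))
    refine h3.congr_fderiv ?_
    ext1
    · ext1 a
      simp [e₀, R, hx0, ContinuousLinearMap.precompR, ContinuousLinearMap.precompL]
    · ext1 a
      simp [e₀, R, hx0, ContinuousLinearMap.precompR, ContinuousLinearMap.precompL]
  obtain ⟨e, hez, -, he, hsymm⟩ := exists_smooth_openPartialHomeomorph isOpen_univ (mem_univ z₀)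
    hΨ.contDiffOn e₀ hΨ'
  have hΨz₀ : Ψ z₀ = (p, 0) := by
    have h1 : Φ z₀ = 0 := by
      simp only [Φ, hx0]
      simp [hz₀]
    exact Prod.ext rfl h1
  let j : E → E × C(I, E) := fun q => (q, 0)
  have hj : ContDiff ℝ ∞ j := contDiff_id.prodMk contDiff_const
  let u : E → C(I, E) := fun q => (e.symm (q, 0)).2
  have hV₀ : IsOpen (j ⁻¹' e.target) := e.open_target.preimage hj.continuous
  have hu : ContDiffOn ℝ ∞ u (j ⁻¹' e.target) :=
    contDiff_snd.comp_contDiffOn (hsymm.comp hj.contDiffOn fun q hq => hq)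
  have hup : e.symm (p, 0) = z₀ := by
    rw [← hΨz₀, ← he, e.left_inv hez]
  have hup' : u p = constCurve E p := by simp [u, hup, hz₀]
  have hpV₀ : p ∈ j ⁻¹' e.target := by
    have := e.map_source hez
    rwa [he, hΨz₀] at this
  have hueq : ∀ q ∈ j ⁻¹' e.target, Ψ (q, u q) = (q, 0) := by
    intro q hq
    have h1 : Ψ (e.symm (q, 0)) = (q, 0) := by rw [← he, e.right_inv hq]
    have h2 : (e.symm (q, 0)).1 = q := congrArg Prod.fst h1
    have h3 : e.symm (q, 0) = (q, u q) := Prod.ext h2 rfl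
    rwa [h3] at h1
  -- where `κ q < 1` the linearized equation is a contraction
  let κ : E → ℝ := fun q => ‖superposition (F := E →L[ℝ] G →L[ℝ] E) I S' (u q)‖ * ‖P (p - q)‖
  have hκ : ContinuousOn κ (j ⁻¹' e.target) :=
    ((ContinuousMap.continuous_postcomp S').comp_continuousOn hu.continuousOn).norm.mul
      (by fun_prop)
  refine ⟨u, (j ⁻¹' e.target) ∩ κ ⁻¹' Iio 1, hκ.isOpen_inter_preimage hV₀ isOpen_Iio,
    ⟨hpV₀, by simp [κ]⟩, hu.mono inter_subset_left, hup', ?_, ?_⟩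
  · intro q hq
    have h1 : Φ (q, u q) = 0 := congrArg Prod.snd (hueq q hq.1)
    simp only [Φ, sub_sub] at h1
    exact sub_eq_zero.1 h1
  · intro q hq k l hl hk
    by_contra hne
    have hkpos : 0 < ‖k‖ := norm_pos_iff.2 hne
    have h1 : ‖l‖ ≤ κ q * ‖k‖ := by
      have hκ0 : 0 ≤ κ q := by positivity
      rw [ContinuousMap.norm_le _ (by positivity)]
      intro t
      rw [hl]
      have h2 := (fderiv ℝ S (u q t) (k t)).le_opNorm (P (p - q))
      have h3 := (fderiv ℝ S (u q t)).le_opNorm (k t)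
      have h4 := (superposition (F := E →L[ℝ] G →L[ℝ] E) I S' (u q)).norm_coe_le_norm t
      have h5 := k.norm_coe_le_norm t
      calc _ ≤ ‖superposition (F := E →L[ℝ] G →L[ℝ] E) I S' (u q)‖ * ‖k‖ * ‖P (p - q)‖ :=
            h2.trans (by
              gcongr
              exact h3.trans (mul_le_mul h4 h5 (norm_nonneg _)
                ((norm_nonneg (fderiv ℝ S (u q t))).trans h4)))
        _ = κ q * ‖k‖ := by ring
    have h2 : ‖k‖ ≤ ‖l‖ := by
      conv_lhs => rw [hk]
      exact ((primitive E).le_opNorm l).trans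
        (mul_le_of_le_one_left (norm_nonneg _) norm_primitive_le)
    have h3 : κ q < 1 := hq.2
    nlinarith

/-- Frobenius: an involutive frame `X i` of vector fields has, near `p`, first integrals with any
prescribed differential at `p` that annihilates the vectors `X i p`. -/
theorem exists_first_integral {E : Type} [NormedAddCommGroup E] [NormedSpace ℝ E]
    [FiniteDimensional ℝ E] {ι : Type} [Fintype ι] {X : ι → E → E} {N : Set E} (hN : IsOpen N)
    (hX : ∀ i, ContDiffOn ℝ ∞ (X i) N) {p : E} (hp : p ∈ N)
    (hli : LinearIndependent ℝ (fun i => X i p))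
    (hinv : ∀ q ∈ N, ∀ i j, lieBracket ℝ (X i) (X j) q ∈ Submodule.span ℝ (range fun k => X k q))
    (η : E →L[ℝ] ℝ) (hη : ∀ i, η (X i p) = 0) :
    ∃ (w : E → ℝ) (V : Set E), IsOpen V ∧ p ∈ V ∧ V ⊆ N ∧ ContDiffOn ℝ ∞ w V ∧
      (∀ q ∈ V, ∀ i, fderiv ℝ w q (X i q) = 0) ∧ fderiv ℝ w p = η := by
  have : CompleteSpace E := FiniteDimensional.complete ℝ E
  obtain ⟨P, S₀, V₁, hV₁, hpV₁, hV₁N, hS₀, hfr⟩ := exists_frame_splitting hN hX hp hli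
  obtain ⟨S, hS, hSS₀⟩ := exists_contDiff_eventuallyEq hV₁ hpV₁ hS₀
  obtain ⟨V₂, hV₂sub, hV₂, hpV₂⟩ := mem_nhds_iff.1 (hSS₀.and (hV₁.mem_nhds hpV₁))
  have hSV : ∀ q ∈ V₂, S q = S₀ q := fun q hq => (hV₂sub hq).1
  have hV₂₁ : V₂ ⊆ V₁ := fun q hq => (hV₂sub hq).2
  have hPS : ∀ q ∈ V₂, ∀ c, P (S q c) = c := fun q hq c => by
    rw [hSV q hq]; exact (hfr q (hV₂₁ hq)).1 c
  have hspan : ∀ q ∈ V₂, ∀ c, S q c ∈ Submodule.span ℝ (range fun i => X i q) := fun q hq c => by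
    rw [hSV q hq]; exact (hfr q (hV₂₁ hq)).2.1 c
  have hSP : ∀ q ∈ V₂, ∀ i, S q (P (X i q)) = X i q := fun q hq i => by
    rw [hSV q hq]; exact (hfr q (hV₂₁ hq)).2.2 i
  have hV₂N : V₂ ⊆ N := hV₂₁.trans hV₁N
  have hcomm := fun {q} (hq : q ∈ V₂) => fderiv_frame_comm hV₂ (fun i => (hX i).mono hV₂N)
    (fun q hq => hinv q (hV₂N hq)) hS.contDiffOn hPS hspan hSP hq
  obtain ⟨u, V₃, hV₃, hpV₃, hu, hup, hueq, huniq⟩ :=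
    exists_smooth_curves ⟨S, hS.continuous⟩ hS P p
  have hSd : ∀ x, HasFDerivAt S (fderiv ℝ S x) x := fun x =>
    (hS.differentiable (by simp) x).hasFDerivAt
  let S' : C(E, E →L[ℝ] (ι → ℝ) →L[ℝ] E) := ⟨fderiv ℝ S, (hS.continuous_fderiv (by simp))⟩
  let B := pointwiseApply I (ι → ℝ) E
  -- the linearized integral equation satisfied by the derivative of `u`
  have hu' : ∀ q ∈ V₃, ∀ a : E, fderiv ℝ u q a = constCurve E a + primitive E
      (B (pointwiseApply I E _ (superposition I S' (u q)) (fderiv ℝ u q a))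
        (constCurve _ (P (p - q))) - B (superposition I ⟨S, hS.continuous⟩ (u q))
          (constCurve _ (P a))) := by
    intro q hq a
    have hud : HasFDerivAt u (fderiv ℝ u q) q :=
      ((hu.contDiffAt (hV₃.mem_nhds hq)).differentiableAt (by simp)).hasFDerivAt
    have h1 : HasFDerivAt (fun q => constCurve (ι → ℝ) (P (p - q)))
        (((constCurve _).comp P).comp (-(ContinuousLinearMap.id ℝ E))) q :=
      ((constCurve _).comp P).hasFDerivAt.comp q ((hasFDerivAt_id q).const_sub p)
    have h2 := (hasFDerivAt_superposition (K := I) ⟨S, hS.continuous⟩ S' hSd (u q)).comp q hud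
    have h3 := (constCurve E).hasFDerivAt.add
      ((primitive E).hasFDerivAt.comp q (B.hasFDerivAt_of_bilinear h2 h1))
    have h4 := (h3.congr_of_eventuallyEq
      (by filter_upwards [hV₃.mem_nhds hq] with x hx using hueq x hx)).fderiv
    conv_lhs => rw [h4]
    simp [ContinuousLinearMap.precompR, ContinuousLinearMap.precompL]
    abel
  have hO : IsOpen (V₃ ∩ u ⁻¹' {γ : C(I, E) | MapsTo γ univ V₂}) :=
    hu.continuousOn.isOpen_inter_preimage hV₃
      (ContinuousMap.isOpen_setOfPred_mapsTo isCompact_univ hV₂)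
  have hpO : p ∈ V₃ ∩ u ⁻¹' {γ : C(I, E) | MapsTo γ univ V₂} := by
    refine ⟨hpV₃, fun t _ => ?_⟩
    rw [hup]
    exact hpV₂
  let ev : C(I, E) →L[ℝ] E := ContinuousMap.evalCLM ℝ (1 : I)
  have hwd : ∀ q ∈ V₃, ∀ a, fderiv ℝ (fun q => η (u q 1)) q a = η (fderiv ℝ u q a 1) := by
    intro q hq a
    have hud : HasFDerivAt u (fderiv ℝ u q) q :=
      ((hu.contDiffAt (hV₃.mem_nhds hq)).differentiableAt (by simp)).hasFDerivAt
    have h1 : HasFDerivAt (fun q => η (u q 1)) ((η.comp ev).comp (fderiv ℝ u q)) q :=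
      (η.comp ev).hasFDerivAt.comp q hud
    rw [h1.fderiv]
    rfl
  refine ⟨fun q => η (u q 1), (V₃ ∩ u ⁻¹' {γ : C(I, E) | MapsTo γ univ V₂}) ∩ V₂, hO.inter hV₂,
    ⟨hpO, hpV₂⟩, fun q hq => hV₂N hq.2,
    (η.comp ev).contDiff.comp_contDiffOn (hu.mono fun q hq => hq.1.1), ?_, ?_⟩
  · rintro q ⟨⟨hq₃, hmaps⟩, hq₂⟩ i
    rw [hwd q hq₃, ← hSP q hq₂ i]
    set s := P (X i q) with hs
    set v := fderiv ℝ u q (S q s) with hv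
    -- `v(t) = (1 - t) S(u(t)) s`, since both sides solve the same linear integral equation
    let uc : ℝ → E := fun t => q + ∫ r in (0 : ℝ)..t, IccExtend zero_le_one
      (B (superposition I ⟨S, hS.continuous⟩ (u q)) (constCurve _ (P (p - q)))) r
    have huct : ∀ t : I, uc t = u q t := fun t => by
      conv_rhs => rw [hueq q hq₃]
      rfl
    have hucd : ∀ t : I, HasDerivAt uc (S (u q t) (P (p - q))) t := fun t => by
      have := (hasDerivAt_primitive (B (superposition I ⟨S, hS.continuous⟩ (u q))
        (constCurve _ (P (p - q)))) t).const_add q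
      simp only [IccExtend_val] at this
      exact this
    let W : C(I, E) := ⟨fun t => (1 - (t : ℝ)) • S (u q t) s, by
      have := hS.continuous
      fun_prop⟩
    let W' : C(I, E) := B (pointwiseApply I E _ (superposition I S' (u q)) W)
      (constCurve _ (P (p - q))) - B (superposition I ⟨S, hS.continuous⟩ (u q)) (constCurve _ s)
    have hW : W = constCurve E (S q s) + primitive E W' := by
      ext t
      have h1 : ∀ t : I, HasDerivAt (fun r : ℝ => (1 - r) • S (uc r) s) (W' t) t := by
        intro t
        have h2 : HasDerivAt (fun r : ℝ => S (uc r) s)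
            (fderiv ℝ S (u q t) (S (u q t) (P (p - q))) s) t := by
          have h3 : HasFDerivAt S (fderiv ℝ S (u q t)) (uc t) := by rw [huct]; exact hSd _
          have h4 := (h3.comp_hasDerivAt (t : ℝ) (hucd t))
          exact (ContinuousLinearMap.apply ℝ E s).hasFDerivAt.comp_hasDerivAt (t : ℝ) h4
        have h5 := ((hasDerivAt_id (t : ℝ)).const_sub 1).smul h2
        refine h5.congr_deriv ?_
        rw [hcomm (hmaps (mem_univ t))]
        simp [W', W, B, S', huct, ← sub_eq_add_neg, smul_sub]
      have h2 := eq_add_primitive h1 t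
      simp only [huct] at h2
      have h3 : uc 0 = q := by simp [uc]
      rw [h3] at h2
      simpa [W] using h2
    have hk : v - W = 0 := by
      refine huniq q hq₃ (v - W) (B (pointwiseApply I E _ (superposition I S' (u q)) (v - W))
        (constCurve _ (P (p - q)))) (fun t => rfl) ?_
      have h1 := hu' q hq₃ (S q s)
      rw [← hv, hPS q hq₂] at h1
      conv_lhs => rw [h1, hW]
      rw [add_sub_add_left_eq_sub, ← map_sub]
      congr 1
      simp only [W', sub_sub_sub_cancel_right, map_sub, sub_apply]
      abel
    rw [sub_eq_zero.1 hk]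
    simp [W]
  · ext a
    rw [hwd p hpV₃, hu' p hpV₃ a, hup]
    have h1 : η (S p (P a)) = 0 := by
      have h2 := hspan p hpV₂ (P a)
      generalize S p (P a) = v at h2
      induction h2 using Submodule.span_induction with
      | mem v hv => obtain ⟨i, rfl⟩ := hv; exact hη i
      | zero => simp
      | add v w _ _ h1 h2 => rw [map_add, h1, h2, add_zero]
      | smul c v _ h1 => rw [map_smul, h1, smul_zero]
    have h3 : B (superposition I ⟨S, hS.continuous⟩ (constCurve E p)) (constCurve _ (P a))
        = constCurve E (S p (P a)) := by
      ext t; rfl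
    have h4 : primitive E (constCurve E (S p (P a))) 1 = S p (P a) := by
      rw [primitive_apply]
      have : IccExtend zero_le_one (constCurve E (S p (P a))) = fun _ => S p (P a) := by
        ext r; rfl
      simp [this]
    simp [h3, h4, h1]

end FirstIntegrals

/-! ### Distributions, flags and annihilators -/

section LinearAlgebra

variable {E : Type*} [AddCommGroup E] [Module ℝ E] [FiniteDimensional ℝ E]

/-- A vector `b ∉ A` spans a space `B ⊇ A` of at most one dimension more, modulo `A`. -/
theorem exists_add_smul_of_finrank_succ {A B : Submodule ℝ E} (hAB : A ≤ B)
    (h : finrank ℝ B ≤ finrank ℝ A + 1) {b : E} (hb : b ∈ B) (hbA : b ∉ A) {w : E} (hw : w ∈ B) :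
    ∃ a ∈ A, ∃ s : ℝ, w = a + s • b := by
  have h1 : A ⊔ Submodule.span ℝ {b} ≤ B :=
    sup_le hAB ((Submodule.span_singleton_le_iff_mem _ _).2 hb)
  have h2 : A < A ⊔ Submodule.span ℝ {b} :=
    lt_of_le_of_ne le_sup_left fun he => hbA (he ▸ Submodule.mem_sup_right
      (Submodule.mem_span_singleton_self b))
  have h3 := Submodule.finrank_lt_finrank_of_lt h2
  have h4 := Submodule.eq_of_le_of_finrank_le h1 (by omega)
  rw [← h4] at hw
  obtain ⟨a, ha, c, hc, rfl⟩ := Submodule.mem_sup.1 hw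
  obtain ⟨s, rfl⟩ := Submodule.mem_span_singleton.1 hc
  exact ⟨a, ha, s, rfl⟩

end LinearAlgebra

section Modules

variable {E : Type*} [NormedAddCommGroup E] [NormedSpace ℝ E]
  {F : Type*} [NormedAddCommGroup F] [NormedSpace ℝ F] {U : Set E}

theorem mem_fiber {Δ : Submodule (smoothFunctions U) (E → F)} {X : E → F} (hX : X ∈ Δ) (q : E) :
    X q ∈ fiber Δ q := ⟨X, hX, rfl⟩

theorem fiber_mono {Δ Δ' : Submodule (smoothFunctions U) (E → F)} (h : Δ ≤ Δ') (q : E) :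
    fiber Δ q ≤ fiber Δ' q := by
  rintro _ ⟨X, hX, rfl⟩
  exact ⟨X, h hX, rfl⟩

/-- The value at `q` of a `C^∞`-combination of fields is a linear combination of their values. -/
theorem apply_mem_of_mem_span {s : Set (E → F)} {q : E} {T : Submodule ℝ F}
    (h : ∀ X ∈ s, X q ∈ T) {X : E → F} (hX : X ∈ Submodule.span (smoothFunctions U) s) :
    X q ∈ T := by
  induction hX using Submodule.span_induction with
  | mem X hX => exact h X hX
  | zero => exact T.zero_mem
  | add X Y _ _ h1 h2 => exact T.add_mem h1 h2
  | smul c X _ h1 => exact T.smul_mem _ h1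

/-- To bound the value of `Δ + [Δ₁, Δ₂]` at `q` it suffices to bound `Δ` and the values at `q` of
single brackets. -/
theorem fiber_sup_bracket_le {Δ Δ₁ Δ₂ : Submodule (smoothFunctions U) (E → E)} {q : E}
    {T : Submodule ℝ E} (h : fiber Δ q ≤ T)
    (h' : ∀ X ∈ Δ₁, ∀ Y ∈ Δ₂, lieBracket ℝ X Y q ∈ T) :
    fiber (Δ ⊔ bracket Δ₁ Δ₂) q ≤ T := by
  rintro _ ⟨X, hX, rfl⟩
  obtain ⟨Y, hY, Z, hZ, rfl⟩ := Submodule.mem_sup.1 hX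
  refine T.add_mem (h ⟨Y, hY, rfl⟩) (apply_mem_of_mem_span ?_ hZ)
  rintro _ ⟨X, hX, Y, hY, rfl⟩
  exact h' X hX Y hY

theorem lieBracket_mem_bracket {Δ₁ Δ₂ : Submodule (smoothFunctions U) (E → E)} {X Y : E → E}
    (hX : X ∈ Δ₁) (hY : Y ∈ Δ₂) : lieBracket ℝ X Y ∈ bracket Δ₁ Δ₂ :=
  Submodule.subset_span ⟨X, hX, Y, hY, rfl⟩

theorem bracket_mono {Δ₁ Δ₂ Δ₃ Δ₄ : Submodule (smoothFunctions U) (E → E)} (h : Δ₁ ≤ Δ₃)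
    (h' : Δ₂ ≤ Δ₄) : bracket Δ₁ Δ₂ ≤ bracket Δ₃ Δ₄ :=
  Submodule.span_mono fun _ ⟨X, hX, Y, hY, hZ⟩ => ⟨X, h hX, Y, h' hY, hZ⟩

theorem ContDiffOn.lieBracket_of_isOpen {X Y : E → E} (hU : IsOpen U) (hX : ContDiffOn ℝ ∞ X U)
    (hY : ContDiffOn ℝ ∞ Y U) : ContDiffOn ℝ ∞ (lieBracket ℝ X Y) U := fun _ hx =>
  (ContDiffAt.lieBracket_vectorField (m := ∞) (n := ∞) (hX.contDiffAt (hU.mem_nhds hx))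
    (hY.contDiffAt (hU.mem_nhds hx)) le_rfl).contDiffWithinAt

theorem bracket_le_smoothMaps {Δ₁ Δ₂ : Submodule (smoothFunctions U) (E → E)} (hU : IsOpen U)
    (h₁ : Δ₁ ≤ smoothMaps U E) (h₂ : Δ₂ ≤ smoothMaps U E) : bracket Δ₁ Δ₂ ≤ smoothMaps U E := by
  refine Submodule.span_le.2 ?_
  rintro _ ⟨X, hX, Y, hY, rfl⟩
  exact ContDiffOn.lieBracket_of_isOpen hU (h₁ hX) (h₂ hY)

variable (Δ : Submodule (smoothFunctions U) (E → E))

theorem derivedFlag_le_succ (k : ℕ) : derivedFlag Δ k ≤ derivedFlag Δ (k + 1) := le_sup_left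

theorem derivedFlag_mono : Monotone (derivedFlag Δ) :=
  monotone_nat_of_le_succ (derivedFlag_le_succ Δ)

theorem lieFlag_le_derivedFlag (k : ℕ) : lieFlag Δ k ≤ derivedFlag Δ k := by
  induction k with
  | zero => exact le_rfl
  | succ k ih => exact sup_le_sup ih (bracket_mono ih (derivedFlag_mono Δ (Nat.zero_le k)))

theorem lieBracket_mem_derivedFlag_succ {k : ℕ} {X Y : E → E} (hX : X ∈ derivedFlag Δ k)
    (hY : Y ∈ derivedFlag Δ k) : lieBracket ℝ X Y ∈ derivedFlag Δ (k + 1) :=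
  Submodule.mem_sup_right (lieBracket_mem_bracket hX hY)

theorem derivedFlag_le_smoothMaps (hU : IsOpen U) (hΔ : Δ ≤ smoothMaps U E) (k : ℕ) :
    derivedFlag Δ k ≤ smoothMaps U E := by
  induction k with
  | zero => exact hΔ
  | succ k ih => exact sup_le ih (bracket_le_smoothMaps hU ih ih)

theorem annihilator_anti {Δ Δ' : Submodule (smoothFunctions U) (E → E)} (h : Δ ≤ Δ') :
    annihilator Δ' ≤ annihilator Δ := fun _ hθ => ⟨hθ.1, fun X hX => hθ.2 X (h hX)⟩

variable {Δ}

theorem apply_eq_zero_of_mem_annihilator {θ : E → E →L[ℝ] ℝ} (hθ : θ ∈ annihilator Δ) {q : E}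
    (hq : q ∈ U) {v : E} (hv : v ∈ fiber Δ q) : θ q v = 0 := by
  obtain ⟨X, hX, rfl⟩ := hv
  exact hθ.2 X hX q hq

theorem differentiableAt_of_mem_smoothMaps (hU : IsOpen U) {X : E → F} (hX : X ∈ smoothMaps U F)
    {q : E} (hq : q ∈ U) : DifferentiableAt ℝ X q :=
  (ContDiffOn.contDiffAt hX (hU.mem_nhds hq)).differentiableAt (by simp)

end Modules

section Annihilator

variable {E : Type*} [NormedAddCommGroup E] [NormedSpace ℝ E] [FiniteDimensional ℝ E] {U : Set E}
  {Δ : Submodule (smoothFunctions U) (E → E)}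

/-- A local one-form annihilating a distribution extends to a one-form on `U` in its
annihilator. -/
theorem exists_mem_annihilator_eventuallyEq {V : Set E} (hV : IsOpen V) {q : E}
    (hq : q ∈ V) {θ : E → E →L[ℝ] ℝ} (hθ : ContDiffOn ℝ ∞ θ V)
    (h : ∀ x ∈ V, ∀ v ∈ fiber Δ x, θ x v = 0) : ∃ η ∈ annihilator Δ, η =ᶠ[𝓝 q] θ := by
  obtain ⟨χ, h1, h2, h3⟩ := exists_cutoff hV hq hθ
  refine ⟨fun x => χ x • θ x, ⟨h1.contDiffOn, fun X hX x _ => ?_⟩, h2.mono fun x hx => by simp [hx]⟩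
  by_cases hx : x ∈ V
  · simp [h x hx _ (mem_fiber hX x)]
  · simp [h3 x hx]

/-- Where a distribution has constant rank, every covector annihilating its value is the value of a
one-form in its annihilator. -/
theorem exists_mem_annihilator_apply_eq (hΔ : Δ ≤ smoothMaps U E) {W : Set E} (hW : IsOpen W)
    (hWU : W ⊆ U) {r : ℕ} (hr : ∀ q ∈ W, finrank ℝ (fiber Δ q) = r) {q : E} (hq : q ∈ W)
    (ξ : E →L[ℝ] ℝ) (hξ : ∀ v ∈ fiber Δ q, ξ v = 0) : ∃ θ ∈ annihilator Δ, θ q = ξ := by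
  obtain ⟨b⟩ : Nonempty (Basis (Fin r) ℝ (fiber Δ q)) := ⟨finBasisOfFinrankEq ℝ _ (hr q hq)⟩
  choose X hXΔ hXq using fun i => (b i).2
  have hXs : ∀ i, ContDiffOn ℝ ∞ (X i) W := fun i => ContDiffOn.mono (hΔ (hXΔ i)) hWU
  have hli : LinearIndependent ℝ (fun i => X i q) := by
    have h1 : (fun i => X i q) = (fiber Δ q).subtype ∘ b := funext hXq
    rw [h1]
    exact b.linearIndependent.map' _ (Submodule.ker_subtype _)
  obtain ⟨P, S, V, hV, hqV, hVW, hS, hfr⟩ := exists_frame_splitting hW hXs hq hli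
  -- near `q` the chosen sections still span the distribution, by constancy of the rank
  have hspan : ∀ x ∈ V, fiber Δ x = Submodule.span ℝ (range fun i => X i x) := by
    intro x hx
    have hle : Submodule.span ℝ (range fun i => X i x) ≤ fiber Δ x := by
      rw [Submodule.span_le]
      rintro _ ⟨i, rfl⟩
      exact mem_fiber (hXΔ i) x
    have hinj : Function.Injective (S x) :=
      Function.LeftInverse.injective (g := P) (hfr x hx).1
    have hr' : (LinearMap.range (S x : (Fin r → ℝ) →ₗ[ℝ] E)) ≤
        Submodule.span ℝ (range fun i => X i x) := by
      rintro _ ⟨c, rfl⟩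
      exact (hfr x hx).2.1 c
    have h1 := Submodule.finrank_mono hr'
    rw [LinearMap.finrank_range_of_inj hinj, finrank_fin_fun] at h1
    exact (Submodule.eq_of_le_of_finrank_le hle (by rw [hr x (hVW hx)]; exact h1)).symm
  have hfix : ∀ x ∈ V, ∀ v ∈ fiber Δ x, S x (P v) = v := by
    intro x hx v hv
    rw [hspan x hx] at hv
    induction hv using Submodule.span_induction with
    | mem v hv => obtain ⟨i, rfl⟩ := hv; exact (hfr x hx).2.2 i
    | zero => simp
    | add v w _ _ h1 h2 => rw [map_add, map_add, h1, h2]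
    | smul c v _ h1 => rw [map_smul, map_smul, h1]
  have hθ : ContDiffOn ℝ ∞ (fun x => ξ.comp (ContinuousLinearMap.id ℝ E - (S x).comp P)) V :=
    contDiffOn_const.clm_comp (contDiffOn_const.sub (hS.clm_comp contDiffOn_const))
  obtain ⟨η, hη, he⟩ := exists_mem_annihilator_eventuallyEq (Δ := Δ) hV hqV hθ
    (fun x hx v hv => by simp [hfix x hx v hv])
  refine ⟨η, hη, ?_⟩
  rw [he.self_of_nhds]
  ext v
  have : ξ (S q (P v)) = 0 := hξ _ (by rw [hspan q hqV]; exact (hfr q hqV).2.1 _)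
  simp [this]

/-- Where a distribution has constant rank, its value is cut out by its annihilator. -/
theorem mem_fiber_of_forall_annihilator (hΔ : Δ ≤ smoothMaps U E) {W : Set E} (hW : IsOpen W)
    (hWU : W ⊆ U) {r : ℕ} (hr : ∀ q ∈ W, finrank ℝ (fiber Δ q) = r) {q : E} (hq : q ∈ W) {v : E}
    (hv : ∀ θ ∈ annihilator Δ, θ q v = 0) : v ∈ fiber Δ q := by
  by_contra hne
  obtain ⟨ξ, hξv, hξ⟩ := Submodule.exists_le_ker_of_notMem hne
  obtain ⟨θ, hθ, hθq⟩ := exists_mem_annihilator_apply_eq hΔ hW hWU hr hq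
    (LinearMap.toContinuousLinearMap ξ) (fun w hw => hξ hw)
  have := hv θ hθ
  rw [hθq] at this
  exact hξv this

end Annihilator

theorem minSmoothness_two_le_infty : minSmoothness ℝ 2 ≤ (∞ : WithTop ℕ∞) := by
  rw [minSmoothness_of_isRCLikeNormedField]
  exact WithTop.coe_le_coe.2 le_top

/-! ### Cauchy characteristics of a regular flag -/

section Regular

variable {E : Type} [NormedAddCommGroup E] [NormedSpace ℝ E]

/-- On the open set `W ⊆ U` the `k`-th members of the Lie flag and of the derived flag of the
distribution `Δ` on `U` both have rank `2 + k`, as long as this does not exceed the dimension. -/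
structure IsRegularFlag {U : Set E} (W : Set E) (Δ : Submodule (smoothFunctions U) (E → E)) :
    Prop where
  isOpen_domain : IsOpen U
  isOpen : IsOpen W
  subset : W ⊆ U
  le_smoothMaps : Δ ≤ smoothMaps U E
  finrank_lieFlag : ∀ k, k + 2 ≤ finrank ℝ E → ∀ q ∈ W, finrank ℝ (fiber (lieFlag Δ k) q) = 2 + k
  finrank_derivedFlag :
    ∀ k, k + 2 ≤ finrank ℝ E → ∀ q ∈ W, finrank ℝ (fiber (derivedFlag Δ k) q) = 2 + k

/-- The Cauchy characteristic space of the `k`-th member of the derived flag. -/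
def charSpace {U : Set E} (Δ : Submodule (smoothFunctions U) (E → E)) (k : ℕ) (q : E) :
    Submodule ℝ E :=
  cauchyCharSpace (annihilator (derivedFlag Δ k)) q

variable {U W : Set E} {Δ : Submodule (smoothFunctions U) (E → E)}

namespace IsRegularFlag

variable (H : IsRegularFlag W Δ) {k : ℕ} {q : E}
include H

theorem differentiableAt_form {θ : E → E →L[ℝ] ℝ} (hθ : θ ∈ annihilator (derivedFlag Δ k))
    (hq : q ∈ W) : DifferentiableAt ℝ θ q :=
  differentiableAt_of_mem_smoothMaps H.isOpen_domain hθ.1 (H.subset hq)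

theorem differentiableAt_field {X : E → E} (hX : X ∈ derivedFlag Δ k)
    (hq : q ∈ W) : DifferentiableAt ℝ X q :=
  differentiableAt_of_mem_smoothMaps H.isOpen_domain
    (derivedFlag_le_smoothMaps Δ H.isOpen_domain H.le_smoothMaps k hX) (H.subset hq)

theorem eventually_apply_eq_zero {θ : E → E →L[ℝ] ℝ} (hθ : θ ∈ annihilator (derivedFlag Δ k))
    (hq : q ∈ W) {X : E → E} (hX : ∀ᶠ x in 𝓝 q, X x ∈ fiber (derivedFlag Δ k) x) :
    ∀ᶠ x in 𝓝 q, θ x (X x) = 0 := by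
  filter_upwards [hX, H.isOpen.mem_nhds hq] with x hx hxW
  exact apply_eq_zero_of_mem_annihilator hθ (H.subset hxW) hx

theorem contDiffAt_field {X : E → E} (hX : X ∈ derivedFlag Δ k) (hq : q ∈ W) :
    ContDiffAt ℝ ∞ X q :=
  ContDiffOn.contDiffAt
    (derivedFlag_le_smoothMaps Δ H.isOpen_domain H.le_smoothMaps k hX)
    (H.isOpen_domain.mem_nhds (H.subset hq))

theorem apply_lieBracket {θ : E → E →L[ℝ] ℝ} (hθ : θ ∈ annihilator (derivedFlag Δ k))
    (hq : q ∈ W) {X Y : E → E} (hXd : DifferentiableAt ℝ X q) (hYd : DifferentiableAt ℝ Y q)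
    (hX : ∀ᶠ x in 𝓝 q, X x ∈ fiber (derivedFlag Δ k) x)
    (hY : ∀ᶠ x in 𝓝 q, Y x ∈ fiber (derivedFlag Δ k) x) :
    θ q (lieBracket ℝ X Y q) = -curl θ q (X q) (Y q) :=
  apply_lieBracket_eq_neg_curl (H.differentiableAt_form hθ hq) hXd hYd
    (H.eventually_apply_eq_zero hθ hq hX) (H.eventually_apply_eq_zero hθ hq hY)

theorem apply_lieBracket_of_mem {θ : E → E →L[ℝ] ℝ} (hθ : θ ∈ annihilator (derivedFlag Δ k))
    (hq : q ∈ W) {X Y : E → E} (hX : X ∈ derivedFlag Δ k) (hY : Y ∈ derivedFlag Δ k) :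
    θ q (lieBracket ℝ X Y q) = -curl θ q (X q) (Y q) :=
  H.apply_lieBracket hθ hq (H.differentiableAt_field hX hq) (H.differentiableAt_field hY hq)
    (Eventually.of_forall (mem_fiber hX)) (Eventually.of_forall (mem_fiber hY))

/-- The exterior derivative of a form annihilating `G_{k+1}` vanishes on `G_k`. -/
theorem curl_eq_zero_of_succ {θ : E → E →L[ℝ] ℝ}
    (hθ : θ ∈ annihilator (derivedFlag Δ (k + 1))) (hq : q ∈ W) {v w : E}
    (hv : v ∈ fiber (derivedFlag Δ k) q) (hw : w ∈ fiber (derivedFlag Δ k) q) :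
    curl θ q v w = 0 := by
  obtain ⟨X, hX, rfl⟩ := hv
  obtain ⟨Y, hY, rfl⟩ := hw
  have h1 := H.apply_lieBracket_of_mem (annihilator_anti (derivedFlag_le_succ Δ k) hθ) hq hX hY
  rw [apply_eq_zero_of_mem_annihilator hθ (H.subset hq)
    (mem_fiber (lieBracket_mem_derivedFlag_succ Δ hX hY) q)] at h1
  exact neg_eq_zero.1 h1.symm

/-- If `Z` is a section of `G_{k+1}` with value in `G_k` at `q`, then brackets of `Z` with sections
of `G_k` are seen by forms in the annihilator of `G_{k+1}` as if `Z` were a section of `G_k`. -/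
theorem apply_lieBracket_eq_zero {θ : E → E →L[ℝ] ℝ}
    (hθ : θ ∈ annihilator (derivedFlag Δ (k + 1))) (hq : q ∈ W) {Z Y : E → E}
    (hZ : Z ∈ derivedFlag Δ (k + 1)) (hZq : Z q ∈ fiber (derivedFlag Δ k) q)
    (hY : Y ∈ derivedFlag Δ k) : θ q (lieBracket ℝ Z Y q) = 0 := by
  rw [H.apply_lieBracket_of_mem hθ hq hZ (derivedFlag_le_succ Δ k hY),
    H.curl_eq_zero_of_succ hθ hq hZq (mem_fiber hY q), neg_zero]

variable [FiniteDimensional ℝ E]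

theorem fiber_lieFlag_eq (hk : k + 2 ≤ finrank ℝ E) (hq : q ∈ W) :
    fiber (lieFlag Δ k) q = fiber (derivedFlag Δ k) q :=
  Submodule.eq_of_le_of_finrank_eq (fiber_mono (lieFlag_le_derivedFlag Δ k) q)
    ((H.finrank_lieFlag k hk q hq).trans (H.finrank_derivedFlag k hk q hq).symm)

theorem mem_fiber_of_forall (hk : k + 2 ≤ finrank ℝ E) (hq : q ∈ W) {v : E}
    (hv : ∀ θ ∈ annihilator (derivedFlag Δ k), θ q v = 0) : v ∈ fiber (derivedFlag Δ k) q :=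
  mem_fiber_of_forall_annihilator (derivedFlag_le_smoothMaps Δ H.isOpen_domain H.le_smoothMaps k)
    H.isOpen H.subset (H.finrank_derivedFlag k hk) hq hv

/-- A vector is characteristic for `G_k` if it lies in `G_k` and is paired to zero with all of `G_k`
by the exterior derivatives of the forms annihilating `G_k`. -/
theorem mem_charSpace_iff (hk : k + 2 ≤ finrank ℝ E) (hq : q ∈ W) {v : E} :
    v ∈ charSpace Δ k q ↔ v ∈ fiber (derivedFlag Δ k) q ∧
      ∀ θ ∈ annihilator (derivedFlag Δ k), ∀ w ∈ fiber (derivedFlag Δ k) q,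
        curl θ q v w = 0 := by
  have hd : ∀ θ ∈ annihilator (derivedFlag Δ k), ∀ w, extDerivOneForm θ q ![v, w]
      = curl θ q v w := fun θ hθ w =>
    extDerivOneForm_apply (H.differentiableAt_form hθ hq) v w
  constructor
  · intro hv
    refine ⟨H.mem_fiber_of_forall hk hq fun θ hθ => (hv θ hθ).1, fun θ hθ w hw => ?_⟩
    obtain ⟨-, _, ⟨η, hη, rfl⟩, h⟩ := hv θ hθ
    rw [← hd θ hθ, h, apply_eq_zero_of_mem_annihilator hη (H.subset hq) hw]
  · rintro ⟨hv, hv'⟩ θ hθ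
    refine ⟨apply_eq_zero_of_mem_annihilator hθ (H.subset hq) hv, curl θ q v, ?_,
      fun w => hd θ hθ w⟩
    obtain ⟨η, hη, he⟩ := exists_mem_annihilator_apply_eq
      (derivedFlag_le_smoothMaps Δ H.isOpen_domain H.le_smoothMaps k)
      H.isOpen H.subset (H.finrank_derivedFlag k hk) hq (curl θ q v) (hv' θ hθ)
    exact ⟨η, hη, he⟩

theorem lieBracket_mem_fiber (hk : k + 2 ≤ finrank ℝ E) (hq : q ∈ W) {X Y : E → E}
    (hXd : DifferentiableAt ℝ X q) (hYd : DifferentiableAt ℝ Y q)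
    (hX : ∀ᶠ x in 𝓝 q, X x ∈ fiber (derivedFlag Δ k) x)
    (hY : ∀ᶠ x in 𝓝 q, Y x ∈ fiber (derivedFlag Δ k) x)
    (hXY : ∀ θ ∈ annihilator (derivedFlag Δ k), curl θ q (X q) (Y q) = 0) :
    lieBracket ℝ X Y q ∈ fiber (derivedFlag Δ k) q := by
  refine H.mem_fiber_of_forall hk hq fun θ hθ => ?_
  rw [H.apply_lieBracket hθ hq hXd hYd hX hY, hXY θ hθ, neg_zero]

theorem lieBracket_mem_fiber_succ (hk : k + 3 ≤ finrank ℝ E) (hq : q ∈ W) {X Y : E → E}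
    (hXd : DifferentiableAt ℝ X q) (hYd : DifferentiableAt ℝ Y q)
    (hX : ∀ᶠ x in 𝓝 q, X x ∈ fiber (derivedFlag Δ k) x)
    (hY : ∀ᶠ x in 𝓝 q, Y x ∈ fiber (derivedFlag Δ k) x) :
    lieBracket ℝ X Y q ∈ fiber (derivedFlag Δ (k + 1)) q := by
  have hle := derivedFlag_le_succ Δ k
  exact H.lieBracket_mem_fiber (by omega) hq hXd hYd (hX.mono fun x hx => fiber_mono hle x hx)
    (hY.mono fun x hx => fiber_mono hle x hx) fun θ hθ =>
      H.curl_eq_zero_of_succ hθ hq hX.self_of_nhds hY.self_of_nhds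

/-- Since the Lie flag grows as fast as the derived flag, `G_k` is not even closed under brackets
with `Δ`. -/
theorem exists_curl_ne_zero (hk : k + 3 ≤ finrank ℝ E) (hq : q ∈ W) :
    ∃ θ ∈ annihilator (derivedFlag Δ k), ∃ v ∈ fiber (derivedFlag Δ k) q, ∃ w ∈ fiber Δ q,
      curl θ q v w ≠ 0 := by
  by_contra! hcon
  have h1 : fiber (lieFlag Δ (k + 1)) q ≤ fiber (derivedFlag Δ k) q := by
    refine fiber_sup_bracket_le (fiber_mono (lieFlag_le_derivedFlag Δ k) q) fun X hX Y hY => ?_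
    refine H.mem_fiber_of_forall (by omega) hq fun θ hθ => ?_
    have hX' := lieFlag_le_derivedFlag Δ k hX
    have hY' : Y ∈ derivedFlag Δ k := derivedFlag_mono Δ (Nat.zero_le k) hY
    rw [H.apply_lieBracket_of_mem hθ hq hX' hY', hcon θ hθ _ (mem_fiber hX' q) _ (mem_fiber hY q),
      neg_zero]
  have h2 := Submodule.finrank_mono h1
  rw [H.finrank_lieFlag (k + 1) (by omega) q hq, H.finrank_derivedFlag k (by omega) q hq] at h2
  omega

/-- The Cauchy characteristic spaces of the derived flag increase. The Jacobi identity carries a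
characteristic direction of `G_k` over to the brackets that generate `G_{k+1}`. -/
theorem charSpace_le_succ (hk : k + 3 ≤ finrank ℝ E) (hq : q ∈ W) :
    charSpace Δ k q ≤ charSpace Δ (k + 1) q := by
  intro v hv
  rw [H.mem_charSpace_iff (by omega) hq] at hv ⊢
  obtain ⟨hv, hv'⟩ := hv
  have hle := derivedFlag_le_succ Δ k
  refine ⟨fiber_mono hle q hv, fun θ hθ => ?_⟩
  obtain ⟨V, hV, rfl⟩ := hv
  have hbr : ∀ X ∈ derivedFlag Δ k, lieBracket ℝ V X q ∈ fiber (derivedFlag Δ k) q := by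
    intro X hX
    refine H.lieBracket_mem_fiber (by omega) hq (H.differentiableAt_field hV hq)
      (H.differentiableAt_field hX hq) (Eventually.of_forall (mem_fiber hV))
      (Eventually.of_forall (mem_fiber hX)) fun η hη => hv' η hη _ (mem_fiber hX q)
  suffices h : fiber (derivedFlag Δ (k + 1)) q ≤ LinearMap.ker (curl θ q (V q) : E →ₗ[ℝ] ℝ) from
    fun w hw => h hw
  refine fiber_sup_bracket_le (fun w hw => H.curl_eq_zero_of_succ hθ hq (mem_fiber hV q) hw)
    fun X hX Y hY => ?_
  have h1 := H.apply_lieBracket_of_mem hθ hq (hle hV) (lieBracket_mem_derivedFlag_succ Δ hX hY)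
  have h2 := leibniz_identity_lieBracket (𝕜 := ℝ) (n := ∞) minSmoothness_two_le_infty
    (H.contDiffAt_field hV hq) (H.contDiffAt_field hX hq) (H.contDiffAt_field hY hq)
  have h3 := H.apply_lieBracket_eq_zero hθ hq (lieBracket_mem_derivedFlag_succ Δ hV hX)
    (hbr X hX) hY
  have h4 := H.apply_lieBracket_eq_zero hθ hq (lieBracket_mem_derivedFlag_succ Δ hV hY)
    (hbr Y hY) hX
  rw [h2, map_add, h3, lieBracket_swap, map_neg, h4] at h1
  simp only [neg_zero, add_zero] at h1
  exact neg_eq_zero.1 h1.symm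

theorem charSpace_mono {l : ℕ} (hkl : k ≤ l) (hl : l + 2 ≤ finrank ℝ E) (hq : q ∈ W) :
    charSpace Δ k q ≤ charSpace Δ l q := by
  induction l, hkl using Nat.le_induction with
  | base => exact le_rfl
  | succ l hkl ih => exact (ih (by omega)).trans (H.charSpace_le_succ (by omega) hq)

/-- A vector `v` seen by a form annihilating `G_{k+1}` through brackets with `G_k` spans `G_{k+1}`
modulo `G_k`. -/
theorem exists_add_smul {θ : E → E →L[ℝ] ℝ} (hk : k + 3 ≤ finrank ℝ E)
    (hθ : θ ∈ annihilator (derivedFlag Δ (k + 1))) (hq : q ∈ W) {v w : E}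
    (hv : v ∈ fiber (derivedFlag Δ (k + 1)) q) (hw : w ∈ fiber (derivedFlag Δ k) q)
    (hvw : curl θ q v w ≠ 0) {x : E} (hx : x ∈ fiber (derivedFlag Δ (k + 1)) q) :
    ∃ a ∈ fiber (derivedFlag Δ k) q, ∃ s : ℝ, x = a + s • v := by
  refine exists_add_smul_of_finrank_succ (fiber_mono (derivedFlag_le_succ Δ k) q) ?_ hv
    (fun hv' => hvw (H.curl_eq_zero_of_succ hθ hq hv' hw)) hx
  rw [H.finrank_derivedFlag k (by omega) q hq, H.finrank_derivedFlag (k + 1) (by omega) q hq]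
  omega

/-- The bracket form of `G_{k+1}` has rank two: correcting `u ∈ G_k` by a multiple of `w` makes it
characteristic. -/
theorem sub_smul_mem_charSpace {θ : E → E →L[ℝ] ℝ} (hk : k + 4 ≤ finrank ℝ E)
    (hθ : θ ∈ annihilator (derivedFlag Δ (k + 1))) (hq : q ∈ W) {v w u : E}
    (hv : v ∈ fiber (derivedFlag Δ (k + 1)) q) (hw : w ∈ fiber (derivedFlag Δ k) q)
    (hvw : curl θ q v w ≠ 0) (hu : u ∈ fiber (derivedFlag Δ k) q) :
    u - (curl θ q v u / curl θ q v w) • w ∈ charSpace Δ (k + 1) q := by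
  set u' := u - (curl θ q v u / curl θ q v w) • w with hu'
  have hle := derivedFlag_le_succ Δ k
  have hu'k : u' ∈ fiber (derivedFlag Δ k) q := sub_mem hu (Submodule.smul_mem _ _ hw)
  have hvu' : curl θ q v u' = 0 := by
    rw [hu', map_sub, map_smul, smul_eq_mul, div_mul_cancel₀ _ hvw, sub_self]
  rw [H.mem_charSpace_iff (by omega) hq]
  refine ⟨fiber_mono hle q hu'k, fun η hη x hx => ?_⟩
  obtain ⟨a, ha, s, rfl⟩ := H.exists_add_smul (by omega) hθ hq hv hw hvw hx
  rw [map_add, map_smul, H.curl_eq_zero_of_succ hη hq hu'k ha, zero_add]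
  obtain ⟨V, hV, rfl⟩ := hv
  obtain ⟨B, hB, rfl⟩ := hw
  obtain ⟨X, hX, hXu'⟩ := hu'k
  -- `G_{k+2} = G_{k+1} + ⟨[V, B]⟩`, and `[X, V]` has no `[V, B]` component
  have h1 := H.apply_lieBracket_of_mem hθ hq hV (hle hB)
  have hne : lieBracket ℝ V B q ∉ fiber (derivedFlag Δ (k + 1)) q := fun hmem => by
    rw [apply_eq_zero_of_mem_annihilator hθ (H.subset hq) hmem] at h1
    exact hvw (neg_eq_zero.1 h1.symm)
  obtain ⟨d, hd, c, hc⟩ := exists_add_smul_of_finrank_succ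
    (fiber_mono (derivedFlag_le_succ Δ (k + 1)) q)
    (by
      rw [H.finrank_derivedFlag (k + 1) (by omega) q hq,
        H.finrank_derivedFlag (k + 1 + 1) (by omega) q hq]
      omega)
    (mem_fiber (lieBracket_mem_derivedFlag_succ Δ hV (hle hB)) q) hne
    (mem_fiber (lieBracket_mem_derivedFlag_succ Δ (hle hX) hV) q)
  have h2 := H.apply_lieBracket_of_mem hθ hq (hle hX) hV
  rw [hXu', curl_swap, hvu', hc, map_add, map_smul, h1,
    apply_eq_zero_of_mem_annihilator hθ (H.subset hq) hd] at h2
  have hc0 : c = 0 := by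
    have : c * curl θ q (V q) (B q) = 0 := by simpa using h2
    exact (mul_eq_zero.1 this).resolve_right hvw
  rw [hc0, zero_smul, add_zero] at hc
  have h3 := H.apply_lieBracket_of_mem hη hq (hle hX) hV
  rw [hc, apply_eq_zero_of_mem_annihilator hη (H.subset hq) hd, hXu'] at h3
  rw [neg_eq_zero.1 h3.symm, smul_zero]

/-- The Cauchy characteristic distribution is involutive. -/
theorem lieBracket_mem_charSpace (hk : k + 2 ≤ finrank ℝ E) {N : Set E} (hN : IsOpen N)
    (hNW : N ⊆ W) {X Y : E → E} (hX : ContDiffOn ℝ ∞ X N) (hY : ContDiffOn ℝ ∞ Y N)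
    (hXc : ∀ x ∈ N, X x ∈ charSpace Δ k x) (hYc : ∀ x ∈ N, Y x ∈ charSpace Δ k x) (hq : q ∈ N) :
    lieBracket ℝ X Y q ∈ charSpace Δ k q := by
  -- a characteristic field maps sections of `G_k` to sections of `G_k`
  have key : ∀ {X Z : E → E}, ContDiffOn ℝ ∞ X N → (∀ x ∈ N, X x ∈ charSpace Δ k x) →
      ContDiffOn ℝ ∞ Z N → (∀ x ∈ N, Z x ∈ fiber (derivedFlag Δ k) x) →
      ∀ x ∈ N, lieBracket ℝ X Z x ∈ fiber (derivedFlag Δ k) x := by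
    intro X Z hX hXc hZ hZm x hx
    have hXm := (H.mem_charSpace_iff hk (hNW hx)).1 (hXc x hx)
    refine H.lieBracket_mem_fiber hk (hNW hx)
      ((hX.contDiffAt (hN.mem_nhds hx)).differentiableAt (by simp))
      ((hZ.contDiffAt (hN.mem_nhds hx)).differentiableAt (by simp)) ?_ ?_
      fun θ hθ => hXm.2 θ hθ _ (hZm x hx)
    · filter_upwards [hN.mem_nhds hx] with y hy
      exact ((H.mem_charSpace_iff hk (hNW hy)).1 (hXc y hy)).1
    · filter_upwards [hN.mem_nhds hx] with y hy using hZm y hy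
  have hXm : ∀ x ∈ N, X x ∈ fiber (derivedFlag Δ k) x := fun x hx =>
    ((H.mem_charSpace_iff hk (hNW hx)).1 (hXc x hx)).1
  have hYm : ∀ x ∈ N, Y x ∈ fiber (derivedFlag Δ k) x := fun x hx =>
    ((H.mem_charSpace_iff hk (hNW hx)).1 (hYc x hx)).1
  have hbr := key hX hXc hY hYm
  rw [H.mem_charSpace_iff hk (hNW hq)]
  refine ⟨hbr q hq, fun θ hθ w hw => ?_⟩
  obtain ⟨Z, hZ, rfl⟩ := hw
  have hNq := hN.mem_nhds hq
  have hZs : ContDiffOn ℝ ∞ Z N := ContDiffOn.mono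
    (derivedFlag_le_smoothMaps Δ H.isOpen_domain H.le_smoothMaps k hZ) (hNW.trans H.subset)
  -- the exterior derivative of `θ` vanishes on a characteristic field and a section of `G_k`
  have hz : ∀ {X Z : E → E}, ContDiffOn ℝ ∞ X N → (∀ x ∈ N, X x ∈ charSpace Δ k x) →
      ContDiffOn ℝ ∞ Z N → (∀ x ∈ N, Z x ∈ fiber (derivedFlag Δ k) x) →
      θ q (lieBracket ℝ X Z q) = 0 := fun hX hXc hZ hZm =>
    apply_eq_zero_of_mem_annihilator hθ (H.subset (hNW hq)) (key hX hXc hZ hZm q hq)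
  have h1 := hz hX hXc (ContDiffOn.lieBracket_of_isOpen hN hY hZs)
    (key hY hYc hZs fun x _ => mem_fiber hZ x)
  have h2 := hz hY hYc (ContDiffOn.lieBracket_of_isOpen hN hX hZs)
    (key hX hXc hZs fun x _ => mem_fiber hZ x)
  have h3 := leibniz_identity_lieBracket (𝕜 := ℝ) (n := ∞) minSmoothness_two_le_infty
    (hX.contDiffAt hNq) (hY.contDiffAt hNq) (hZs.contDiffAt hNq)
  rw [h3, map_add, h2, add_zero] at h1
  have h4 := H.apply_lieBracket (X := lieBracket ℝ X Y) (Y := Z) hθ (hNW hq)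
    (((ContDiffOn.lieBracket_of_isOpen hN hX hY).contDiffAt hNq).differentiableAt (by simp))
    ((hZs.contDiffAt hNq).differentiableAt (by simp))
    (by filter_upwards [hNq] with y hy using hbr y hy)
    (Eventually.of_forall (mem_fiber hZ))
  rw [h1] at h4
  exact neg_eq_zero.1 h4.symm

end IsRegularFlag

end Regular

/-! ### A common first integral of the Cauchy characteristics -/

section FirstFunction

variable {E : Type} [NormedAddCommGroup E] [NormedSpace ℝ E] [FiniteDimensional ℝ E]
variable {U W : Set E} {Δ : Submodule (smoothFunctions U) (E → E)}

namespace IsRegularFlag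

variable (H : IsRegularFlag W Δ) {k : ℕ} {q : E}
include H

/-- A characteristic vector of `G_{k+1}` lies in `G_k`: the bracket form of `G_{k+1}` does not
vanish on `G_{k+1} × Δ` but does on `G_k × Δ`, so a component outside `G_k` would be detected. -/
theorem charSpace_succ_le (hk : k + 4 ≤ finrank ℝ E) (hq : q ∈ W) :
    charSpace Δ (k + 1) q ≤ fiber (derivedFlag Δ k) q := by
  intro x hx
  obtain ⟨hx, hx'⟩ := (H.mem_charSpace_iff (by omega) hq).1 hx
  obtain ⟨θ, hθ, v, hv, w, hw, hvw⟩ := H.exists_curl_ne_zero (k := k + 1) (by omega) hq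
  have hwk := fiber_mono (derivedFlag_mono Δ (Nat.zero_le k)) q hw
  obtain ⟨a, ha, s, rfl⟩ := H.exists_add_smul (by omega) hθ hq hv hwk hvw hx
  have h1 := hx' θ hθ w (fiber_mono (derivedFlag_le_succ Δ k) q hwk)
  rw [map_add, add_apply, H.curl_eq_zero_of_succ hθ hq ha hwk, zero_add, map_smul, smul_apply,
    smul_eq_mul] at h1
  rw [(mul_eq_zero.1 h1).resolve_right hvw, zero_smul, add_zero]
  exact ha

/-- The characteristic space of `G_{k+1}` is a hyperplane in `G_k`. -/
theorem finrank_charSpace (hk : k + 4 ≤ finrank ℝ E) (hq : q ∈ W) :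
    finrank ℝ (charSpace Δ (k + 1) q) = k + 1 := by
  obtain ⟨θ, hθ, v, hv, w, hw, hvw⟩ := H.exists_curl_ne_zero (k := k + 1) (by omega) hq
  have hwk := fiber_mono (derivedFlag_mono Δ (Nat.zero_le k)) q hw
  have h1 : charSpace Δ (k + 1) q < fiber (derivedFlag Δ k) q := by
    refine lt_of_le_of_ne (H.charSpace_succ_le hk hq) fun he => hvw ?_
    rw [← he] at hwk
    rw [curl_swap, ((H.mem_charSpace_iff (by omega) hq).1 hwk).2 θ hθ v hv, neg_zero]
  have h2 := Submodule.finrank_lt_finrank_of_lt h1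
  have h3 : fiber (derivedFlag Δ k) q ≤ charSpace Δ (k + 1) q ⊔ Submodule.span ℝ {w} := by
    intro u hu
    have := H.sub_smul_mem_charSpace hk hθ hq hv hwk hvw hu
    rw [← sub_add_cancel u ((curl θ q v u / curl θ q v w) • w)]
    exact Submodule.add_mem_sup this
      (Submodule.smul_mem _ _ (Submodule.mem_span_singleton_self w))
  have h4 := (Submodule.finrank_mono h3).trans (Submodule.finrank_add_le_finrank_add_finrank _ _)
  have h5 := finrank_span_singleton (K := ℝ) (v := w) fun h => hvw (by simp [h])
  rw [H.finrank_derivedFlag k (by omega) q hq] at h2 h4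
  omega

/-- Near a point of `W` there is a function that is constant along all the Cauchy characteristic
distributions but not along `Δ`. -/
theorem exists_characteristic_integral {p : E} (hp : p ∈ W) (hn : 2 ≤ finrank ℝ E) :
    ∃ (h : E → ℝ) (N : Set E), IsOpen N ∧ p ∈ N ∧ N ⊆ W ∧ ContDiffOn ℝ ∞ h N ∧
      (∃ w ∈ fiber Δ p, fderiv ℝ h p w ≠ 0) ∧
      ∀ q ∈ N, ∀ k, k + 4 ≤ finrank ℝ E → ∀ v ∈ charSpace Δ (k + 1) q, fderiv ℝ h q v = 0 := by
  -- below dimension four there are no conditions, and any linear form not vanishing on `Δ` serves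
  rcases lt_or_ge (finrank ℝ E) 4 with hlt | hge
  · have h1 : 0 < finrank ℝ (fiber Δ p) := by
      have := H.finrank_derivedFlag 0 (by omega) p hp
      change finrank ℝ (fiber Δ p) = _ at this
      omega
    obtain ⟨⟨w, hw⟩, hw0⟩ := (finrank_pos_iff_exists_ne_zero (R := ℝ)).1 h1
    have hw0' : w ∉ (⊥ : Submodule ℝ E) := fun h => hw0 (Subtype.ext ((Submodule.mem_bot ℝ).1 h))
    obtain ⟨ξ, hξ, -⟩ := Submodule.exists_le_ker_of_notMem hw0'
    let ξ' : E →L[ℝ] ℝ := LinearMap.toContinuousLinearMap ξ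
    refine ⟨ξ', W, H.isOpen, hp, Subset.rfl, ξ'.contDiff.contDiffOn, ⟨w, hw, ?_⟩,
      fun q _ k hk => by omega⟩
    rw [ξ'.fderiv]
    exact hξ
  obtain ⟨m, hm⟩ : ∃ m, finrank ℝ E = m + 4 := ⟨finrank ℝ E - 4, by omega⟩
  obtain ⟨θ, hθ, v, hv, w, hw, hvw⟩ := H.exists_curl_ne_zero (k := m + 1) (by omega) hp
  obtain ⟨V, hV, rfl⟩ := hv
  obtain ⟨B, hB, rfl⟩ := hw
  have hBm : B ∈ derivedFlag Δ m := derivedFlag_mono Δ (Nat.zero_le m) hB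
  obtain ⟨b⟩ : Nonempty (Basis (Fin (m + 1)) ℝ (charSpace Δ (m + 1) p)) :=
    ⟨finBasisOfFinrankEq ℝ _ (H.finrank_charSpace (by omega) hp)⟩
  choose Y hYm hYp using fun i => H.charSpace_succ_le (by omega) hp (b i).2
  -- smoothness on `W` of the sections and of the coefficients `dθ(V, ·)`
  have hs : ∀ {j : ℕ} {X : E → E}, X ∈ derivedFlag Δ j → ContDiffOn ℝ ∞ X W := fun hX =>
    ContDiffOn.mono (derivedFlag_le_smoothMaps Δ H.isOpen_domain H.le_smoothMaps _ hX) H.subset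
  have hdθ : ContDiffOn ℝ ∞ (fderiv ℝ θ) W :=
    ContDiffOn.fderiv_of_isOpen (ContDiffOn.mono hθ.1 H.subset) H.isOpen le_rfl
  have hcurl : ∀ {X : E → E}, ContDiffOn ℝ ∞ X W →
      ContDiffOn ℝ ∞ (fun q => curl θ q (V q) (X q)) W := fun hX =>
    ((hdθ.clm_apply (hs hV)).clm_apply hX).sub ((hdθ.clm_apply hX).clm_apply (hs hV))
  let c : E → ℝ := fun q => curl θ q (V q) (B q)
  have hc : ContDiffOn ℝ ∞ c W := hcurl (hs hBm)
  -- a smooth local frame of the largest characteristic distribution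
  let X : Fin (m + 1) → E → E := fun i q => Y i q - (curl θ q (V q) (Y i q) / c q) • B q
  have hN₁ : IsOpen (W ∩ c ⁻¹' {0}ᶜ) :=
    hc.continuousOn.isOpen_inter_preimage H.isOpen isOpen_compl_singleton
  have hXs : ∀ i, ContDiffOn ℝ ∞ (X i) (W ∩ c ⁻¹' {0}ᶜ) := fun i =>
    ((hs (hYm i)).mono inter_subset_left).sub
      ((((hcurl (hs (hYm i))).mono inter_subset_left).div (hc.mono inter_subset_left)
        fun q hq => hq.2).smul ((hs hBm).mono inter_subset_left))
  have hpN₁ : p ∈ W ∩ c ⁻¹' {0}ᶜ := ⟨hp, hvw⟩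
  have hXp : ∀ i, X i p = b i := by
    intro i
    have h1 := ((H.mem_charSpace_iff (by omega) hp).1 (b i).2).2 θ hθ _ (mem_fiber hV p)
    simp only [X, hYp]
    rw [curl_swap, h1]
    simp
  have hlip : LinearIndependent ℝ (fun i => X i p) := by
    have h1 : (fun i => X i p) = (charSpace Δ (m + 1) p).subtype ∘ b := funext hXp
    rw [h1]
    exact b.linearIndependent.map' _ (Submodule.ker_subtype _)
  have hcont : ContinuousOn (fun q i => X i q) (W ∩ c ⁻¹' {0}ᶜ) :=
    continuousOn_pi.2 fun i => (hXs i).continuousOn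
  have hN := hcont.isOpen_inter_preimage hN₁ (isOpen_setOfPred_linearIndependent (𝕜 := ℝ))
  set N := (W ∩ c ⁻¹' {0}ᶜ) ∩ (fun q i => X i q) ⁻¹' {f : Fin (m + 1) → E |
    LinearIndependent ℝ f} with hNdef
  have hNW : N ⊆ W := fun q hq => hq.1.1
  have hXc : ∀ q ∈ N, ∀ i, X i q ∈ charSpace Δ (m + 1) q := fun q hq i =>
    H.sub_smul_mem_charSpace (by omega) hθ (hNW hq) (mem_fiber hV q) (mem_fiber hBm q) hq.1.2
      (mem_fiber (hYm i) q)
  have hspan : ∀ q ∈ N, charSpace Δ (m + 1) q = Submodule.span ℝ (range fun i => X i q) := by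
    intro q hq
    refine (Submodule.eq_of_le_of_finrank_le (Submodule.span_le.2 ?_) ?_).symm
    · rintro _ ⟨i, rfl⟩
      exact hXc q hq i
    · rw [H.finrank_charSpace (by omega) (hNW hq), finrank_span_eq_card hq.2, Fintype.card_fin]
  have hXN : ∀ i, ContDiffOn ℝ ∞ (X i) N := fun i => (hXs i).mono inter_subset_left
  have hBp : B p ∉ charSpace Δ (m + 1) p := fun hmem => by
    have h1 := ((H.mem_charSpace_iff (by omega) hp).1 hmem).2 θ hθ _ (mem_fiber hV p)
    rw [curl_swap, neg_eq_zero] at h1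
    exact hvw h1
  obtain ⟨ξ, hξ, hξ'⟩ := Submodule.exists_le_ker_of_notMem hBp
  obtain ⟨h, N', hN', hpN', hN'N, hh, hXh, hhp⟩ := exists_first_integral hN hXN
    (⟨hpN₁, hlip⟩ : p ∈ N) hlip
    (fun q hq i j => hspan q hq ▸ H.lieBracket_mem_charSpace (by omega) hN hNW (hXN i) (hXN j)
      (fun x hx => hXc x hx i) (fun x hx => hXc x hx j) hq)
    (LinearMap.toContinuousLinearMap ξ) (fun i => hξ' (by rw [hXp]; exact (b i).2))
  refine ⟨h, N', hN', hpN', hN'N.trans hNW, hh, ⟨B p, mem_fiber hB p, ?_⟩, ?_⟩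
  · rw [hhp]
    exact hξ
  · intro q hq k hk v hv
    have h1 := H.charSpace_mono (k := k + 1) (l := m + 1) (by omega) (by omega)
      (hNW (hN'N hq)) hv
    rw [hspan q (hN'N hq)] at h1
    have h2 : Submodule.span ℝ (range fun i => X i q) ≤
        LinearMap.ker (fderiv ℝ h q : E →ₗ[ℝ] ℝ) := by
      rw [Submodule.span_le]
      rintro _ ⟨i, rfl⟩
      exact hXh q hq i
    exact h2 h1

end IsRegularFlag

end FirstFunction

/-! ### Brackets and contact forms -/

section Derivations

variable {E : Type*} [NormedAddCommGroup E] [NormedSpace ℝ E]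

theorem ContDiffOn.fderiv_apply_of_isOpen {N : Set E} (hN : IsOpen N) {z : E → ℝ} {X : E → E}
    (hz : ContDiffOn ℝ ∞ z N) (hX : ContDiffOn ℝ ∞ X N) :
    ContDiffOn ℝ ∞ (fun q => fderiv ℝ z q (X q)) N :=
  (hz.fderiv_of_isOpen hN le_rfl).clm_apply hX

/-- If `z` has constant derivative along `Y`, then only the second term remains in
`dz([X, Y]) = X(Y z) - Y(X z)`. -/
theorem fderiv_lieBracket_of_const {N : Set E} (hN : IsOpen N) {z : E → ℝ} {X Y : E → E} {a : ℝ}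
    (hz : ContDiffOn ℝ ∞ z N) (hX : ContDiffOn ℝ ∞ X N) (hY : ContDiffOn ℝ ∞ Y N)
    (ha : ∀ q ∈ N, fderiv ℝ z q (Y q) = a) {q : E} (hq : q ∈ N) :
    fderiv ℝ z q (lieBracket ℝ X Y q) = -fderiv ℝ (fun q => fderiv ℝ z q (X q)) q (Y q) := by
  have hNq := hN.mem_nhds hq
  rw [fderiv_apply_lieBracket (hz.contDiffAt hNq) minSmoothness_two_le_infty
    ((hY.contDiffAt hNq).differentiableAt (by simp))
    ((hX.contDiffAt hNq).differentiableAt (by simp))]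
  have : (fun x => fderiv ℝ z x (Y x)) =ᶠ[𝓝 q] fun _ => a := by
    filter_upwards [hNq] with x hx using ha x hx
  rw [this.fderiv_eq]
  simp

theorem fderiv_lieBracket_eq_zero {N : Set E} (hN : IsOpen N) {z : E → ℝ} {X Y : E → E} {a b : ℝ}
    (hz : ContDiffOn ℝ ∞ z N) (hX : ContDiffOn ℝ ∞ X N) (hY : ContDiffOn ℝ ∞ Y N)
    (ha : ∀ q ∈ N, fderiv ℝ z q (X q) = a) (hb : ∀ q ∈ N, fderiv ℝ z q (Y q) = b) {q : E}
    (hq : q ∈ N) : fderiv ℝ z q (lieBracket ℝ X Y q) = 0 := by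
  rw [fderiv_lieBracket_of_const hN hz hX hY hb hq]
  have : (fun x => fderiv ℝ z x (X x)) =ᶠ[𝓝 q] fun _ => a := by
    filter_upwards [hN.mem_nhds hq] with x hx using ha x hx
  rw [this.fderiv_eq]
  simp

/-- The contact form `dz - a dh`. -/
noncomputable def contactForm (z a h : E → ℝ) (q : E) : E →L[ℝ] ℝ :=
  fderiv ℝ z q - a q • fderiv ℝ h q

theorem contactForm_apply (z a h : E → ℝ) (q v : E) :
    contactForm z a h q v = fderiv ℝ z q v - a q * fderiv ℝ h q v := rfl

theorem contDiffOn_contactForm {N : Set E} (hN : IsOpen N) {z a h : E → ℝ}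
    (hz : ContDiffOn ℝ ∞ z N) (ha : ContDiffOn ℝ ∞ a N) (hh : ContDiffOn ℝ ∞ h N) :
    ContDiffOn ℝ ∞ (contactForm z a h) N :=
  (hz.fderiv_of_isOpen hN le_rfl).sub (ha.smul (hh.fderiv_of_isOpen hN le_rfl))

theorem fderiv_fderiv_comm {z : E → ℝ} {q : E} (hz : ContDiffAt ℝ ∞ z q) (v w : E) :
    fderiv ℝ (fderiv ℝ z) q v w = fderiv ℝ (fderiv ℝ z) q w v :=
  hz.isSymmSndFDerivAt minSmoothness_two_le_infty v w

/-- The exterior derivative of the contact form `dz - a dh` is `-da ∧ dh`. -/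
theorem curl_contactForm {z a h : E → ℝ} {q : E} (hz : ContDiffAt ℝ ∞ z q)
    (ha : ContDiffAt ℝ ∞ a q) (hh : ContDiffAt ℝ ∞ h q) (v w : E) :
    curl (contactForm z a h) q v w =
      fderiv ℝ a q w * fderiv ℝ h q v - fderiv ℝ a q v * fderiv ℝ h q w := by
  have hd : ∀ {z : E → ℝ}, ContDiffAt ℝ ∞ z q → DifferentiableAt ℝ (fderiv ℝ z) q := fun hz =>
    (hz.fderiv_right (m := ∞) le_rfl).differentiableAt (by simp)
  have h1 := ((hd hz).hasFDerivAt.sub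
    ((ha.differentiableAt (by simp)).hasFDerivAt.smul (hd hh).hasFDerivAt)).fderiv
  have h2 : fderiv ℝ (contactForm z a h) q = _ := h1
  rw [curl_apply, h2]
  simp [fderiv_fderiv_comm hz v w, fderiv_fderiv_comm hh v w]

end Derivations

/-! ### Adapted frames and their iterated brackets -/

section AdaptedFrame

variable {E : Type} [NormedAddCommGroup E] [NormedSpace ℝ E]
variable {U W : Set E} {Δ : Submodule (smoothFunctions U) (E → E)}

/-- A function `h` on `N` that is constant along the Cauchy characteristics of the derived flag of
`Δ`, together with a smooth frame `b₁`, `b₂` of `Δ` normalized by `dh(b₁) = 1` and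
`dh(b₂) = 0`. -/
structure IsAdaptedFrame (W N : Set E) (Δ : Submodule (smoothFunctions U) (E → E)) (h : E → ℝ)
    (b₁ b₂ : E → E) : Prop where
  isOpen : IsOpen N
  subset : N ⊆ W
  contDiffOn_h : ContDiffOn ℝ ∞ h N
  contDiffOn_b₁ : ContDiffOn ℝ ∞ b₁ N
  contDiffOn_b₂ : ContDiffOn ℝ ∞ b₂ N
  b₁_mem : ∀ q ∈ N, b₁ q ∈ fiber Δ q
  b₂_mem : ∀ q ∈ N, b₂ q ∈ fiber Δ q
  fderiv_b₁ : ∀ q ∈ N, fderiv ℝ h q (b₁ q) = 1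
  fderiv_b₂ : ∀ q ∈ N, fderiv ℝ h q (b₂ q) = 0
  exists_eq : ∀ q ∈ N, ∀ v ∈ fiber Δ q, ∃ s t : ℝ, v = s • b₁ q + t • b₂ q
  fderiv_charSpace : ∀ q ∈ N, ∀ k, k + 4 ≤ finrank ℝ E → ∀ v ∈ charSpace Δ (k + 1) q,
    fderiv ℝ h q v = 0

/-- The iterated brackets `c₀ = b₂`, `c_{k+1} = [b₁, c_k]`. -/
noncomputable def iterBracket (b₁ b₂ : E → E) : ℕ → E → E
  | 0 => b₂
  | k + 1 => lieBracket ℝ b₁ (iterBracket b₁ b₂ k)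

/-- The iterated derivatives `z₀ = y`, `z_{i+1} = dz_i(b₁)`. -/
noncomputable def iterDeriv (b₁ : E → E) (y : E → ℝ) : ℕ → E → ℝ
  | 0 => y
  | i + 1 => fun q => fderiv ℝ (iterDeriv b₁ y i) q (b₁ q)

namespace IsAdaptedFrame

variable {N : Set E} {h : E → ℝ} {b₁ b₂ : E → E} (A : IsAdaptedFrame W N Δ h b₁ b₂) {q : E}
  {k : ℕ}
include A

theorem mono {N' : Set E} (hN' : IsOpen N') (hsub : N' ⊆ N) : IsAdaptedFrame W N' Δ h b₁ b₂ where
  isOpen := hN'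
  subset := hsub.trans A.subset
  contDiffOn_h := A.contDiffOn_h.mono hsub
  contDiffOn_b₁ := A.contDiffOn_b₁.mono hsub
  contDiffOn_b₂ := A.contDiffOn_b₂.mono hsub
  b₁_mem q hq := A.b₁_mem q (hsub hq)
  b₂_mem q hq := A.b₂_mem q (hsub hq)
  fderiv_b₁ q hq := A.fderiv_b₁ q (hsub hq)
  fderiv_b₂ q hq := A.fderiv_b₂ q (hsub hq)
  exists_eq q hq := A.exists_eq q (hsub hq)
  fderiv_charSpace q hq := A.fderiv_charSpace q (hsub hq)

theorem contDiffOn_iterBracket (k : ℕ) : ContDiffOn ℝ ∞ (iterBracket b₁ b₂ k) N := by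
  induction k with
  | zero => exact A.contDiffOn_b₂
  | succ k ih => exact ContDiffOn.lieBracket_of_isOpen A.isOpen A.contDiffOn_b₁ ih

theorem differentiableAt_iterBracket (k : ℕ) (hq : q ∈ N) :
    DifferentiableAt ℝ (iterBracket b₁ b₂ k) q :=
  ((A.contDiffOn_iterBracket k).contDiffAt (A.isOpen.mem_nhds hq)).differentiableAt (by simp)

theorem differentiableAt_b₁ (hq : q ∈ N) : DifferentiableAt ℝ b₁ q :=
  (A.contDiffOn_b₁.contDiffAt (A.isOpen.mem_nhds hq)).differentiableAt (by simp)

theorem fderiv_iterBracket (k : ℕ) : ∀ q ∈ N, fderiv ℝ h q (iterBracket b₁ b₂ k q) = 0 := by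
  induction k with
  | zero => exact A.fderiv_b₂
  | succ k ih =>
    exact fun q hq => fderiv_lieBracket_eq_zero A.isOpen A.contDiffOn_h A.contDiffOn_b₁
      (A.contDiffOn_iterBracket k) A.fderiv_b₁ ih hq

theorem b₁_mem_derivedFlag (k : ℕ) (hq : q ∈ N) : b₁ q ∈ fiber (derivedFlag Δ k) q :=
  fiber_mono (derivedFlag_mono Δ (Nat.zero_le k)) q (A.b₁_mem q hq)

theorem contDiffOn_iterDeriv {y : E → ℝ} (hy : ContDiffOn ℝ ∞ y N) (i : ℕ) :
    ContDiffOn ℝ ∞ (iterDeriv b₁ y i) N := by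
  induction i with
  | zero => exact hy
  | succ i ih => exact ContDiffOn.fderiv_apply_of_isOpen A.isOpen ih A.contDiffOn_b₁

variable [FiniteDimensional ℝ E] (H : IsRegularFlag W Δ)
include H

theorem iterBracket_mem (k : ℕ) (hk : k + 2 ≤ finrank ℝ E) :
    ∀ q ∈ N, iterBracket b₁ b₂ k q ∈ fiber (derivedFlag Δ k) q := by
  induction k with
  | zero => exact A.b₂_mem
  | succ k ih =>
    intro q hq
    refine H.lieBracket_mem_fiber_succ (by omega) (A.subset hq) (A.differentiableAt_b₁ hq)
      (A.differentiableAt_iterBracket k hq) ?_ ?_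
    · filter_upwards [A.isOpen.mem_nhds hq] with x hx using A.b₁_mem_derivedFlag k hx
    · filter_upwards [A.isOpen.mem_nhds hq] with x hx using ih (by omega) x hx

/-- The level sets of `h` meet `G_k` in the Cauchy characteristic space of `G_{k+1}`. -/
theorem mem_charSpace (hk : k + 4 ≤ finrank ℝ E) (hq : q ∈ N) {u : E}
    (hu : u ∈ fiber (derivedFlag Δ k) q) (hu0 : fderiv ℝ h q u = 0) :
    u ∈ charSpace Δ (k + 1) q := by
  have hqW := A.subset hq
  obtain ⟨θ, hθ, v, hv, w, hw, hvw⟩ := H.exists_curl_ne_zero (k := k + 1) (by omega) hqW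
  have hwk := fiber_mono (derivedFlag_mono Δ (Nat.zero_le k)) q hw
  have h1 := A.fderiv_charSpace q hq k hk _
    (H.sub_smul_mem_charSpace hk hθ hqW hv hwk hvw (A.b₁_mem_derivedFlag k hq))
  have h2 := H.sub_smul_mem_charSpace hk hθ hqW hv hwk hvw hu
  have h3 := A.fderiv_charSpace q hq k hk _ h2
  have hw0 : fderiv ℝ h q w ≠ 0 := fun h0 => by
    rw [map_sub, map_smul, h0, A.fderiv_b₁ q hq] at h1
    simp at h1
  rw [map_sub, map_smul, hu0, zero_sub, neg_eq_zero, smul_eq_mul] at h3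
  rw [(mul_eq_zero.1 h3).resolve_right hw0, zero_smul, sub_zero] at h2
  exact h2

/-- A form that annihilates `G_k`, and the iterated bracket `c_{k+1}` at `q`, does not see the
brackets of `G_k` with `Δ` at `q`. Dually, `c_{k+1}` spans `G_{k+1}` modulo `G_k`. The argument uses
that `b₂` is characteristic for `G_k` if `k ≥ 1`, so that only brackets of `c_k` with `b₁`
matter. -/
theorem curl_eq_zero {θ : E → E →L[ℝ] ℝ} (hk : k + 3 ≤ finrank ℝ E) (hq : q ∈ N)
    (ih : ∀ l < k, ∀ x ∈ fiber (derivedFlag Δ (l + 1)) q,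
      ∃ a ∈ fiber (derivedFlag Δ l) q, ∃ s : ℝ, x = a + s • iterBracket b₁ b₂ (l + 1) q)
    (hθ : θ ∈ annihilator (derivedFlag Δ k)) (hθc : θ q (iterBracket b₁ b₂ (k + 1) q) = 0) {x y : E}
    (hx : x ∈ fiber (derivedFlag Δ k) q) (hy : y ∈ fiber Δ q) : curl θ q x y = 0 := by
  have hqW := A.subset hq
  have hNq := A.isOpen.mem_nhds hq
  have h1 : curl θ q (b₁ q) (iterBracket b₁ b₂ k q) = 0 := by
    have := H.apply_lieBracket hθ hqW (A.differentiableAt_b₁ hq)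
      (A.differentiableAt_iterBracket k hq)
      (by filter_upwards [hNq] with x hx using A.b₁_mem_derivedFlag k hx)
      (by filter_upwards [hNq] with x hx using A.iterBracket_mem H k (by omega) x hx)
    rw [← neg_eq_zero, ← this]
    exact hθc
  have h2 : curl θ q (iterBracket b₁ b₂ k q) (b₁ q) = 0 := by
    rw [curl_swap, h1, neg_zero]
  obtain ⟨s, t, rfl⟩ := A.exists_eq q hq y hy
  rw [map_add, map_smul, map_smul]
  rcases k with _ | k
  · obtain ⟨s', t', rfl⟩ := A.exists_eq q hq x hx
    have h1' : curl θ q (b₁ q) (b₂ q) = 0 := h1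
    have h2' : curl θ q (b₂ q) (b₁ q) = 0 := h2
    simp [h1', h2']
  · obtain ⟨a, ha, s', rfl⟩ := ih k (by omega) x hx
    have h3 : curl θ q (a + s' • iterBracket b₁ b₂ (k + 1) q) (b₁ q) = 0 := by
      rw [map_add, add_apply, H.curl_eq_zero_of_succ hθ hqW ha (A.b₁_mem_derivedFlag k hq),
        map_smul, smul_apply, h2, smul_zero, add_zero]
    have h4 : b₂ q ∈ charSpace Δ (k + 1) q := A.mem_charSpace H (by omega) hq
      (fiber_mono (derivedFlag_mono Δ (Nat.zero_le k)) q (A.b₂_mem q hq)) (A.fderiv_b₂ q hq)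
    rw [h3, curl_swap, ((H.mem_charSpace_iff (by omega) hqW).1 h4).2 θ hθ _ hx]
    simp

/-- `G_{k+1} = G_k + ⟨c_{k+1}⟩`. -/
theorem exists_add_smul_iterBracket (hk : k + 3 ≤ finrank ℝ E) (hq : q ∈ N) :
    ∀ x ∈ fiber (derivedFlag Δ (k + 1)) q,
      ∃ a ∈ fiber (derivedFlag Δ k) q, ∃ s : ℝ, x = a + s • iterBracket b₁ b₂ (k + 1) q := by
  induction k using Nat.strong_induction_on with
  | _ k ih =>
    have hqW := A.subset hq
    have hsub : fiber (lieFlag Δ (k + 1)) q ≤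
        fiber (derivedFlag Δ k) q ⊔ Submodule.span ℝ {iterBracket b₁ b₂ (k + 1) q} := by
      refine fiber_sup_bracket_le
        ((fiber_mono (lieFlag_le_derivedFlag Δ k) q).trans le_sup_left) fun X hX Y hY => ?_
      by_contra hne
      obtain ⟨ξ, hξ, hξ'⟩ := Submodule.exists_le_ker_of_notMem hne
      obtain ⟨θ, hθ, hθq⟩ := exists_mem_annihilator_apply_eq
        (derivedFlag_le_smoothMaps Δ H.isOpen_domain H.le_smoothMaps k)
        H.isOpen H.subset (H.finrank_derivedFlag k (by omega)) hqW
        (LinearMap.toContinuousLinearMap ξ) (fun v hv => hξ' (Submodule.mem_sup_left hv))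
      have hX' := lieFlag_le_derivedFlag Δ k hX
      have hY' : Y ∈ derivedFlag Δ k := derivedFlag_mono Δ (Nat.zero_le k) hY
      have h1 := H.apply_lieBracket_of_mem hθ hqW hX' hY'
      rw [A.curl_eq_zero H hk hq (fun l hl => ih l hl (by omega)) hθ
        (by rw [hθq]; exact hξ' (Submodule.mem_sup_right (Submodule.mem_span_singleton_self _)))
        (mem_fiber hX' q) (mem_fiber hY q), neg_zero, hθq] at h1
      exact hξ h1
    rw [H.fiber_lieFlag_eq (by omega) hqW] at hsub
    intro x hx
    obtain ⟨a, ha, c, hc, rfl⟩ := Submodule.mem_sup.1 (hsub hx)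
    obtain ⟨s, rfl⟩ := Submodule.mem_span_singleton.1 hc
    exact ⟨a, ha, s, rfl⟩

/-- `G_k` is spanned by `b₁` and `c_0, …, c_k`. -/
theorem fiber_derivedFlag_le (k : ℕ) (hk : k + 2 ≤ finrank ℝ E) (hq : q ∈ N) :
    fiber (derivedFlag Δ k) q ≤ Submodule.span ℝ {b₁ q} ⊔
      Submodule.span ℝ (range fun i : Fin (k + 1) => iterBracket b₁ b₂ i q) := by
  induction k with
  | zero =>
    intro x hx
    obtain ⟨s, t, rfl⟩ := A.exists_eq q hq x hx
    exact Submodule.add_mem_sup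
      (Submodule.smul_mem _ _ (Submodule.mem_span_singleton_self _))
      (Submodule.smul_mem _ _ (Submodule.subset_span ⟨0, rfl⟩))
  | succ k ih =>
    intro x hx
    obtain ⟨a, ha, s, rfl⟩ := A.exists_add_smul_iterBracket H (by omega) hq x hx
    have hmono : Submodule.span ℝ (range fun i : Fin (k + 1) => iterBracket b₁ b₂ i q) ≤
        Submodule.span ℝ (range fun i : Fin (k + 1 + 1) => iterBracket b₁ b₂ i q) := by
      refine Submodule.span_mono ?_
      rintro _ ⟨i, rfl⟩
      exact ⟨i.castSucc, rfl⟩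
    have ha' := sup_le_sup_left hmono (Submodule.span ℝ {b₁ q}) (ih (by omega) ha)
    exact add_mem ha' (Submodule.mem_sup_right (Submodule.smul_mem _ _
        (Submodule.subset_span ⟨Fin.last (k + 1), rfl⟩)))

theorem linearIndependent_iterBracket (k : ℕ) (hk : k + 2 ≤ finrank ℝ E) (hq : q ∈ N) :
    LinearIndependent ℝ (fun i : Fin (k + 1) => iterBracket b₁ b₂ i q) := by
  rw [linearIndependent_iff_card_le_finrank_span, Fintype.card_fin, Set.finrank]
  have h1 := (Submodule.finrank_mono (A.fiber_derivedFlag_le H k hk hq)).trans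
    (Submodule.finrank_add_le_finrank_add_finrank _ _)
  have h2 : b₁ q ≠ 0 := fun h0 => by
    have := A.fderiv_b₁ q hq
    rw [h0, map_zero] at this
    exact zero_ne_one this
  rw [finrank_span_singleton h2, H.finrank_derivedFlag k hk q (A.subset hq)] at h1
  omega

/-- `G_k ∩ ker dh` is spanned by `c_0, …, c_k`. -/
theorem mem_span_iterBracket (k : ℕ) (hk : k + 2 ≤ finrank ℝ E) (hq : q ∈ N) {x : E}
    (hx : x ∈ fiber (derivedFlag Δ k) q) (hx0 : fderiv ℝ h q x = 0) :
    x ∈ Submodule.span ℝ (range fun i : Fin (k + 1) => iterBracket b₁ b₂ i q) := by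
  obtain ⟨a, ha, b, hb, rfl⟩ := Submodule.mem_sup.1 (A.fiber_derivedFlag_le H k hk hq hx)
  obtain ⟨s, rfl⟩ := Submodule.mem_span_singleton.1 ha
  have h1 : Submodule.span ℝ (range fun i : Fin (k + 1) => iterBracket b₁ b₂ i q) ≤
      LinearMap.ker (fderiv ℝ h q : E →ₗ[ℝ] ℝ) := by
    rw [Submodule.span_le]
    rintro _ ⟨i, rfl⟩
    exact A.fderiv_iterBracket i q hq
  have h2 : fderiv ℝ h q b = 0 := h1 hb
  rw [map_add, h2, map_smul, A.fderiv_b₁ q hq] at hx0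
  have : s = 0 := by simpa using hx0
  rw [this, zero_smul, zero_add]
  exact hb

/-- The level sets of `h` cut `G_k` in an involutive distribution. -/
theorem lieBracket_iterBracket_mem (k : ℕ) (hk : k + 3 ≤ finrank ℝ E) (hq : q ∈ N)
    (i j : Fin (k + 1)) :
    lieBracket ℝ (iterBracket b₁ b₂ i) (iterBracket b₁ b₂ j) q ∈
      Submodule.span ℝ (range fun i : Fin (k + 1) => iterBracket b₁ b₂ i q) := by
  have hqW := A.subset hq
  have hNq := A.isOpen.mem_nhds hq
  have hmem : ∀ i : Fin (k + 1), ∀ x ∈ N, iterBracket b₁ b₂ i x ∈ fiber (derivedFlag Δ k) x :=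
    fun i x hx => fiber_mono (derivedFlag_mono Δ (Nat.lt_succ_iff.1 i.2)) x
      (A.iterBracket_mem H i (by omega) x hx)
  -- all `c_i` but the last one are characteristic for `G_k`
  have hchar : ∀ i : Fin (k + 1), (i : ℕ) < k → ∀ θ ∈ annihilator (derivedFlag Δ k),
      ∀ w ∈ fiber (derivedFlag Δ k) q, curl θ q (iterBracket b₁ b₂ i q) w = 0 := by
    intro i hi
    obtain ⟨l, rfl⟩ : ∃ l, k = l + 1 := ⟨k - 1, by omega⟩
    exact ((H.mem_charSpace_iff (by omega) hqW).1 (A.mem_charSpace H (by omega) hq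
      (fiber_mono (derivedFlag_mono Δ (Nat.lt_succ_iff.1 hi)) q
        (A.iterBracket_mem H i (by omega) q hq)) (A.fderiv_iterBracket i q hq))).2
  refine A.mem_span_iterBracket H k (by omega) hq ?_
    (fderiv_lieBracket_eq_zero A.isOpen A.contDiffOn_h (A.contDiffOn_iterBracket i)
      (A.contDiffOn_iterBracket j) (A.fderiv_iterBracket i) (A.fderiv_iterBracket j) hq)
  refine H.lieBracket_mem_fiber (by omega) hqW (A.differentiableAt_iterBracket i hq)
    (A.differentiableAt_iterBracket j hq)
    (by filter_upwards [hNq] with x hx using hmem i x hx)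
    (by filter_upwards [hNq] with x hx using hmem j x hx) fun θ hθ => ?_
  rcases Nat.lt_or_ge i k with hi | hi
  · exact hchar i hi θ hθ _ (hmem j q hq)
  rcases Nat.lt_or_ge j k with hj | hj
  · rw [curl_swap, hchar j hj θ hθ _ (hmem i q hq), neg_zero]
  · have : i = j := Fin.ext (by omega)
    rw [this, curl_self]

/-- There are functions constant along `c_0, …, c_{r-1}` but not along `c_r`, since these
fields span involutive distributions. -/
theorem exists_flat_output {r : ℕ} (hr : finrank ℝ E = r + 2) {p : E} (hp : p ∈ N) :
    ∃ (y : E → ℝ) (N' : Set E), IsOpen N' ∧ p ∈ N' ∧ N' ⊆ N ∧ ContDiffOn ℝ ∞ y N' ∧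
      (∀ q ∈ N', ∀ i < r, fderiv ℝ y q (iterBracket b₁ b₂ i q) = 0) ∧
      ∀ q ∈ N', fderiv ℝ y q (iterBracket b₁ b₂ r q) ≠ 0 := by
  have hli := A.linearIndependent_iterBracket H r (by omega) hp
  have hlast : iterBracket b₁ b₂ r p ∉
      Submodule.span ℝ (range fun i : Fin r => iterBracket b₁ b₂ i p) := by
    have h1 := hli.notMem_span_image (s := range Fin.castSucc) (x := Fin.last r)
      (by rintro ⟨i, hi⟩; exact (Fin.castSucc_lt_last i).ne hi)
    rw [← range_comp] at h1
    exact h1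
  obtain ⟨ξ, hξ, hξ'⟩ := Submodule.exists_le_ker_of_notMem hlast
  obtain ⟨y, N', hN', hpN', hN'N, hy, hyc, hyp⟩ := exists_first_integral
    (X := fun i : Fin r => iterBracket b₁ b₂ i) A.isOpen
    (fun i => A.contDiffOn_iterBracket i) hp
    (hli.comp Fin.castSucc (Fin.castSucc_injective r))
    (fun q hq i j => by
      obtain ⟨m, rfl⟩ : ∃ m, r = m + 1 := ⟨r - 1, by have := i.2; omega⟩
      exact A.lieBracket_iterBracket_mem H m (by omega) hq i j)
    (LinearMap.toContinuousLinearMap ξ) (fun i => hξ' (Submodule.subset_span ⟨i, rfl⟩))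
  have hcont : ContinuousOn (fun q => fderiv ℝ y q (iterBracket b₁ b₂ r q)) N' :=
    (ContDiffOn.fderiv_apply_of_isOpen hN' hy
      ((A.contDiffOn_iterBracket r).mono hN'N)).continuousOn
  refine ⟨y, N' ∩ (fun q => fderiv ℝ y q (iterBracket b₁ b₂ r q)) ⁻¹' {0}ᶜ,
    hcont.isOpen_inter_preimage hN' isOpen_compl_singleton, ⟨hpN', ?_⟩,
    inter_subset_left.trans hN'N, hy.mono inter_subset_left,
    fun q hq i hi => hyc q hq.1 ⟨i, hi⟩, fun q hq => hq.2⟩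
  change fderiv ℝ y p _ ≠ 0
  rw [hyp]
  exact hξ

end IsAdaptedFrame

end AdaptedFrame

/-! ### Derivatives of the flat output -/

section FlatOutput

variable {E : Type} [NormedAddCommGroup E] [NormedSpace ℝ E]
variable {U W : Set E} {Δ : Submodule (smoothFunctions U) (E → E)}

/-- A function `y` that is constant along `c_0, …, c_{r-1}` but not along `c_r`. Together with `h`
it is a flat output of the driftless system `ẋ = b₁ v₁ + b₂ v₂`: its derivatives along `b₁` and `h`
are coordinates. -/
structure IsFlatOutput (N : Set E) (b₁ b₂ : E → E) (y : E → ℝ) (r : ℕ) : Prop where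
  contDiffOn : ContDiffOn ℝ ∞ y N
  fderiv_eq_zero : ∀ q ∈ N, ∀ i < r, fderiv ℝ y q (iterBracket b₁ b₂ i q) = 0
  fderiv_ne_zero : ∀ q ∈ N, fderiv ℝ y q (iterBracket b₁ b₂ r q) ≠ 0

namespace IsFlatOutput

variable {N : Set E} {h y : E → ℝ} {b₁ b₂ : E → E} {r : ℕ} (Y : IsFlatOutput N b₁ b₂ y r)
  (A : IsAdaptedFrame W N Δ h b₁ b₂) {q : E} {k i : ℕ}
include Y A

theorem fderiv_iterDeriv_iterBracket_eq_zero (hik : i + k < r) :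
    ∀ q ∈ N, fderiv ℝ (iterDeriv b₁ y i) q (iterBracket b₁ b₂ k q) = 0 := by
  induction i generalizing k with
  | zero => exact fun q hq => Y.fderiv_eq_zero q hq k (by omega)
  | succ i ih =>
    intro q hq
    have h1 := fderiv_lieBracket_of_const A.isOpen (A.contDiffOn_iterDeriv Y.contDiffOn i)
      A.contDiffOn_b₁ (A.contDiffOn_iterBracket k) (ih (k := k) (by omega)) hq
    have h2 := ih (k := k + 1) (by omega) q hq
    exact neg_eq_zero.1 (h1.symm.trans h2)

theorem fderiv_iterDeriv_iterBracket_ne_zero (hik : i + k = r) :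
    ∀ q ∈ N, fderiv ℝ (iterDeriv b₁ y i) q (iterBracket b₁ b₂ k q) ≠ 0 := by
  induction i generalizing k with
  | zero =>
    obtain rfl : k = r := by omega
    exact Y.fderiv_ne_zero
  | succ i ih =>
    intro q hq h0
    have h1 := fderiv_lieBracket_of_const A.isOpen (A.contDiffOn_iterDeriv Y.contDiffOn i)
      A.contDiffOn_b₁ (A.contDiffOn_iterBracket k)
      (Y.fderiv_iterDeriv_iterBracket_eq_zero A (i := i) (k := k) (by omega)) hq
    exact ih (k := k + 1) (by omega) q hq (h1.trans (neg_eq_zero.2 h0))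

variable [FiniteDimensional ℝ E] (H : IsRegularFlag W Δ) (hr : finrank ℝ E = r + 2)
include H hr

/-- The contact forms `dz_i - z_{i+1} dh` with `i < r - k` annihilate `G_k`. -/
theorem contactForm_eq_zero (hik : i + k < r) (hq : q ∈ N) {v : E}
    (hv : v ∈ fiber (derivedFlag Δ k) q) :
    contactForm (iterDeriv b₁ y i) (iterDeriv b₁ y (i + 1)) h q v = 0 := by
  have hle : fiber (derivedFlag Δ k) q ≤ LinearMap.ker
      (contactForm (iterDeriv b₁ y i) (iterDeriv b₁ y (i + 1)) h q : E →ₗ[ℝ] ℝ) := by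
    refine (A.fiber_derivedFlag_le H k (by omega) hq).trans (sup_le ?_ ?_)
    · rw [Submodule.span_singleton_le_iff_mem]
      change contactForm _ _ _ _ _ = 0
      rw [contactForm_apply, A.fderiv_b₁ q hq, mul_one]
      exact sub_self _
    · rw [Submodule.span_le]
      rintro _ ⟨j, rfl⟩
      change contactForm _ _ _ _ _ = 0
      rw [contactForm_apply, A.fderiv_iterBracket j q hq,
        Y.fderiv_iterDeriv_iterBracket_eq_zero A (by omega) q hq, mul_zero, sub_zero]
  exact hle hv

theorem mem_fiber_of_succ (hik : i + k + 1 = r) (hq : q ∈ N) {v : E}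
    (hv : v ∈ fiber (derivedFlag Δ (k + 1)) q) (hh : fderiv ℝ h q v = 0)
    (hz : fderiv ℝ (iterDeriv b₁ y i) q v = 0) : v ∈ fiber (derivedFlag Δ k) q := by
  obtain ⟨a, ha, s, rfl⟩ := A.exists_add_smul_iterBracket H (by omega) hq v hv
  have h1 := Y.contactForm_eq_zero A H hr (i := i) (by omega) hq ha
  have h2 : contactForm (iterDeriv b₁ y i) (iterDeriv b₁ y (i + 1)) h q
      (a + s • iterBracket b₁ b₂ (k + 1) q) = 0 := by
    rw [contactForm_apply, hh, hz, mul_zero, sub_zero]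
  rw [map_add, h1, zero_add, contactForm_apply, map_smul, map_smul,
    A.fderiv_iterBracket (k + 1) q hq, smul_zero, mul_zero, sub_zero, smul_eq_mul] at h2
  rw [(mul_eq_zero.1 h2).resolve_right
    (Y.fderiv_iterDeriv_iterBracket_ne_zero A (by omega) q hq), zero_smul, add_zero]
  exact ha

/-- A vector of `ker dh` annihilated by `dz_0, …, dz_{j-1}` lies in `G_{r-j}`. -/
theorem mem_fiber_of_forall {j m : ℕ} (hjm : j + m = r) (hq : q ∈ N) {v : E}
    (hh : fderiv ℝ h q v = 0) (hz : ∀ i < j, fderiv ℝ (iterDeriv b₁ y i) q v = 0) :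
    v ∈ fiber (derivedFlag Δ m) q := by
  induction j generalizing m with
  | zero =>
    have htop : fiber (derivedFlag Δ m) q = ⊤ := by
      refine Submodule.eq_top_of_finrank_eq ?_
      rw [H.finrank_derivedFlag m (by omega) q (A.subset hq)]
      omega
    rw [htop]
    trivial
  | succ j ih =>
    exact Y.mem_fiber_of_succ A H hr (i := j) (by omega) hq
      (ih (m := m + 1) (by omega) fun i hi => hz i (by omega)) hh (hz j (by omega))

theorem eq_zero_of_forall (hq : q ∈ N) {v : E} (hh : fderiv ℝ h q v = 0)
    (hz : ∀ i ≤ r, fderiv ℝ (iterDeriv b₁ y i) q v = 0) : v = 0 := by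
  have h1 := Y.mem_fiber_of_forall A H hr (j := r) (m := 0) (by omega) hq hh
    fun i hi => hz i hi.le
  obtain ⟨s, t, rfl⟩ := A.exists_eq q hq v h1
  rw [map_add, map_smul, map_smul, A.fderiv_b₁ q hq, A.fderiv_b₂ q hq] at hh
  have hs : s = 0 := by simpa using hh
  have h2 := hz r le_rfl
  rw [hs, zero_smul, zero_add, map_smul, smul_eq_mul] at h2
  have ht : t = 0 := (mul_eq_zero.1 h2).resolve_right
    (Y.fderiv_iterDeriv_iterBracket_ne_zero A (i := r) (k := 0) (by omega) q hq)
  rw [hs, ht]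
  simp

/-- The condition that `L_f` maps the annihilators of the derived flag into the retracting spaces
says that the drift components `(dz_i - z_{i+1} dh)(f)` are constant in the directions of
`z_{i+2}, …, z_r`. -/
theorem fderiv_contactForm_apply_eq_zero {f : E → E} (hf : ContDiffOn ℝ ∞ f U)
    (hcond : ∀ k, 1 ≤ k → k + 3 ≤ finrank ℝ E → ∀ q ∈ W,
      ∀ θ ∈ annihilator (derivedFlag Δ k),
        lieDerivOneForm f θ q ∈ retractingSpace (annihilator (derivedFlag Δ k)) q)
    (hi : i < r) (hq : q ∈ N) {v : E} (hh : fderiv ℝ h q v = 0)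
    (hz : ∀ l ≤ i + 1, fderiv ℝ (iterDeriv b₁ y l) q v = 0) :
    fderiv ℝ (fun x => contactForm (iterDeriv b₁ y i) (iterDeriv b₁ y (i + 1)) h x (f x)) q v
      = 0 := by
  -- for `i = r - 1` the hypotheses cover all coordinates
  rcases Nat.lt_or_ge r (i + 2) with hlt | hge
  · rw [Y.eq_zero_of_forall A H hr hq hh fun l hl => hz l (by omega), map_zero]
  obtain ⟨m, hm⟩ : ∃ m, i + 2 + m = r := ⟨r - (i + 2), by omega⟩
  have hvc := A.mem_charSpace H (by omega) hq
    (Y.mem_fiber_of_forall A H hr hm hq hh fun l hl => hz l (by omega)) hh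
  set θ := contactForm (iterDeriv b₁ y i) (iterDeriv b₁ y (i + 1)) h with hθ
  have hzs := fun j => A.contDiffOn_iterDeriv Y.contDiffOn j
  have hθs : ContDiffOn ℝ ∞ θ N := contDiffOn_contactForm A.isOpen (hzs i) (hzs (i + 1))
    A.contDiffOn_h
  have hNq := A.isOpen.mem_nhds hq
  obtain ⟨η, hη, hηθ⟩ := exists_mem_annihilator_eventuallyEq (Δ := derivedFlag Δ (m + 1)) A.isOpen
    hq hθs fun x hx v hv => Y.contactForm_eq_zero A H hr (by omega) hx hv
  have h1 : lieDerivOneForm f η q v = 0 :=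
    hcond (m + 1) (by omega) (by omega) q (A.subset hq) η hη v hvc
  have h2 : lieDerivOneForm f η q = lieDerivOneForm f θ q := by
    rw [lieDerivOneForm, lieDerivOneForm, hηθ.fderiv_eq, hηθ.self_of_nhds]
  have hθd : DifferentiableAt ℝ θ q := (hθs.contDiffAt hNq).differentiableAt (by simp)
  rw [h2, lieDerivOneForm_apply hθd ((hf.contDiffAt
    (H.isOpen_domain.mem_nhds (H.subset (A.subset hq)))).differentiableAt (by simp)),
    extDerivOneForm_apply hθd, ← curl_apply, hθ, curl_contactForm ((hzs i).contDiffAt hNq)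
      ((hzs (i + 1)).contDiffAt hNq) (A.contDiffOn_h.contDiffAt hNq), hh, hz (i + 1) le_rfl] at h1
  simpa using h1

end IsFlatOutput

end FlatOutput

/-! ### Existence of adapted frames -/

section Feedback

variable {E : Type} [NormedAddCommGroup E] [NormedSpace ℝ E]

/-- A field in the span of `g₁`, `g₂` along which `h` has derivative `1`, wherever `h` is not
constant along both of them (elsewhere it is `0` because of the convention `0⁻¹ = 0`). -/
noncomputable def normalizedField (h : E → ℝ) (g₁ g₂ : E → E) (q : E) : E :=
  ((fderiv ℝ h q (g₁ q)) ^ 2 + (fderiv ℝ h q (g₂ q)) ^ 2)⁻¹ •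
    (fderiv ℝ h q (g₁ q) • g₁ q + fderiv ℝ h q (g₂ q) • g₂ q)

/-- A field in the span of `g₁`, `g₂` along which `h` is constant. -/
noncomputable def tangentField (h : E → ℝ) (g₁ g₂ : E → E) (q : E) : E :=
  fderiv ℝ h q (g₁ q) • g₂ q - fderiv ℝ h q (g₂ q) • g₁ q

theorem left_mem_distributionSpan (U : Set E) (g₁ g₂ : E → E) : g₁ ∈ distributionSpan U g₁ g₂ :=
  Submodule.subset_span (by simp)

theorem right_mem_distributionSpan (U : Set E) (g₁ g₂ : E → E) : g₂ ∈ distributionSpan U g₁ g₂ :=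
  Submodule.subset_span (by simp)

theorem exists_eq_of_mem_fiber_distributionSpan {U : Set E} {g₁ g₂ : E → E} {q v : E}
    (hv : v ∈ fiber (distributionSpan U g₁ g₂) q) : ∃ a b : ℝ, v = a • g₁ q + b • g₂ q := by
  obtain ⟨X, hX, rfl⟩ := hv
  have h1 : X q ∈ Submodule.span ℝ {g₁ q, g₂ q} := by
    refine apply_mem_of_mem_span (s := {g₁, g₂}) ?_ hX
    rintro _ (rfl | rfl)
    · exact Submodule.subset_span (by simp)
    · exact Submodule.subset_span (by simp)
  obtain ⟨a, b, h2⟩ := Submodule.mem_span_pair.1 h1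
  exact ⟨a, b, h2.symm⟩

theorem distributionSpan_le_smoothMaps {U : Set E} {g₁ g₂ : E → E} (hg₁ : ContDiffOn ℝ ∞ g₁ U)
    (hg₂ : ContDiffOn ℝ ∞ g₂ U) : distributionSpan U g₁ g₂ ≤ smoothMaps U E := by
  refine Submodule.span_le.2 ?_
  rintro _ (rfl | rfl)
  · exact hg₁
  · exact hg₂

/-- A regular distribution has near each point an adapted frame, obtained by normalizing `g₁`, `g₂`
against a common first integral of the Cauchy characteristics. -/
theorem exists_adaptedFrame [FiniteDimensional ℝ E] {U W : Set E} {g₁ g₂ : E → E}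
    (hg₁ : ContDiffOn ℝ ∞ g₁ U) (hg₂ : ContDiffOn ℝ ∞ g₂ U)
    (H : IsRegularFlag W (distributionSpan U g₁ g₂)) (hn : 2 ≤ finrank ℝ E) {p : E} (hp : p ∈ W) :
    ∃ (h : E → ℝ) (N : Set E), p ∈ N ∧ IsAdaptedFrame W N (distributionSpan U g₁ g₂) h
      (normalizedField h g₁ g₂) (tangentField h g₁ g₂) := by
  obtain ⟨h, N₀, hN₀, hpN₀, hN₀W, hh, ⟨w, hw, hhw⟩, hchar⟩ :=
    H.exists_characteristic_integral hp hn
  have hg₁' : ContDiffOn ℝ ∞ g₁ N₀ := hg₁.mono (hN₀W.trans H.subset)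
  have hg₂' : ContDiffOn ℝ ∞ g₂ N₀ := hg₂.mono (hN₀W.trans H.subset)
  let s₁ : E → ℝ := fun q => fderiv ℝ h q (g₁ q)
  let s₂ : E → ℝ := fun q => fderiv ℝ h q (g₂ q)
  have hs₁ : ContDiffOn ℝ ∞ s₁ N₀ := ContDiffOn.fderiv_apply_of_isOpen hN₀ hh hg₁'
  have hs₂ : ContDiffOn ℝ ∞ s₂ N₀ := ContDiffOn.fderiv_apply_of_isOpen hN₀ hh hg₂'
  let D : E → ℝ := fun q => s₁ q ^ 2 + s₂ q ^ 2
  have hD : ContDiffOn ℝ ∞ D N₀ := (hs₁.pow 2).add (hs₂.pow 2)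
  have hN : IsOpen (N₀ ∩ D ⁻¹' {0}ᶜ) :=
    hD.continuousOn.isOpen_inter_preimage hN₀ isOpen_compl_singleton
  refine ⟨h, N₀ ∩ D ⁻¹' {0}ᶜ, ⟨hpN₀, ?_⟩, hN, inter_subset_left.trans hN₀W,
    hh.mono inter_subset_left, ?_, ?_, ?_, ?_, ?_, ?_, ?_, fun q hq => hchar q hq.1⟩
  · obtain ⟨a, b, rfl⟩ := exists_eq_of_mem_fiber_distributionSpan hw
    intro hD0
    have h1 : s₁ p ^ 2 + s₂ p ^ 2 = 0 := hD0
    have h2 : s₁ p = 0 := by nlinarith [sq_nonneg (s₁ p), sq_nonneg (s₂ p)]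
    have h3 : s₂ p = 0 := by nlinarith [sq_nonneg (s₁ p), sq_nonneg (s₂ p)]
    refine hhw ?_
    rw [map_add, map_smul, map_smul, show fderiv ℝ h p (g₁ p) = 0 from h2,
      show fderiv ℝ h p (g₂ p) = 0 from h3]
    simp
  · exact ((hD.mono inter_subset_left).inv fun q hq => hq.2).smul
      (((hs₁.smul hg₁').add (hs₂.smul hg₂')).mono inter_subset_left)
  · exact ((hs₁.smul hg₂').sub (hs₂.smul hg₁')).mono inter_subset_left
  · exact fun q _ => Submodule.smul_mem _ _ (add_mem
      (Submodule.smul_mem _ _ (mem_fiber (left_mem_distributionSpan U g₁ g₂) q))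
      (Submodule.smul_mem _ _ (mem_fiber (right_mem_distributionSpan U g₁ g₂) q)))
  · exact fun q _ => sub_mem
      (Submodule.smul_mem _ _ (mem_fiber (right_mem_distributionSpan U g₁ g₂) q))
      (Submodule.smul_mem _ _ (mem_fiber (left_mem_distributionSpan U g₁ g₂) q))
  · intro q hq
    have h1 : s₁ q ^ 2 + s₂ q ^ 2 ≠ 0 := hq.2
    rw [normalizedField, map_smul, map_add, map_smul, map_smul]
    change (s₁ q ^ 2 + s₂ q ^ 2)⁻¹ * (s₁ q * s₁ q + s₂ q * s₂ q) = 1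
    field_simp
  · intro q hq
    rw [tangentField, map_sub, map_smul, map_smul, smul_eq_mul, smul_eq_mul]
    ring
  · intro q hq v hv
    obtain ⟨a, b, rfl⟩ := exists_eq_of_mem_fiber_distributionSpan hv
    have h1 : s₁ q ^ 2 + s₂ q ^ 2 ≠ 0 := hq.2
    refine ⟨a * s₁ q + b * s₂ q, (b * s₁ q - a * s₂ q) / (s₁ q ^ 2 + s₂ q ^ 2), ?_⟩
    change _ = (a * s₁ q + b * s₂ q) • (s₁ q ^ 2 + s₂ q ^ 2)⁻¹ • (s₁ q • g₁ q + s₂ q • g₂ q) +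
      ((b * s₁ q - a * s₂ q) / (s₁ q ^ 2 + s₂ q ^ 2)) • (s₁ q • g₂ q - s₂ q • g₁ q)
    match_scalars
    · field_simp
      ring
    · field_simp
      ring

end Feedback

/-! ### Construction of the triangular form -/

section Sufficiency

theorem Convex.eq_of_fderiv_apply_eq_zero {E : Type*} [NormedAddCommGroup E] [NormedSpace ℝ E]
    {O : Set E} (hO : IsOpen O) (hconv : Convex ℝ O) {G : E → ℝ} (hG : ContDiffOn ℝ ∞ G O)
    {z w : E} (hz : z ∈ O) (hw : w ∈ O) (h : ∀ x ∈ O, fderiv ℝ G x (w - z) = 0) : G z = G w := by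
  obtain ⟨x, hx, he⟩ := domain_mvt (f := G) (f' := fun x => fderiv ℝ G x)
    (fun x hx => ((hG.contDiffAt (hO.mem_nhds hx)).differentiableAt
      (by simp)).hasFDerivAt.hasFDerivWithinAt) hconv hz hw
  rw [h x (hconv.segment_subset hz hw hx)] at he
  linarith

variable {n : ℕ} {U W : Set (Fin n → ℝ)}
  {Δ : Submodule (smoothFunctions U) ((Fin n → ℝ) → Fin n → ℝ)}

/-- The components of `(z_0, …, z_r, h)`: the derivatives of `y` along `b₁`, and `h` in the last
place. -/
noncomputable def chainedCoord (b₁ : (Fin n → ℝ) → Fin n → ℝ) (y h : (Fin n → ℝ) → ℝ) (i : Fin n) :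
    (Fin n → ℝ) → ℝ :=
  if i.val + 1 < n then iterDeriv b₁ y i else h

/-- The map with components `(z_0, …, z_r, h)`. -/
noncomputable def chainedMap (b₁ : (Fin n → ℝ) → Fin n → ℝ) (y h : (Fin n → ℝ) → ℝ)
    (q : Fin n → ℝ) : Fin n → ℝ := fun i => chainedCoord b₁ y h i q

variable {N : Set (Fin n → ℝ)} {h y : (Fin n → ℝ) → ℝ} {b₁ b₂ : (Fin n → ℝ) → Fin n → ℝ} {r : ℕ}

theorem contDiffOn_chainedCoord (A : IsAdaptedFrame W N Δ h b₁ b₂) (hy : ContDiffOn ℝ ∞ y N)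
    (i : Fin n) : ContDiffOn ℝ ∞ (chainedCoord b₁ y h i) N := by
  unfold chainedCoord
  split_ifs
  · exact A.contDiffOn_iterDeriv hy i
  · exact A.contDiffOn_h

theorem contDiffOn_chainedMap (A : IsAdaptedFrame W N Δ h b₁ b₂) (hy : ContDiffOn ℝ ∞ y N) :
    ContDiffOn ℝ ∞ (chainedMap b₁ y h) N :=
  contDiffOn_pi.2 fun i => contDiffOn_chainedCoord A hy i

theorem fderiv_chainedMap (A : IsAdaptedFrame W N Δ h b₁ b₂) (hy : ContDiffOn ℝ ∞ y N)
    {q : Fin n → ℝ} (hq : q ∈ N) (v : Fin n → ℝ) (i : Fin n) :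
    fderiv ℝ (chainedMap b₁ y h) q v i = fderiv ℝ (chainedCoord b₁ y h i) q v := by
  have h1 : HasFDerivAt (chainedMap b₁ y h)
      (ContinuousLinearMap.pi fun i => fderiv ℝ (chainedCoord b₁ y h i) q) q :=
    hasFDerivAt_pi.2 fun i => (((contDiffOn_chainedCoord A hy i).contDiffAt
      (A.isOpen.mem_nhds hq)).differentiableAt (by simp)).hasFDerivAt
  rw [h1.fderiv]
  rfl

theorem fderiv_iterDeriv_of_lt (A : IsAdaptedFrame W N Δ h b₁ b₂) (hy : ContDiffOn ℝ ∞ y N)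
    {q : Fin n → ℝ} (hq : q ∈ N) (v : Fin n → ℝ) {i : ℕ} (hi : i + 1 < n) :
    fderiv ℝ (iterDeriv b₁ y i) q v = fderiv ℝ (chainedMap b₁ y h) q v ⟨i, by omega⟩ := by
  rw [fderiv_chainedMap A hy hq, chainedCoord, if_pos hi]

theorem fderiv_h_eq (A : IsAdaptedFrame W N Δ h b₁ b₂) (hy : ContDiffOn ℝ ∞ y N)
    {q : Fin n → ℝ} (hq : q ∈ N) (v : Fin n → ℝ) {j : Fin n} (hj : j.val + 1 = n) :
    fderiv ℝ h q v = fderiv ℝ (chainedMap b₁ y h) q v j := by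
  rw [fderiv_chainedMap A hy hq, chainedCoord, if_neg (by omega)]

/-- Near every point of `N` the map `(z_0, …, z_r, h)` is a diffeomorphism onto a ball. -/
theorem exists_chained_chart (A : IsAdaptedFrame W N Δ h b₁ b₂) (H : IsRegularFlag W Δ)
    (Y : IsFlatOutput N b₁ b₂ y r) (hr : n = r + 2) {p : Fin n → ℝ} (hp : p ∈ N) :
    ∃ ψ : OpenPartialHomeomorph (Fin n → ℝ) (Fin n → ℝ), p ∈ ψ.source ∧ ψ.source ⊆ N ∧
      (∀ x, ψ x = chainedMap b₁ y h x) ∧ ContDiffOn ℝ ∞ ψ.symm ψ.target ∧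
      Convex ℝ ψ.target := by
  have hfr : finrank ℝ (Fin n → ℝ) = r + 2 := by rw [finrank_fin_fun, hr]
  have hy := Y.contDiffOn
  have hinj : Function.Injective
      (fderiv ℝ (chainedMap b₁ y h) p : (Fin n → ℝ) →ₗ[ℝ] (Fin n → ℝ)) := by
    rw [← LinearMap.ker_eq_bot, LinearMap.ker_eq_bot']
    intro v hv
    have hv' : fderiv ℝ (chainedMap b₁ y h) p v = 0 := hv
    refine Y.eq_zero_of_forall A H hfr hp ?_ fun i hi => ?_
    · rw [fderiv_h_eq A hy hp v (j := ⟨r + 1, by omega⟩) (by simp; omega), hv']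
      rfl
    · rw [fderiv_iterDeriv_of_lt A hy hp v (by omega), hv']
      rfl
  let L := (LinearEquiv.ofInjectiveEndo _ hinj).toContinuousLinearEquiv
  have hL : HasFDerivAt (chainedMap b₁ y h) (L : (Fin n → ℝ) →L[ℝ] (Fin n → ℝ)) p := by
    have h1 := (((contDiffOn_chainedMap A hy).contDiffAt
      (A.isOpen.mem_nhds hp)).differentiableAt (by simp)).hasFDerivAt
    refine h1.congr_fderiv ?_
    ext1 v
    rfl
  obtain ⟨e, hpe, heN, he, hsymm⟩ := exists_smooth_openPartialHomeomorph A.isOpen hp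
    (contDiffOn_chainedMap A hy) L hL
  obtain ⟨ρ, hρ, hball⟩ := Metric.isOpen_iff.1 e.open_target (e p) (e.map_source hpe)
  refine ⟨(e.symm.restrOpen (Metric.ball (e p) ρ) Metric.isOpen_ball).symm, ?_, ?_, he, ?_, ?_⟩
  · have h1 : e p ∈ (e.symm.restrOpen (Metric.ball (e p) ρ) Metric.isOpen_ball).source :=
      ⟨e.map_source hpe, Metric.mem_ball_self hρ⟩
    have h2 := (e.symm.restrOpen (Metric.ball (e p) ρ) Metric.isOpen_ball).map_source h1
    have h3 : (e.symm.restrOpen (Metric.ball (e p) ρ) Metric.isOpen_ball) (e p) = p :=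
      e.left_inv hpe
    rw [h3] at h2
    exact h2
  · intro x hx
    have h1 := (e.symm.restrOpen (Metric.ball (e p) ρ) Metric.isOpen_ball).map_target hx
    have h2 : e.symm ((e.symm.restrOpen (Metric.ball (e p) ρ) Metric.isOpen_ball).symm x) = x :=
      (e.symm.restrOpen (Metric.ball (e p) ρ) Metric.isOpen_ball).right_inv hx
    rw [← h2]
    exact heN (e.map_target h1.1)
  · exact hsymm.mono fun z hz => hz.1
  · have h1 : (e.symm.restrOpen (Metric.ball (e p) ρ) Metric.isOpen_ball).source =
      Metric.ball (e p) ρ := inter_eq_right.2 hball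
    change Convex ℝ (e.symm.restrOpen (Metric.ball (e p) ρ) Metric.isOpen_ball).source
    rw [h1]
    exact convex_ball _ _

/-- The drift terms `⟨dz_i - z_{i+1} dh, f⟩` are triangular. Convexity of the target turns vanishing
derivatives into independence of the corresponding coordinates. -/
theorem isTriangularDrift_chained (A : IsAdaptedFrame W N Δ h b₁ b₂) (H : IsRegularFlag W Δ)
    (Y : IsFlatOutput N b₁ b₂ y r) (hr : n = r + 2) {f : (Fin n → ℝ) → Fin n → ℝ}
    (hf : ContDiffOn ℝ ∞ f U)
    (hcond : ∀ k, 1 ≤ k → k + 3 ≤ n → ∀ q ∈ W,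
      ∀ θ ∈ annihilator (derivedFlag Δ k),
        lieDerivOneForm f θ q ∈ retractingSpace (annihilator (derivedFlag Δ k)) q)
    (ψ : OpenPartialHomeomorph (Fin n → ℝ) (Fin n → ℝ)) (hψN : ψ.source ⊆ N)
    (hψ : ∀ x, ψ x = chainedMap b₁ y h x) (hsymm : ContDiffOn ℝ ∞ ψ.symm ψ.target)
    (hconv : Convex ℝ ψ.target) :
    IsTriangularDrift ψ.target fun i z =>
      contactForm (iterDeriv b₁ y i) (iterDeriv b₁ y (i + 1)) h (ψ.symm z) (f (ψ.symm z)) := by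
  have hfr : finrank ℝ (Fin n → ℝ) = r + 2 := by rw [finrank_fin_fun, hr]
  have hy := Y.contDiffOn
  intro i hi
  have hF : ContDiffOn ℝ ∞ (fun x =>
      contactForm (iterDeriv b₁ y i) (iterDeriv b₁ y (i + 1)) h x (f x)) N :=
    (contDiffOn_contactForm A.isOpen (A.contDiffOn_iterDeriv hy i)
      (A.contDiffOn_iterDeriv hy (i + 1)) A.contDiffOn_h).clm_apply
      (hf.mono (A.subset.trans H.subset))
  have hG := hF.comp hsymm fun z hz => hψN (ψ.map_target hz)
  refine ⟨hG, fun z hz w hw hzw => ?_⟩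
  refine Convex.eq_of_fderiv_apply_eq_zero ψ.open_target hconv hG hz hw fun x hx => ?_
  have hq : ψ.symm x ∈ N := hψN (ψ.map_target hx)
  have hsd : DifferentiableAt ℝ ψ.symm x :=
    (hsymm.contDiffAt (ψ.open_target.mem_nhds hx)).differentiableAt (by simp)
  have hFd : DifferentiableAt ℝ (fun x =>
      contactForm (iterDeriv b₁ y i) (iterDeriv b₁ y (i + 1)) h x (f x)) (ψ.symm x) :=
    (hF.contDiffAt (A.isOpen.mem_nhds hq)).differentiableAt (by simp)
  have hmd : DifferentiableAt ℝ (chainedMap b₁ y h) (ψ.symm x) :=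
    ((contDiffOn_chainedMap A hy).contDiffAt (A.isOpen.mem_nhds hq)).differentiableAt (by simp)
  rw [fderiv_comp x hFd hsd, ContinuousLinearMap.comp_apply]
  -- the differential of the chart maps `v` to `w - z`
  set v := fderiv ℝ ψ.symm x (w - z) with hv
  have hv' : fderiv ℝ (chainedMap b₁ y h) (ψ.symm x) v = w - z := by
    have h1 : (chainedMap b₁ y h) ∘ ψ.symm =ᶠ[𝓝 x] id := by
      filter_upwards [ψ.open_target.mem_nhds hx] with x' hx'
      rw [Function.comp_apply, ← hψ, ψ.right_inv hx', id]
    have h2 := h1.fderiv_eq (𝕜 := ℝ)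
    rw [fderiv_comp x hmd hsd, fderiv_id] at h2
    exact congrArg (fun L : (Fin n → ℝ) →L[ℝ] (Fin n → ℝ) => L (w - z)) h2
  refine Y.fderiv_contactForm_apply_eq_zero A H hfr hf (by rwa [finrank_fin_fun]) (by omega) hq
    ?_ fun l hl => ?_
  · rw [fderiv_h_eq A hy hq v (j := ⟨r + 1, by omega⟩) (by simp; omega), hv', Pi.sub_apply,
      hzw _ (Or.inr (by simp; omega)), sub_self]
  · rw [fderiv_iterDeriv_of_lt A hy hq v (by omega), hv', Pi.sub_apply, hzw _ (Or.inl hl),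
      sub_self]

/-- The conditions on the flags and on `L_f` give the triangular form near `p`. -/
theorem isLocallyTriangularizable_of_regular (hn : 2 ≤ n) {f g₁ g₂ : (Fin n → ℝ) → Fin n → ℝ}
    (hf : ContDiffOn ℝ ∞ f U) (hg₁ : ContDiffOn ℝ ∞ g₁ U) (hg₂ : ContDiffOn ℝ ∞ g₂ U)
    {p : Fin n → ℝ} (hp : p ∈ W) (H : IsRegularFlag W (distributionSpan U g₁ g₂))
    (hcond : ∀ k, 1 ≤ k → k + 3 ≤ n → ∀ q ∈ W,
      ∀ θ ∈ annihilator (derivedFlag (distributionSpan U g₁ g₂) k),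
        lieDerivOneForm f θ q ∈
          retractingSpace (annihilator (derivedFlag (distributionSpan U g₁ g₂) k)) q) :
    IsLocallyTriangularizable U f g₁ g₂ p := by
  obtain ⟨r, hr⟩ : ∃ r, n = r + 2 := ⟨n - 2, by omega⟩
  have hfr : finrank ℝ (Fin n → ℝ) = r + 2 := by rw [finrank_fin_fun, hr]
  obtain ⟨h, N₀, hpN₀, A₀⟩ := exists_adaptedFrame hg₁ hg₂ H (by omega) hp
  obtain ⟨y, N, hN, hpN, hNN₀, hy, hy1, hy2⟩ := A₀.exists_flat_output H hfr hpN₀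
  have A := A₀.mono hN hNN₀
  have Y : IsFlatOutput N (normalizedField h g₁ g₂) (tangentField h g₁ g₂) y r := ⟨hy, hy1, hy2⟩
  clear A₀ hNN₀ hy1 hy2
  set b₁ := normalizedField h g₁ g₂ with hb₁
  set b₂ := tangentField h g₁ g₂ with hb₂
  obtain ⟨ψ, hpψ, hψN, hψ, hsymm, hconv⟩ := exists_chained_chart A H Y hr hpN
  have hNU : N ⊆ U := A.subset.trans H.subset
  let s₁ : (Fin n → ℝ) → ℝ := fun q => fderiv ℝ h q (g₁ q)
  let s₂ : (Fin n → ℝ) → ℝ := fun q => fderiv ℝ h q (g₂ q)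
  let D : (Fin n → ℝ) → ℝ := fun q => s₁ q ^ 2 + s₂ q ^ 2
  let κ : (Fin n → ℝ) → ℝ := fun q => fderiv ℝ (iterDeriv b₁ y r) q (b₂ q)
  let a : (Fin n → ℝ) → ℝ := iterDeriv b₁ y (r + 1)
  let fh : (Fin n → ℝ) → ℝ := fun q => fderiv ℝ h q (f q)
  let fz : (Fin n → ℝ) → ℝ := fun q => fderiv ℝ (iterDeriv b₁ y r) q (f q)
  have hs₁ : ContDiffOn ℝ ∞ s₁ N :=
    ContDiffOn.fderiv_apply_of_isOpen hN A.contDiffOn_h (hg₁.mono hNU)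
  have hs₂ : ContDiffOn ℝ ∞ s₂ N :=
    ContDiffOn.fderiv_apply_of_isOpen hN A.contDiffOn_h (hg₂.mono hNU)
  have hD : ContDiffOn ℝ ∞ D N := (hs₁.pow 2).add (hs₂.pow 2)
  have hzr := A.contDiffOn_iterDeriv hy r
  have hκ : ContDiffOn ℝ ∞ κ N := ContDiffOn.fderiv_apply_of_isOpen hN hzr A.contDiffOn_b₂
  have ha : ContDiffOn ℝ ∞ a N := A.contDiffOn_iterDeriv hy (r + 1)
  have hfh : ContDiffOn ℝ ∞ fh N :=
    ContDiffOn.fderiv_apply_of_isOpen hN A.contDiffOn_h (hf.mono hNU)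
  have hfz : ContDiffOn ℝ ∞ fz N := ContDiffOn.fderiv_apply_of_isOpen hN hzr (hf.mono hNU)
  have hκ0 : ∀ q ∈ N, κ q ≠ 0 :=
    Y.fderiv_iterDeriv_iterBracket_ne_zero A (i := r) (k := 0) (by omega)
  have hD0 : ∀ q ∈ N, D q ≠ 0 := by
    intro q hq h0
    have h1 : (fderiv ℝ h q (g₁ q)) ^ 2 + (fderiv ℝ h q (g₂ q)) ^ 2 = 0 := h0
    have h2 := A.fderiv_b₁ q hq
    rw [hb₁, normalizedField, h1, inv_zero, zero_smul, map_zero] at h2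
    exact zero_ne_one h2
  -- with `u = α + β v`, the controls of `b₁` and `b₂` are `v₀ - fh` and
  -- `(v₁ - fz - a (v₀ - fh)) / κ`
  let α : (Fin n → ℝ) → Fin 2 → ℝ := fun q =>
    ![-fh q * (s₁ q / D q) - (a q * fh q - fz q) / κ q * s₂ q,
      -fh q * (s₂ q / D q) + (a q * fh q - fz q) / κ q * s₁ q]
  let β : (Fin n → ℝ) → Matrix (Fin 2) (Fin 2) ℝ := fun q =>
    !![s₁ q / D q + a q / κ q * s₂ q, -(s₂ q / κ q);
      s₂ q / D q - a q / κ q * s₁ q, s₁ q / κ q]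
  refine ⟨ψ, α, β, fun i z => contactForm (iterDeriv b₁ y i) (iterDeriv b₁ y (i + 1)) h
    (ψ.symm z) (f (ψ.symm z)), hpψ, hψN.trans hNU, ?_, hsymm, ?_, ?_, ?_,
    isTriangularDrift_chained A H Y hr hf hcond ψ hψN hψ hsymm hconv, ?_⟩
  · exact ((contDiffOn_chainedMap A hy).mono hψN).congr fun x _ => hψ x
  · refine (contDiffOn_pi.2 fun i => ?_ : ContDiffOn ℝ ∞ α N).mono hψN
    fin_cases i
    · exact (hfh.neg.mul (hs₁.div hD hD0)).sub
        ((((ha.mul hfh).sub hfz).div hκ hκ0).mul hs₂)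
    · exact (hfh.neg.mul (hs₂.div hD hD0)).add
        ((((ha.mul hfh).sub hfz).div hκ hκ0).mul hs₁)
  · intro i j
    refine ContDiffOn.mono (?_ : ContDiffOn ℝ ∞ (fun x => β x i j) N) hψN
    fin_cases i <;> fin_cases j
    · exact (hs₁.div hD hD0).add ((ha.div hκ hκ0).mul hs₂)
    · exact (hs₂.div hκ hκ0).neg
    · exact (hs₂.div hD hD0).sub ((ha.div hκ hκ0).mul hs₁)
    · exact hs₁.div hκ hκ0
  · intro x hx
    have hκx := hκ0 x (hψN hx)
    have hDx := hD0 x (hψN hx)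
    have hdet : (β x).det = 1 / κ x := by
      rw [Matrix.det_fin_two_of]
      have h1 : D x = s₁ x ^ 2 + s₂ x ^ 2 := rfl
      field_simp
      rw [h1]
      ring
    rw [Matrix.isUnit_iff_isUnit_det, hdet]
    exact (one_div_ne_zero hκx).isUnit
  · intro x hx v u hu
    have hxN := hψN hx
    have hκx := hκ0 x hxN
    have hDx := hD0 x hxN
    have hu0 : u 0 = -fh x * (s₁ x / D x) - (a x * fh x - fz x) / κ x * s₂ x +
        ((s₁ x / D x + a x / κ x * s₂ x) * v 0 + -(s₂ x / κ x) * v 1) := by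
      rw [hu]
      simp [α, β, dotProduct, Fin.sum_univ_two]
    have hu1 : u 1 = -fh x * (s₂ x / D x) + (a x * fh x - fz x) / κ x * s₁ x +
        ((s₂ x / D x - a x / κ x * s₁ x) * v 0 + s₁ x / κ x * v 1) := by
      rw [hu]
      simp [α, β, dotProduct, Fin.sum_univ_two]
    have hsum : u 0 • g₁ x + u 1 • g₂ x = (v 0 - fh x) • b₁ x +
        ((v 1 - fz x - a x * (v 0 - fh x)) / κ x) • b₂ x := by
      have h1 : b₁ x = (D x)⁻¹ • (s₁ x • g₁ x + s₂ x • g₂ x) := rfl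
      have h2 : b₂ x = s₁ x • g₂ x - s₂ x • g₁ x := rfl
      rw [h1, h2, hu0, hu1]
      match_scalars
      · field_simp
        ring
      · field_simp
        ring
    have hψ' : (ψ : (Fin n → ℝ) → Fin n → ℝ) = chainedMap b₁ y h := funext hψ
    rw [add_assoc, hsum, hψ']
    have hz : ∀ i ≤ r, fderiv ℝ (iterDeriv b₁ y i) x (f x + ((v 0 - fh x) • b₁ x +
        ((v 1 - fz x - a x * (v 0 - fh x)) / κ x) • b₂ x)) =
        fderiv ℝ (iterDeriv b₁ y i) x (f x) + (v 0 - fh x) * iterDeriv b₁ y (i + 1) x +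
        ((v 1 - fz x - a x * (v 0 - fh x)) / κ x) * fderiv ℝ (iterDeriv b₁ y i) x (b₂ x) := by
      intro i _
      rw [map_add, map_add, map_smul, map_smul, smul_eq_mul, smul_eq_mul, ← add_assoc]
      rfl
    ext i
    rw [fderiv_chainedMap A hy hxN]
    unfold triangularField
    split_ifs with h1 h2
    · have hzero : fderiv ℝ (iterDeriv b₁ y i) x (b₂ x) = 0 :=
        Y.fderiv_iterDeriv_iterBracket_eq_zero A (k := 0) (by omega) x hxN
      have hsx : ψ.symm (chainedMap b₁ y h x) = x := by rw [← hψ, ψ.left_inv hx]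
      have hcoord : chainedMap b₁ y h x ⟨i.val + 1, by omega⟩ = iterDeriv b₁ y (i + 1) x := by
        rw [chainedMap, chainedCoord, if_pos (by simp; omega)]
      beta_reduce
      rw [chainedCoord, if_pos (by omega), hz i (by omega), hzero, hsx, hcoord, contactForm_apply]
      change _ = _ - _ * fh x + _
      ring
    · have hir : i.val = r := by omega
      rw [chainedCoord, if_pos (by omega), hir, hz r le_rfl]
      change fz x + (v 0 - fh x) * a x + (v 1 - fz x - a x * (v 0 - fh x)) / κ x * κ x = v 1
      rw [div_mul_cancel₀ _ hκx]
      ring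
    · rw [chainedCoord, if_neg (by omega), map_add, map_add, map_smul, map_smul,
        A.fderiv_b₁ x hxN, A.fderiv_b₂ x hxN]
      change fh x + ((v 0 - fh x) * 1 + _ * 0) = v 0
      ring

end Sufficiency

/-! ### Systems in triangular form -/

section Necessity

variable {n : ℕ}

/-- The `i`-th coordinate function of a chart, with the value `0` for `i` out of range. -/
noncomputable def coord (ψ : OpenPartialHomeomorph (Fin n → ℝ) (Fin n → ℝ)) (i : ℕ)
    (x : Fin n → ℝ) : ℝ :=
  if h : i < n then ψ x ⟨i, h⟩ else 0

/-- The contact form `dz_i - z_{i+1} dz_{n-1}` of a chart. -/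
noncomputable def chartForm (ψ : OpenPartialHomeomorph (Fin n → ℝ) (Fin n → ℝ)) (i : ℕ) :
    (Fin n → ℝ) → (Fin n → ℝ) →L[ℝ] ℝ :=
  contactForm (coord ψ i) (coord ψ (i + 1)) (coord ψ (n - 1))

/-- The common kernel at `q` of the contact forms `dz_i - z_{i+1} dz_{n-1}` with
`i ≤ n - 3 - k`. -/
noncomputable def contactKer (ψ : OpenPartialHomeomorph (Fin n → ℝ) (Fin n → ℝ)) (k : ℕ)
    (q : Fin n → ℝ) : Submodule ℝ (Fin n → ℝ) :=
  ⨅ (i : ℕ) (_ : i + k + 3 ≤ n), LinearMap.ker (chartForm ψ i q : (Fin n → ℝ) →ₗ[ℝ] ℝ)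

/-- The field with constant components `c` in the coordinates given by `ψ`. -/
noncomputable def coordField (ψ : OpenPartialHomeomorph (Fin n → ℝ) (Fin n → ℝ)) (c : Fin n → ℝ)
    (x : Fin n → ℝ) : Fin n → ℝ :=
  fderiv ℝ ψ.symm (ψ x) c

variable {U : Set (Fin n → ℝ)} {Δ : Submodule (smoothFunctions U) ((Fin n → ℝ) → Fin n → ℝ)}
  {ψ : OpenPartialHomeomorph (Fin n → ℝ) (Fin n → ℝ)} {b₁ b₂ : (Fin n → ℝ) → Fin n → ℝ}

theorem mem_contactKer {k : ℕ} {q v : Fin n → ℝ} :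
    v ∈ contactKer ψ k q ↔ ∀ i, i + k + 3 ≤ n → chartForm ψ i q v = 0 := by
  simp [contactKer]

/-- In the coordinates `z` given by `ψ`, the distribution `Δ` has the chained form: it is spanned
at each point of the chart by `b₂ = ∂_{n-2}` and a vector `b₁` that equals
`∑ z_{i+1} ∂_i + ∂_{n-1}`, with the sum over `i ≤ n - 3`, up to a multiple of `∂_{n-2}`. -/
structure IsChainedFrame (Δ : Submodule (smoothFunctions U) ((Fin n → ℝ) → Fin n → ℝ))
    (ψ : OpenPartialHomeomorph (Fin n → ℝ) (Fin n → ℝ)) (b₁ b₂ : (Fin n → ℝ) → Fin n → ℝ) :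
    Prop where
  two_le : 2 ≤ n
  isOpen : IsOpen U
  le_smoothMaps : Δ ≤ smoothMaps U (Fin n → ℝ)
  subset : ψ.source ⊆ U
  contDiffOn : ContDiffOn ℝ ∞ ψ ψ.source
  contDiffOn_symm : ContDiffOn ℝ ∞ ψ.symm ψ.target
  b₁_mem : ∀ x ∈ ψ.source, b₁ x ∈ fiber Δ x
  b₂_mem : ∀ x ∈ ψ.source, b₂ x ∈ fiber Δ x
  exists_eq : ∀ x ∈ ψ.source, ∀ v ∈ fiber Δ x, ∃ s t : ℝ, v = s • b₁ x + t • b₂ x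
  b₁_coord : ∀ x ∈ ψ.source, ∀ i, i + 3 ≤ n →
    fderiv ℝ (coord ψ i) x (b₁ x) = coord ψ (i + 1) x
  b₁_coord_sub_one : ∀ x ∈ ψ.source, fderiv ℝ (coord ψ (n - 1)) x (b₁ x) = 1
  b₂_coord : ∀ x ∈ ψ.source, ∀ i, i + 3 ≤ n → fderiv ℝ (coord ψ i) x (b₂ x) = 0
  b₂_coord_sub_two : ∀ x ∈ ψ.source, fderiv ℝ (coord ψ (n - 2)) x (b₂ x) = 1
  b₂_coord_sub_one : ∀ x ∈ ψ.source, fderiv ℝ (coord ψ (n - 1)) x (b₂ x) = 0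

theorem fderiv_coord {x : Fin n → ℝ} (h : DifferentiableAt ℝ ψ x) {i : ℕ} (hi : i < n)
    (v : Fin n → ℝ) : fderiv ℝ (coord ψ i) x v = fderiv ℝ ψ x v ⟨i, hi⟩ := by
  have h1 : coord ψ i = fun x => ψ x ⟨i, hi⟩ := by
    ext x
    rw [coord, dif_pos hi]
  rw [h1, (hasFDerivAt_pi'.1 h.hasFDerivAt ⟨i, hi⟩).fderiv]
  rfl

namespace IsChainedFrame

variable (C : IsChainedFrame Δ ψ b₁ b₂) {q : Fin n → ℝ} {k : ℕ}
include C

theorem contDiffOn_coord (i : ℕ) : ContDiffOn ℝ ∞ (coord ψ i) ψ.source := by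
  unfold coord
  split_ifs with h
  · exact contDiffOn_pi.1 C.contDiffOn _
  · exact contDiffOn_const

theorem contDiffAt_coord (hq : q ∈ ψ.source) (i : ℕ) : ContDiffAt ℝ ∞ (coord ψ i) q :=
  (C.contDiffOn_coord i).contDiffAt (ψ.open_source.mem_nhds hq)

theorem differentiableAt (hq : q ∈ ψ.source) : DifferentiableAt ℝ ψ q :=
  (C.contDiffOn.contDiffAt (ψ.open_source.mem_nhds hq)).differentiableAt (by simp)

theorem differentiableAt_symm (hq : q ∈ ψ.source) : DifferentiableAt ℝ ψ.symm (ψ q) :=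
  (C.contDiffOn_symm.contDiffAt (ψ.open_target.mem_nhds (ψ.map_source hq))).differentiableAt
    (by simp)

theorem contDiffOn_chartForm (i : ℕ) : ContDiffOn ℝ ∞ (chartForm ψ i) ψ.source :=
  contDiffOn_contactForm ψ.open_source (C.contDiffOn_coord _) (C.contDiffOn_coord _)
    (C.contDiffOn_coord _)

theorem fderiv_coordField (hq : q ∈ ψ.source) (c : Fin n → ℝ) :
    fderiv ℝ ψ q (coordField ψ c q) = c := by
  have h1 : ψ ∘ ψ.symm =ᶠ[𝓝 (ψ q)] id := by
    filter_upwards [ψ.open_target.mem_nhds (ψ.map_source hq)] with x hx using ψ.right_inv hx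
  have h2 := h1.fderiv_eq (𝕜 := ℝ)
  rw [fderiv_comp (ψ q) (by rw [ψ.left_inv hq]; exact C.differentiableAt hq)
    (C.differentiableAt_symm hq), fderiv_id, ψ.left_inv hq] at h2
  exact congrArg (fun L : (Fin n → ℝ) →L[ℝ] (Fin n → ℝ) => L c) h2

theorem coordField_fderiv (hq : q ∈ ψ.source) (v : Fin n → ℝ) :
    coordField ψ (fderiv ℝ ψ q v) q = v := by
  have h1 : ψ.symm ∘ ψ =ᶠ[𝓝 q] id := by
    filter_upwards [ψ.open_source.mem_nhds hq] with x hx using ψ.left_inv hx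
  have h2 := h1.fderiv_eq (𝕜 := ℝ)
  rw [fderiv_comp q (C.differentiableAt_symm hq) (C.differentiableAt hq), fderiv_id] at h2
  exact congrArg (fun L : (Fin n → ℝ) →L[ℝ] (Fin n → ℝ) => L v) h2

theorem fderiv_coord_coordField (hq : q ∈ ψ.source) {i : ℕ} (hi : i < n) (c : Fin n → ℝ) :
    fderiv ℝ (coord ψ i) q (coordField ψ c q) = c ⟨i, hi⟩ := by
  rw [fderiv_coord (C.differentiableAt hq) hi, C.fderiv_coordField hq]

theorem contDiffOn_coordField (c : Fin n → ℝ) : ContDiffOn ℝ ∞ (coordField ψ c) ψ.source :=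
  ((C.contDiffOn_symm.fderiv_of_isOpen ψ.open_target le_rfl).comp C.contDiffOn
    fun _ hx => ψ.map_source hx).clm_apply contDiffOn_const

theorem eq_zero_of_fderiv_coord (hq : q ∈ ψ.source) {v : Fin n → ℝ}
    (h : ∀ i < n, fderiv ℝ (coord ψ i) q v = 0) : v = 0 := by
  have h1 : fderiv ℝ ψ q v = 0 := by
    ext i
    rw [← fderiv_coord (C.differentiableAt hq) i.2, h i i.2, Pi.zero_apply]
  rw [← C.coordField_fderiv hq v, h1, coordField, map_zero]

theorem curl_chartForm (hq : q ∈ ψ.source) (i : ℕ) (v w : Fin n → ℝ) :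
    curl (chartForm ψ i) q v w =
      fderiv ℝ (coord ψ (i + 1)) q w * fderiv ℝ (coord ψ (n - 1)) q v -
      fderiv ℝ (coord ψ (i + 1)) q v * fderiv ℝ (coord ψ (n - 1)) q w :=
  curl_contactForm (C.contDiffAt_coord hq _) (C.contDiffAt_coord hq _) (C.contDiffAt_coord hq _)
    v w

theorem differentiableAt_chartForm (hq : q ∈ ψ.source) (i : ℕ) :
    DifferentiableAt ℝ (chartForm ψ i) q :=
  ((C.contDiffOn_chartForm i).contDiffAt (ψ.open_source.mem_nhds hq)).differentiableAt (by simp)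

theorem differentiableAt_field (hq : q ∈ ψ.source) {X : (Fin n → ℝ) → Fin n → ℝ}
    (hX : X ∈ derivedFlag Δ k) : DifferentiableAt ℝ X q :=
  differentiableAt_of_mem_smoothMaps C.isOpen
    (derivedFlag_le_smoothMaps Δ C.isOpen C.le_smoothMaps k hX) (C.subset hq)

theorem fiber_le_contactKer (hq : q ∈ ψ.source) : fiber Δ q ≤ contactKer ψ 0 q := by
  intro v hv
  rw [mem_contactKer]
  intro i hi
  obtain ⟨s, t, rfl⟩ := C.exists_eq q hq v hv
  rw [chartForm, contactForm_apply]
  simp only [map_add, map_smul, smul_eq_mul, C.b₁_coord q hq i hi, C.b₁_coord_sub_one q hq,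
    C.b₂_coord q hq i hi, C.b₂_coord_sub_one q hq]
  ring

theorem chartForm_lieBracket (hq : q ∈ ψ.source) {i : ℕ} (hi : i + k + 3 ≤ n)
    (h : ∀ x ∈ ψ.source, fiber (derivedFlag Δ k) x ≤ contactKer ψ k x)
    {X Y : (Fin n → ℝ) → Fin n → ℝ} (hX : X ∈ derivedFlag Δ k) (hY : Y ∈ derivedFlag Δ k) :
    chartForm ψ i q (lieBracket ℝ X Y q) =
      fderiv ℝ (coord ψ (i + 1)) q (X q) * fderiv ℝ (coord ψ (n - 1)) q (Y q) -
      fderiv ℝ (coord ψ (i + 1)) q (Y q) * fderiv ℝ (coord ψ (n - 1)) q (X q) := by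
  have h0 : ∀ X ∈ derivedFlag Δ k, ∀ᶠ x in 𝓝 q, chartForm ψ i x (X x) = 0 := fun X hX => by
    filter_upwards [ψ.open_source.mem_nhds hq] with x hx
      using mem_contactKer.1 (h x hx (mem_fiber hX x)) i hi
  rw [apply_lieBracket_eq_neg_curl (C.differentiableAt_chartForm hq i)
    (C.differentiableAt_field hq hX) (C.differentiableAt_field hq hY) (h0 X hX) (h0 Y hY),
    C.curl_chartForm hq]
  ring

/-- The contact forms with index at most `n - 3 - k` annihilate the `k`-th member of the derived
flag: `d(dz_i - z_{i+1} dz_{n-1}) = -dz_{i+1} ∧ dz_{n-1}` vanishes on the kernel of the next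
contact form. -/
theorem fiber_derivedFlag_le (k : ℕ) :
    ∀ q ∈ ψ.source, fiber (derivedFlag Δ k) q ≤ contactKer ψ k q := by
  induction k with
  | zero => exact fun q hq => C.fiber_le_contactKer hq
  | succ k ih =>
    intro q hq
    refine fiber_sup_bracket_le (fun v hv => ?_) fun X hX Y hY => ?_
    · exact mem_contactKer.2 fun i hi => mem_contactKer.1 (ih q hq hv) i (by omega)
    · refine mem_contactKer.2 fun i hi => ?_
      have h1 := mem_contactKer.1 (ih q hq (mem_fiber hX q)) (i + 1) (by omega)
      have h2 := mem_contactKer.1 (ih q hq (mem_fiber hY q)) (i + 1) (by omega)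
      rw [chartForm, contactForm_apply, sub_eq_zero] at h1 h2
      rw [C.chartForm_lieBracket hq (by omega) ih hX hY, h1, h2]
      ring

theorem finrank_contactKer_le (hk : k + 2 ≤ n) (hq : q ∈ ψ.source) :
    finrank ℝ (contactKer ψ k q) ≤ k + 2 := by
  -- a vector of `contactKer ψ k q` is determined by its last `k + 2` coordinates
  let T : (Fin n → ℝ) →ₗ[ℝ] (Fin (k + 2) → ℝ) := LinearMap.pi fun j =>
    (fderiv ℝ (coord ψ (n - 2 - k + j)) q : (Fin n → ℝ) →ₗ[ℝ] ℝ)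
  have hT : Function.Injective (T ∘ₗ (contactKer ψ k q).subtype) := by
    rw [← LinearMap.ker_eq_bot, LinearMap.ker_eq_bot']
    rintro ⟨v, hv⟩ h
    have h1 : ∀ i < n, n - 2 - k ≤ i → fderiv ℝ (coord ψ i) q v = 0 := fun i hi hi' => by
      have h2 := congrFun h ⟨i - (n - 2 - k), by omega⟩
      have h3 : n - 2 - k + (i - (n - 2 - k)) = i := by omega
      simpa [T, h3] using h2
    refine Subtype.ext (C.eq_zero_of_fderiv_coord hq fun i hi => ?_)
    by_cases hik : n - 2 - k ≤ i
    · exact h1 i hi hik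
    · have h2 := mem_contactKer.1 hv i (by omega)
      rwa [chartForm, contactForm_apply, h1 (n - 1) (by omega) (by omega), mul_zero,
        sub_zero] at h2
  simpa using LinearMap.finrank_le_finrank_of_injective hT

theorem two_le_finrank_fiber (hq : q ∈ ψ.source) : 2 ≤ finrank ℝ (fiber Δ q) := by
  have h2 : b₂ q ≠ 0 := fun h => by
    have := C.b₂_coord_sub_two q hq
    rw [h, map_zero] at this
    exact zero_ne_one this
  have h1 : Submodule.span ℝ {b₂ q} < fiber Δ q := by
    refine lt_of_le_of_ne ((Submodule.span_singleton_le_iff_mem _ _).2 (C.b₂_mem q hq)) fun h => ?_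
    have h3 := C.b₁_mem q hq
    rw [← h] at h3
    obtain ⟨s, hs⟩ := Submodule.mem_span_singleton.1 h3
    have := C.b₁_coord_sub_one q hq
    rw [← hs, map_smul, C.b₂_coord_sub_one q hq, smul_zero] at this
    exact zero_ne_one this
  have h3 := Submodule.finrank_lt_finrank_of_lt h1
  rw [finrank_span_singleton h2] at h3
  exact h3

theorem coordField_mem_contactKer (hq : q ∈ ψ.source) {c : Fin n → ℝ}
    (hc : ∀ j : Fin n, j.val + k + 3 ≤ n ∨ j.val + 1 = n → c j = 0) :
    coordField ψ c q ∈ contactKer ψ k q := by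
  have hn := C.two_le
  refine mem_contactKer.2 fun i hi => ?_
  rw [chartForm, contactForm_apply, C.fderiv_coord_coordField hq (by omega : i < n),
    C.fderiv_coord_coordField hq (by omega : n - 1 < n), hc _ (Or.inl hi),
    hc _ (Or.inr (by simp; omega)), mul_zero, sub_zero]

/-- Bracketing `∂_{n-2-k}` with `b₁` yields a direction `∂_{n-3-k}` that is new in the Lie flag, so
that the flags grow by exactly one dimension at each step. -/
theorem fiber_lieFlag (hq : q ∈ ψ.source) (k : ℕ) (hk : k + 2 ≤ n) :
    fiber (lieFlag Δ k) q = contactKer ψ k q ∧ finrank ℝ (fiber (lieFlag Δ k) q) = 2 + k := by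
  have hn := C.two_le
  have hle : ∀ k, fiber (lieFlag Δ k) q ≤ contactKer ψ k q := fun k =>
    (fiber_mono (lieFlag_le_derivedFlag Δ k) q).trans (C.fiber_derivedFlag_le k q hq)
  have hfin : ∀ k, k + 2 ≤ n → 2 + k ≤ finrank ℝ (fiber (lieFlag Δ k) q) →
      fiber (lieFlag Δ k) q = contactKer ψ k q ∧
        finrank ℝ (fiber (lieFlag Δ k) q) = 2 + k := fun k hk h => by
    have h1 := C.finrank_contactKer_le hk hq
    have h2 := Submodule.finrank_mono (hle k)
    exact ⟨Submodule.eq_of_le_of_finrank_le (hle k) (by omega), by omega⟩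
  induction k with
  | zero => exact hfin 0 hk (C.two_le_finrank_fiber hq)
  | succ k ih =>
    obtain ⟨h1, h2⟩ := ih (by omega)
    refine hfin (k + 1) hk ?_
    let j : Fin n := ⟨n - 2 - k, by omega⟩
    have hmem : coordField ψ (Pi.single j 1) q ∈ fiber (lieFlag Δ k) q := by
      rw [h1]
      refine C.coordField_mem_contactKer hq fun l hl => Pi.single_eq_of_ne (fun h => ?_) 1
      rw [h] at hl
      simp only [j] at hl
      omega
    obtain ⟨X, hX, hXq⟩ := hmem
    obtain ⟨Y, hY, hYq⟩ := C.b₁_mem q hq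
    have hlt : fiber (lieFlag Δ k) q < fiber (lieFlag Δ (k + 1)) q := by
      refine lt_of_le_of_ne (fiber_mono le_sup_left q) fun h => ?_
      have h3 : lieBracket ℝ X Y q ∈ contactKer ψ k q := by
        rw [← h1, h]
        exact mem_fiber (Submodule.mem_sup_right (lieBracket_mem_bracket hX hY)) q
      have h4 := mem_contactKer.1 h3 (n - 3 - k) (by omega)
      have h5 : n - 3 - k + 1 = j := by simp only [j]; omega
      rw [C.chartForm_lieBracket hq (by omega) (C.fiber_derivedFlag_le k)
        (lieFlag_le_derivedFlag Δ k hX) (derivedFlag_mono Δ (Nat.zero_le k) hY), hXq, hYq,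
        C.b₁_coord_sub_one q hq, h5, C.fderiv_coord_coordField hq j.2,
        C.fderiv_coord_coordField hq (by omega : n - 1 < n), Pi.single_eq_same,
        Pi.single_eq_of_ne (fun h => ?_) 1] at h4
      · simp at h4
      · have := congrArg Fin.val h
        simp only [j] at this
        omega
    have := Submodule.finrank_lt_finrank_of_lt hlt
    omega

/-- The annihilator of the `k`-th member of the derived flag is spanned by the contact forms with
index at most `n - 3 - k`. -/
theorem fiber_derivedFlag (hq : q ∈ ψ.source) (hk : k + 2 ≤ n) :
    fiber (derivedFlag Δ k) q = contactKer ψ k q :=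
  le_antisymm (C.fiber_derivedFlag_le k q hq)
    ((C.fiber_lieFlag hq k hk).1 ▸ fiber_mono (lieFlag_le_derivedFlag Δ k) q)

theorem finrank_fiber_derivedFlag (hq : q ∈ ψ.source) (hk : k + 2 ≤ n) :
    finrank ℝ (fiber (derivedFlag Δ k) q) = 2 + k := by
  rw [C.fiber_derivedFlag hq hk, ← (C.fiber_lieFlag hq k hk).1, (C.fiber_lieFlag hq k hk).2]

/-- A Cauchy characteristic vector of the `k`-th member of the derived flag has no component along
`∂_0, …, ∂_{n-2-k}` and `∂_{n-1}`. -/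
theorem fderiv_coord_of_mem_cauchyCharSpace (hq : q ∈ ψ.source) (hk : 1 ≤ k) (hkn : k + 3 ≤ n)
    {v : Fin n → ℝ} (hv : v ∈ cauchyCharSpace (annihilator (derivedFlag Δ k)) q) :
    (∀ i, i + k + 2 ≤ n → fderiv ℝ (coord ψ i) q v = 0) ∧
      fderiv ℝ (coord ψ (n - 1)) q v = 0 := by
  have key : ∀ i, i + k + 3 ≤ n → chartForm ψ i q v = 0 ∧
      ∀ w ∈ fiber (derivedFlag Δ k) q, curl (chartForm ψ i) q v w = 0 := by
    intro i hi
    obtain ⟨η, hη, he⟩ := exists_mem_annihilator_eventuallyEq (Δ := derivedFlag Δ k)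
      ψ.open_source hq (C.contDiffOn_chartForm i)
      fun x hx w hw => mem_contactKer.1 (C.fiber_derivedFlag_le k x hx hw) i hi
    obtain ⟨h1, _, ⟨ζ, hζ, rfl⟩, h2⟩ := hv η hη
    refine ⟨he.self_of_nhds ▸ h1, fun w hw => ?_⟩
    have h3 := h2 w
    rwa [extDerivOneForm_apply (differentiableAt_of_mem_smoothMaps C.isOpen hη.1 (C.subset hq)),
      apply_eq_zero_of_mem_annihilator hζ (C.subset hq) hw, he.fderiv_eq] at h3
  have hlast : fderiv ℝ (coord ψ (n - 1)) q v = 0 := by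
    let j : Fin n := ⟨n - 2 - k, by omega⟩
    have hmem : coordField ψ (Pi.single j 1) q ∈ fiber (derivedFlag Δ k) q := by
      rw [C.fiber_derivedFlag hq (by omega)]
      refine C.coordField_mem_contactKer hq fun l hl => Pi.single_eq_of_ne (fun h => ?_) 1
      rw [h] at hl
      simp only [j] at hl
      omega
    have h1 := (key (n - 3 - k) (by omega)).2 _ hmem
    have h5 : n - 3 - k + 1 = j := by simp only [j]; omega
    rw [C.curl_chartForm hq, h5, C.fderiv_coord_coordField hq j.2,
      C.fderiv_coord_coordField hq (by omega : n - 1 < n), Pi.single_eq_same,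
      Pi.single_eq_of_ne (fun h => ?_) 1] at h1
    · simpa using h1
    · have := congrArg Fin.val h
      simp only [j] at this
      omega
  refine ⟨fun i hi => ?_, hlast⟩
  rcases i with _ | i
  · have h1 := (key 0 (by omega)).1
    rwa [chartForm, contactForm_apply, hlast, mul_zero, sub_zero] at h1
  · have h1 := (key i (by omega)).2 (b₁ q)
      (fiber_mono (derivedFlag_mono Δ (Nat.zero_le k)) q (C.b₁_mem q hq))
    rw [C.curl_chartForm hq, hlast, C.b₁_coord_sub_one q hq] at h1
    simpa using h1

/-- The bracket of `f` with a field that is constant in the chart and has no component along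
`∂_{i+1}` is seen by the `i`-th contact form through the drift `⟨θ_i, f⟩` only. -/
theorem chartForm_lieBracket_coordField {f : (Fin n → ℝ) → Fin n → ℝ}
    (hf : ContDiffOn ℝ ∞ f ψ.source) (hq : q ∈ ψ.source) {i : ℕ} (hi : i + 3 ≤ n)
    {c : Fin n → ℝ} (hc : c ⟨i + 1, by omega⟩ = 0) :
    chartForm ψ i q (lieBracket ℝ f (coordField ψ c) q) =
      -fderiv ℝ (fun x => chartForm ψ i x (f x)) q (coordField ψ c q) := by
  have hY := C.contDiffOn_coordField c
  have hz := C.contDiffOn_coord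
  have hd : ∀ j, DifferentiableAt ℝ (fun x => fderiv ℝ (coord ψ j) x (f x)) q := fun j =>
    ((ContDiffOn.fderiv_apply_of_isOpen ψ.open_source (hz j) hf).contDiffAt
      (ψ.open_source.mem_nhds hq)).differentiableAt (by simp)
  have hd' : DifferentiableAt ℝ (coord ψ (i + 1)) q :=
    (C.contDiffAt_coord hq _).differentiableAt (by simp)
  have h1 : fderiv ℝ (fun x => chartForm ψ i x (f x)) q = _ :=
    ((hd i).hasFDerivAt.sub (hd'.hasFDerivAt.mul (hd (n - 1)).hasFDerivAt)).fderiv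
  rw [h1, chartForm, contactForm_apply,
    fderiv_lieBracket_of_const ψ.open_source (hz _) hf hY
      (fun x hx => C.fderiv_coord_coordField hx (by omega : i < n) c) hq,
    fderiv_lieBracket_of_const ψ.open_source (hz _) hf hY
      (fun x hx => C.fderiv_coord_coordField hx (by omega : n - 1 < n) c) hq]
  have h2 := C.fderiv_coord_coordField hq (by omega : i + 1 < n) c
  rw [hc] at h2
  simp [h2]
  ring

/-- If the functions `⟨dz_i - z_{i+1} dz_{n-1}, f⟩` depend in the chart on `z_0, …, z_{i+1}` and
`z_{n-1}` only, then `L_f` maps the annihilator of the `k`-th member of the derived flag into its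
retracting space. -/
theorem lieDerivOneForm_mem_retractingSpace {f : (Fin n → ℝ) → Fin n → ℝ}
    (hf : ContDiffOn ℝ ∞ f ψ.source)
    (hdrift : ∀ q ∈ ψ.source, ∀ i, i + 3 ≤ n → ∀ c : Fin n → ℝ,
      (∀ j : Fin n, j.val ≤ i + 1 ∨ j.val + 1 = n → c j = 0) →
        fderiv ℝ (fun x => chartForm ψ i x (f x)) q (coordField ψ c q) = 0)
    (hq : q ∈ ψ.source) (hk : 1 ≤ k) (hkn : k + 3 ≤ n) {θ : (Fin n → ℝ) → (Fin n → ℝ) →L[ℝ] ℝ}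
    (hθ : θ ∈ annihilator (derivedFlag Δ k)) :
    lieDerivOneForm f θ q ∈ retractingSpace (annihilator (derivedFlag Δ k)) q := by
  intro v hv
  obtain ⟨h1, h2⟩ := C.fderiv_coord_of_mem_cauchyCharSpace hq hk hkn hv
  obtain ⟨c, rfl⟩ : ∃ c, coordField ψ c q = v := ⟨_, C.coordField_fderiv hq v⟩
  have hlast : ∀ j : Fin n, j.val + 1 = n → c j = 0 := fun j hj => by
    rw [← C.fderiv_coord_coordField hq j.2 c, show j.val = n - 1 by omega, h2]
  have hc : ∀ j : Fin n, j.val + k + 2 ≤ n → c j = 0 := fun j hj => by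
    rw [← C.fderiv_coord_coordField hq j.2 c, h1 _ hj]
  have hYd : DifferentiableAt ℝ (coordField ψ c) q :=
    ((C.contDiffOn_coordField c).contDiffAt (ψ.open_source.mem_nhds hq)).differentiableAt (by simp)
  have hθd := differentiableAt_of_mem_smoothMaps C.isOpen hθ.1 (C.subset hq)
  have hθY : ∀ᶠ x in 𝓝 q, θ x (coordField ψ c x) = 0 := by
    filter_upwards [ψ.open_source.mem_nhds hq] with x hx
    refine apply_eq_zero_of_mem_annihilator hθ (C.subset hx) ?_
    rw [C.fiber_derivedFlag hx (by omega)]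
    exact C.coordField_mem_contactKer hx fun j hj =>
      hj.elim (fun hj => hc j (by omega)) (hlast j)
  have h3 : lieDerivOneForm f θ q (coordField ψ c q) =
      -θ q (lieBracket ℝ f (coordField ψ c) q) := by
    rw [lieBracket, map_sub, fderiv_apply_eq_neg_of_eventually_eq_zero hθd hYd hθY]
    simp [lieDerivOneForm, add_comm]
  rw [h3, neg_eq_zero]
  refine apply_eq_zero_of_mem_annihilator hθ (C.subset hq) ?_
  rw [C.fiber_derivedFlag hq (by omega), mem_contactKer]
  intro i hi
  rw [C.chartForm_lieBracket_coordField hf hq (by omega) (hc _ (by simp; omega)),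
    hdrift q hq i (by omega) c fun j hj =>
      hj.elim (fun hj => hc j (by omega)) (hlast j), neg_zero]

end IsChainedFrame

/-- A triangular drift has no derivative in directions on which it does not depend. -/
theorem IsTriangularDrift.fderiv_apply_eq_zero {O : Set (Fin n → ℝ)} (hO : IsOpen O)
    {φ : Fin n → (Fin n → ℝ) → ℝ} (hφ : IsTriangularDrift O φ) {i : Fin n} (hi : i.val + 2 < n)
    {z : Fin n → ℝ} (hz : z ∈ O) {c : Fin n → ℝ}
    (hc : ∀ j : Fin n, j.val ≤ i.val + 1 ∨ j.val + 1 = n → c j = 0) :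
    fderiv ℝ (φ i) z c = 0 := by
  obtain ⟨h1, h2⟩ := hφ i hi
  have h3 := ((h1.contDiffAt (hO.mem_nhds hz)).differentiableAt
    (by simp)).hasFDerivAt.hasLineDerivAt c
  have h4 : (fun t : ℝ => φ i (z + t • c)) =ᶠ[𝓝 0] fun _ => φ i z := by
    have h5 : ContinuousAt (fun t : ℝ => z + t • c) 0 := by fun_prop
    filter_upwards [h5.preimage_mem_nhds (hO.mem_nhds (by simpa using hz))] with t ht
    exact h2 _ ht _ hz fun j hj => by simp [hc j hj]
  exact h3.unique ((hasDerivAt_const (0 : ℝ) (φ i z)).congr_of_eventuallyEq h4)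

/-- A triangularizable system satisfies the conditions on the whole domain of the coordinates. -/
theorem regular_of_isLocallyTriangularizable (hn : 2 ≤ n) (hU : IsOpen U)
    {f g₁ g₂ : (Fin n → ℝ) → Fin n → ℝ} (hf : ContDiffOn ℝ ∞ f U)
    (hg₁ : ContDiffOn ℝ ∞ g₁ U) (hg₂ : ContDiffOn ℝ ∞ g₂ U) {p : Fin n → ℝ}
    (h : IsLocallyTriangularizable U f g₁ g₂ p) :
    ∃ W : Set (Fin n → ℝ), IsOpen W ∧ p ∈ W ∧ W ⊆ U ∧
      (∀ k : ℕ, k + 2 ≤ n → ∀ q ∈ W,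
        finrank ℝ (fiber (lieFlag (distributionSpan U g₁ g₂) k) q) = 2 + k ∧
        finrank ℝ (fiber (derivedFlag (distributionSpan U g₁ g₂) k) q) = 2 + k) ∧
      (∀ k : ℕ, 1 ≤ k → k + 3 ≤ n → ∀ q ∈ W,
        ∀ θ ∈ annihilator (derivedFlag (distributionSpan U g₁ g₂) k),
          lieDerivOneForm f θ q ∈
            retractingSpace (annihilator (derivedFlag (distributionSpan U g₁ g₂) k)) q) := by
  obtain ⟨ψ, α, β, φ, hp, hsub, hψ, hψs, -, -, hβ, hφ, hcl⟩ := h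
  let b : Fin 2 → (Fin n → ℝ) → Fin n → ℝ := fun m x => β x 0 m • g₁ x + β x 1 m • g₂ x
  have hg₁m : ∀ x, g₁ x ∈ fiber (distributionSpan U g₁ g₂) x :=
    mem_fiber (left_mem_distributionSpan U g₁ g₂)
  have hg₂m : ∀ x, g₂ x ∈ fiber (distributionSpan U g₁ g₂) x :=
    mem_fiber (right_mem_distributionSpan U g₁ g₂)
  have hψd : ∀ x ∈ ψ.source, DifferentiableAt ℝ ψ x := fun x hx =>
    (hψ.contDiffAt (ψ.open_source.mem_nhds hx)).differentiableAt (by simp)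
  have hzero : ∀ x ∈ ψ.source,
      fderiv ℝ ψ x (f x + α x 0 • g₁ x + α x 1 • g₂ x) = triangularField φ (ψ x) 0 :=
    fun x hx => hcl x hx 0 (α x) (by simp)
  -- the closed-loop equation is affine in `v`; its linear part gives the frame
  have hb : ∀ x ∈ ψ.source, ∀ m, fderiv ℝ ψ x (b m x) =
      triangularField φ (ψ x) (Pi.single m 1) - triangularField φ (ψ x) 0 := by
    intro x hx m
    rw [← hzero x hx, ← hcl x hx (Pi.single m 1) (α x + (β x).mulVec (Pi.single m 1)) rfl,
      ← map_sub]
    congr 1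
    simp only [b, Matrix.mulVec_single_one, Pi.add_apply, Matrix.col_apply]
    module
  have C : IsChainedFrame (distributionSpan U g₁ g₂) ψ (b 0) (b 1) := by
    have hco : ∀ x ∈ ψ.source, ∀ m i (hi : i < n), fderiv ℝ (coord ψ i) x (b m x) =
        triangularField φ (ψ x) (Pi.single m 1) ⟨i, hi⟩ - triangularField φ (ψ x) 0 ⟨i, hi⟩ := by
      intro x hx m i hi
      rw [fderiv_coord (hψd x hx) hi, hb x hx m, Pi.sub_apply]
    have hbm : ∀ m x, b m x ∈ fiber (distributionSpan U g₁ g₂) x := fun m x =>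
      add_mem (Submodule.smul_mem _ _ (hg₁m x)) (Submodule.smul_mem _ _ (hg₂m x))
    refine ⟨hn, hU, distributionSpan_le_smoothMaps hg₁ hg₂, hsub, hψ, hψs, fun x _ => hbm 0 x,
      fun x _ => hbm 1 x, fun x hx v hv => ?_, fun x hx i hi => ?_, fun x hx => ?_,
      fun x hx i hi => ?_, fun x hx => ?_, fun x hx => ?_⟩
    · obtain ⟨s, t, rfl⟩ := exists_eq_of_mem_fiber_distributionSpan hv
      obtain ⟨B, hB⟩ := (hβ x hx).exists_right_inv
      have e : ∀ i j, β x i 0 * B 0 j + β x i 1 * B 1 j = (1 : Matrix (Fin 2) (Fin 2) ℝ) i j :=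
        fun i j => by rw [← hB, Matrix.mul_apply, Fin.sum_univ_two]
      have e00 := e 0 0
      have e01 := e 0 1
      have e10 := e 1 0
      have e11 := e 1 1
      simp only [Matrix.one_apply_eq, ne_eq, zero_ne_one, one_ne_zero, not_false_eq_true,
        Matrix.one_apply_ne] at e00 e01 e10 e11
      refine ⟨B 0 0 * s + B 0 1 * t, B 1 0 * s + B 1 1 * t, ?_⟩
      simp only [b]
      match_scalars
      · linear_combination (-s) * e00 - t * e01
      · linear_combination (-s) * e10 - t * e11
    · rw [hco x hx 0 i (by omega)]
      simp [triangularField, show i + 2 < n by omega, coord, show i + 1 < n by omega]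
    · rw [hco x hx 0 (n - 1) (by omega)]
      simp [triangularField, show ¬ (n - 1 + 2 < n) by omega, show n - 1 + 2 ≠ n by omega]
    · rw [hco x hx 1 i (by omega)]
      simp [triangularField, show i + 2 < n by omega]
    · rw [hco x hx 1 (n - 2) (by omega)]
      simp [triangularField, show n - 2 + 2 = n by omega]
    · rw [hco x hx 1 (n - 1) (by omega)]
      simp [triangularField, show ¬ (n - 1 + 2 < n) by omega, show n - 1 + 2 ≠ n by omega]
  refine ⟨ψ.source, ψ.open_source, hp, hsub, fun k hk q hq =>
    ⟨(C.fiber_lieFlag hq k hk).2, C.finrank_fiber_derivedFlag hq hk⟩,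
    fun k hk hkn q hq θ hθ => C.lieDerivOneForm_mem_retractingSpace (hf.mono hsub)
      (fun q hq i hi c hc => ?_) hq hk hkn hθ⟩
  have hdrift : (fun x => chartForm ψ i x (f x)) =ᶠ[𝓝 q] φ ⟨i, by omega⟩ ∘ ψ := by
    filter_upwards [ψ.open_source.mem_nhds hq] with x hx
    have h1 : ∀ v ∈ fiber (distributionSpan U g₁ g₂) x, chartForm ψ i x v = 0 := fun v hv =>
      mem_contactKer.1 (C.fiber_le_contactKer hx hv) i hi
    have h2 : chartForm ψ i x (f x + α x 0 • g₁ x + α x 1 • g₂ x) = chartForm ψ i x (f x) := by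
      simp [h1 _ (hg₁m x), h1 _ (hg₂m x)]
    rw [← h2, chartForm, contactForm_apply, fderiv_coord (hψd x hx) (by omega : i < n),
      fderiv_coord (hψd x hx) (by omega : n - 1 < n), hzero x hx]
    simp [triangularField, show i + 2 < n by omega, show ¬ (n - 1 + 2 < n) by omega,
      show n - 1 + 2 ≠ n by omega]
  have hφd : DifferentiableAt ℝ (φ ⟨i, by omega⟩) (ψ q) :=
    ((hφ ⟨i, by omega⟩ (by simp; omega)).1.contDiffAt
      (ψ.open_target.mem_nhds (ψ.map_source hq))).differentiableAt (by simp)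
  rw [hdrift.fderiv_eq, fderiv_comp q hφd (hψd q hq), ContinuousLinearMap.comp_apply,
    C.fderiv_coordField hq]
  exact hφ.fderiv_apply_eq_zero ψ.open_target (by simp; omega) (ψ.map_source hq) hc

end Necessity

end FlatTriangular

open FlatTriangular in
theorem theorem3 (n : ℕ) (hn : 2 ≤ n) (U : Set (Fin n → ℝ)) (hU : IsOpen U)
    (f g₁ g₂ : (Fin n → ℝ) → (Fin n → ℝ))
    (hf : ContDiffOn ℝ ∞ f U) (hg₁ : ContDiffOn ℝ ∞ g₁ U) (hg₂ : ContDiffOn ℝ ∞ g₂ U)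
    (p : Fin n → ℝ) (hp : p ∈ U) :
    IsLocallyTriangularizable U f g₁ g₂ p ↔
      ∃ W : Set (Fin n → ℝ), IsOpen W ∧ p ∈ W ∧ W ⊆ U ∧
        (∀ k : ℕ, k + 2 ≤ n → ∀ q ∈ W,
          Module.finrank ℝ (fiber (lieFlag (distributionSpan U g₁ g₂) k) q) = 2 + k ∧
          Module.finrank ℝ (fiber (derivedFlag (distributionSpan U g₁ g₂) k) q) = 2 + k) ∧
        (∀ k : ℕ, 1 ≤ k → k + 3 ≤ n → ∀ q ∈ W,
          ∀ θ ∈ annihilator (derivedFlag (distributionSpan U g₁ g₂) k),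
            lieDerivOneForm f θ q ∈
              retractingSpace (annihilator (derivedFlag (distributionSpan U g₁ g₂) k)) q) := by
  refine ⟨regular_of_isLocallyTriangularizable hn hU hf hg₁ hg₂, ?_⟩
  rintro ⟨W, hW, hpW, hWU, hrank, hcond⟩
  refine isLocallyTriangularizable_of_regular hn hf hg₁ hg₂ hpW
    ⟨hU, hW, hWU, distributionSpan_le_smoothMaps hg₁ hg₂, fun k hk q hq => ?_,
      fun k hk q hq => ?_⟩ hcond
  · exact (hrank k (by rwa [Module.finrank_fin_fun] at hk) q hq).1
  · exact (hrank k (by rwa [Module.finrank_fin_fun] at hk) q hq).2
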